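/- Let $K$ be a field; all vector spaces and tensor products are over $K$. For a homogeneous element $x$ of a graded space write $|x|$ for its degree. **Grafting algebras.** A grafting algebra is a graded vector space $A=\bigoplus_{n\ge 0}A_n$ with bilinear operations $\bullet_i\colon A\otimes A_m\to A$, $0\le i\le m$, with $A_n\bullet_i A_m\subseteq A_{n+m}$, such that for homogeneous elements $$(x\bullet_i y)\bullet_j z=x\bullet_{i+j}(y\bullet_j z)\quad(0\le i\le|y|,\ 0\le j\le|z|),$$ $$x\bullet_i(y\bullet_j z)=y\bullet_{j+|x|}(x\bullet_i z)\quad(0\le i<j\le|z|).$$ **Grafting bialgebras.** A grafting bialgebra is a grafting algebra $H$ with $H_0=0$ and with a coassociative linear map $\Delta\colon H\to H\otimes H$ satisfying $\Delta(H_n)\subseteq\bigoplus_{i+j=n}H_i\otimes H_j$, such that, with $\Delta(x)=\sum x_{(1)}\otimes x_{(2)}$ (all components homogeneous), for homogeneous $x,y$, 1. $\Delta(x\bullet_0y)=\sum x_{(1)}\otimes(x_{(2)}\bullet_0y)+x\otimes y+\sum(x\bullet_0y_{(1)})\otimes y_{(2)}$; 2. for $1\le i<|y|$: $\Delta(x\bullet_iy)=\sum_{|y_{(1)}|\le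 i}y_{(1)}\otimes(x\bullet_{i-|y_{(1)}|}y_{(2)})+\sum_{|y_{(1)}|=i}(x_{(1)}\bullet_iy_{(1)})\otimes(x_{(2)}\bullet_0y_{(2)})+\sum_{|y_{(1)}|\ge i}(x\bullet_iy_{(1)})\otimes y_{(2)}$; 3. $\Delta(x\bullet_{|y|}y)=\sum y_{(1)}\otimes(x\bullet_{|y_{(2)}|}y_{(2)})+y\otimes x+\sum(x_{(1)}\bullet_{|y|}y)\otimes x_{(2)}$. Let $\mathrm{Prim}(H)=\ker\Delta$. Put $F_1=\mathrm{Prim}(H)$ and $F_{p+1}=\{x\mid\Delta(x)\in F_p\otimes F_p\}$ for $p\ge 1$; $H$ is connected if $H=\bigcup_{p\ge 1}F_p$. Isomorphisms of grafting bialgebras are the linear isomorphisms that preserve the grading, all the operations $\bullet_i$ and $\Delta$. **$\mathcal{P}rim_{gr}$ algebras.** A $\mathcal{P}rim_{gr}$ algebra is a graded vector space $V=\bigoplus_{n\ge 1}V_n$ with degree-preserving bilinear operations $\{-,-\}\colon V\otimes V\to V$ and $\bullet_p\colon V\otimes V_n\to V$, $1\le p<n$, such that for homogeneous $x,y,z$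 1. $\{\{x,y\},z\}=\{x,\{y,z\}\}+y\bullet_{|x|}\{x,z\}$; 2. $\{x\bullet_py,z\}=x\bullet_p\{y,z\}$ for $1\le p<|y|$; 3. $\{x,y\bullet_pz\}=y\bullet_{|x|+p}\{x,z\}$ for $1\le p<|z|$; 4. $\{x,y\}\bullet_pz=y\bullet_{|x|+p}(x\bullet_pz)-x\bullet_p(y\bullet_pz)$ for $1\le p<|z|$; 5. $(x\bullet_py)\bullet_qz=x\bullet_{p+q}(y\bullet_qz)$ for $1\le p<|y|$, $1\le q<|z|$; 6. $x\bullet_p(y\bullet_qz)=y\bullet_{|x|+q}(x\bullet_pz)$ for $1\le p<q<|z|$. Isomorphisms of $\mathcal{P}rim_{gr}$ algebras are the linear isomorphisms that preserve the grading, the bracket and all the $\bullet_p$. Every grafting algebra $A$ with $A_0=0$ is a $\mathcal{P}rim_{gr}$ algebra for its operations $\bullet_p$, $1\le p<n$, and the bracket $\{x,y\}=y\bullet_{|x|}x-x\bullet_0y$; if $H$ is a grafting bialgebra, then $\mathrm{Prim}(H)$ is a $\mathcal{P}rim_{gr}$ subalgebra of $H$. **The enveloping bialgebra.** Let $V$ be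 a $\mathcal{P}rim_{gr}$ algebra, with operations written $[-,-]$ and $\circ_p$, and let $X$ be a basis of $V$ consisting of homogeneous elements. The free grafting algebra $K[T_{\infty,X}]$ has as basis the planar rooted trees, different from the trivial tree $|$, whose internal vertices are coloured by elements of $X$, a vertex coloured by $x$ having $|x|+1$ inputs; the degree of a tree is its number of leaves minus one, $s\bullet_it$ is the tree obtained by grafting the root of $s$ on the $i$-th leaf of $t$ (the leaves being numbered $0,\dots,|t|$ from left to right), and $x\in X$ is identified with the corolla coloured by $x$. It is a grafting bialgebra for the coproduct $\Delta$ for which the elements of $X$ are primitive; explicitly, $\Delta$ is given by $\Delta_+(t)=\Delta(t)+t\otimes|+|\otimes t$, where $\Delta_+(|)=|\otimes|$ and, for the tree $\bigvee_x(t^0,\dots,t^n)$ with root coloured by $x\in X$, $n=|x|$, $$\Delta_+\Big(\bigvee\nolimits_x(t^0,\dots,t^n)\Big)=\sum t^0_{(1)}\otimes\bigvee\nolimits_x(t^0_{(2)},t^1,\dots,t^n)+\sum\bigvee\nolimits_x(t^0,\dots,t^{n-1},t^n_{(1)})\otimes t^n_{(2)}.$$ The universal enveloping grafting bialgebra $\mathcal{U}_{Gr}(V)$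 is the quotient of $K[T_{\infty,X}]$ by the ideal generated by the elements $\{x,y\}-[x,y]$ for $x,y\in X$, and $x\bullet_py-x\circ_py$ for $x,y\in X$ and $1\le p<|y|$; here $[x,y]$ and $x\circ_py$ are elements of $V$, viewed as linear combinations of elements of $X$. The coproduct of $K[T_{\infty,X}]$ induces a grafting bialgebra structure on $\mathcal{U}_{Gr}(V)$. **Theorem.** a) Let $H$ be a connected grafting bialgebra. For every homogeneous basis of the $\mathcal{P}rim_{gr}$ algebra $\mathrm{Prim}(H)$, $H$ is isomorphic, as a grafting bialgebra, to $\mathcal{U}_{Gr}(\mathrm{Prim}(H))$. b) Let $V$ be a $\mathcal{P}rim_{gr}$ algebra. For every homogeneous basis of $V$, $V$ is isomorphic, as a $\mathcal{P}rim_{gr}$ algebra, to $\mathrm{Prim}(\mathcal{U}_{Gr}(V))$. -/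

import Mathlib

open scoped TensorProduct

namespace GraftingCMM

/-- A grading of the vector space `V` by the natural numbers, `V = ⨁ₙ Vₙ`. -/
structure Grading (K V : Type*) [Field K] [AddCommGroup V] [Module K V] where
  deg : ℕ → Submodule K V
  isInternal : DirectSum.IsInternal deg

namespace Grading

variable {K V : Type*} [Field K] [AddCommGroup V] [Module K V]

/-- The decomposition isomorphism `V ≃ ⨁ₙ Vₙ`. -/
noncomputable def decomp (G : Grading K V) : V ≃ₗ[K] DirectSum ℕ fun n => G.deg n :=
  (LinearEquiv.ofBijective (DirectSum.coeLinearMap G.deg)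
    (show Function.Bijective (DirectSum.coeLinearMap G.deg) from G.isInternal)).symm

/-- The projection of `V` onto its homogeneous component of degree `n`. -/
noncomputable def proj (G : Grading K V) (n : ℕ) : V →ₗ[K] V :=
  (G.deg n).subtype ∘ₗ DirectSum.component K ℕ (fun m => G.deg m) n ∘ₗ
    G.decomp.toLinearMap

theorem proj_mem (G : Grading K V) (n : ℕ) (x : V) : G.proj n x ∈ G.deg n := by
  simp [proj]

theorem decomp_of_mem (G : Grading K V) {n : ℕ} {x : V} (hx : x ∈ G.deg n) :
    G.decomp x = DirectSum.lof K ℕ (fun m => G.deg m) n ⟨x, hx⟩ := by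
  rw [decomp, LinearEquiv.symm_apply_eq]
  simp [DirectSum.coeLinearMap_lof]

theorem proj_of_mem (G : Grading K V) {n : ℕ} {x : V} (hx : x ∈ G.deg n) :
    G.proj n x = x := by
  simp [proj, decomp_of_mem G hx, DirectSum.component.lof_self]

theorem proj_of_mem_ne (G : Grading K V) {n m : ℕ} {x : V} (hx : x ∈ G.deg n) (h : n ≠ m) :
    G.proj m x = 0 := by
  simp [proj, decomp_of_mem G hx, DirectSum.component.of, h]

theorem homogeneous_induction (G : Grading K V) {p : V → Prop}
    (mem : ∀ n, ∀ x ∈ G.deg n, p x) (add : ∀ x y, p x → p y → p (x + y)) (x : V) : p x := by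
  have hx : x ∈ ⨆ n, G.deg n := by
    rw [G.isInternal.submodule_iSup_eq_top]; trivial
  exact Submodule.iSup_induction _ (motive := p) hx mem (mem 0 0 (Submodule.zero_mem _)) add

theorem sum_proj (G : Grading K V) (x : V) :
    ∃ N, ∀ M, N ≤ M → ∑ n ∈ Finset.range M, G.proj n x = x := by
  refine G.homogeneous_induction (p := fun x => ∃ N, ∀ M, N ≤ M →
    ∑ n ∈ Finset.range M, G.proj n x = x) ?_ ?_ x
  · intro n x hx
    refine ⟨n + 1, fun M hM => ?_⟩
    rw [Finset.sum_eq_single n, G.proj_of_mem hx]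
    · intro b _ hb
      exact G.proj_of_mem_ne hx (Ne.symm hb)
    · intro h
      exact absurd (Finset.mem_range.2 (by omega)) h
  · rintro x y ⟨N, hN⟩ ⟨N', hN'⟩
    refine ⟨max N N', fun M hM => ?_⟩
    simp only [map_add, Finset.sum_add_distrib]
    rw [hN M (by omega), hN' M (by omega)]

theorem isInternal_of_proj (D : ℕ → Submodule K V) (hD : ⨆ n, D n = ⊤) (p : ℕ → V →ₗ[K] V)
    (hp : ∀ n, ∀ x ∈ D n, p n x = x) (hp' : ∀ n m, n ≠ m → ∀ x ∈ D n, p m x = 0) :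
    DirectSum.IsInternal D := by
  rw [DirectSum.isInternal_submodule_iff_iSupIndep_and_iSup_eq_top]
  refine ⟨?_, hD⟩
  intro n
  rw [Submodule.disjoint_def]
  intro x hx hx'
  rw [← hp n x hx]
  have : (⨆ j, ⨆ (_ : j ≠ n), D j) ≤ LinearMap.ker (p n) :=
    iSup₂_le fun j hj y hy => hp' j n hj y hy
  exact this hx'

/-- The grading induced on a graded subspace. -/
def restrict (G : Grading K V) (W : Submodule K V) (hW : ∀ n, ∀ x ∈ W, G.proj n x ∈ W) :
    Grading K W where
  deg n := (G.deg n).comap W.subtype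
  isInternal := by
    refine isInternal_of_proj _ ?_ (fun n => (G.proj n).restrict (hW n)) ?_ ?_
    · rw [eq_top_iff]
      rintro x -
      obtain ⟨N, hN⟩ := G.sum_proj x
      have : x = ∑ n ∈ Finset.range N, (G.proj n).restrict (hW n) x := by
        ext
        simpa using (hN N le_rfl).symm
      rw [this]
      refine Submodule.sum_mem _ fun n _ => Submodule.mem_iSup_of_mem n ?_
      exact G.proj_mem n x
    · intro n x hx
      ext
      exact G.proj_of_mem hx
    · intro n m h x hx
      ext
      exact G.proj_of_mem_ne hx h

/-- The grading induced on the quotient by a graded subspace. -/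
def quot (G : Grading K V) (W : Submodule K V) (hW : ∀ n, ∀ x ∈ W, G.proj n x ∈ W) :
    Grading K (V ⧸ W) where
  deg n := (G.deg n).map W.mkQ
  isInternal := by
    refine isInternal_of_proj _ ?_ (fun n => W.mapQ W (G.proj n) (hW n)) ?_ ?_
    · rw [← Submodule.map_iSup, G.isInternal.submodule_iSup_eq_top]
      simp
    · rintro n _ ⟨x, hx, rfl⟩
      simp [G.proj_of_mem hx]
    · rintro n m h _ ⟨x, hx, rfl⟩
      simp [G.proj_of_mem_ne hx h]

end Grading

/-- A preshuffle algebra: a graded space `A` with operations `x •ᵢ y`, written `graft i x y`,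
for `y` homogeneous of degree `m` and `0 ≤ i ≤ m`.  To have operations that are defined
everywhere, `•ᵢ` is extended by zero to the components `A_m` with `m < i`. -/
structure PreshuffleAlgebra (K A : Type*) [Field K] [AddCommGroup A] [Module K A] extends
    Grading K A where
  graft : ℕ → A →ₗ[K] A →ₗ[K] A
  graft_of_lt : ∀ {i m : ℕ} (x : A) {y : A}, y ∈ deg m → m < i → graft i x y = 0
  graft_mem : ∀ {i n m : ℕ} {x y : A}, x ∈ deg n → y ∈ deg m → i ≤ m →
    graft i x y ∈ deg (n + m)
  graft_assoc : ∀ {i j m r : ℕ} (x : A) {y z : A}, y ∈ deg m → z ∈ deg r → i ≤ m → j ≤ r →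
    graft j (graft i x y) z = graft (i + j) x (graft j y z)

/-- A grafting algebra: a preshuffle algebra in which insertions at different places commute. -/
structure GraftingAlgebra (K A : Type*) [Field K] [AddCommGroup A] [Module K A] extends
    PreshuffleAlgebra K A where
  graft_comm : ∀ {i j n r : ℕ} {x : A} (y : A) {z : A}, x ∈ deg n → z ∈ deg r → i < j → j ≤ r →
    graft i x (graft j y z) = graft (j + n) y (graft i x z)

/-- A grafting bialgebra: a positively graded grafting algebra with a graded coassociative
coproduct `Δ` such that, in Sweedler notation, for `y` homogeneous of degree `m`,
* `Δ (x •₀ y) = ∑ x₁ ⊗ (x₂ •₀ y) + x ⊗ y + ∑ (x •₀ y₁) ⊗ y₂`;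
* `Δ (x •ᵢ y) = ∑_{|y₁| ≤ i} y₁ ⊗ (x •_{i - |y₁|} y₂) + ∑_{|y₁| = i} (x₁ •ᵢ y₁) ⊗ (x₂ •₀ y₂)
    + ∑_{|y₁| ≥ i} (x •ᵢ y₁) ⊗ y₂` for `1 ≤ i < m`;
* `Δ (x •ₘ y) = ∑ y₁ ⊗ (x •_{|y₂|} y₂) + y ⊗ x + ∑ (x₁ •ₘ y) ⊗ x₂`. -/
structure GraftingBialgebra (K A : Type*) [Field K] [AddCommGroup A] [Module K A] extends
    GraftingAlgebra K A where
  deg_zero : deg 0 = ⊥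
  comul : A →ₗ[K] A ⊗[K] A
  comul_mem : ∀ {n : ℕ} {x : A}, x ∈ deg n → comul x ∈
    ⨆ p ∈ Finset.HasAntidiagonal.antidiagonal n,
      LinearMap.range (TensorProduct.map (deg p.1).subtype (deg p.2).subtype)
  coassoc : ∀ x : A, TensorProduct.assoc K A A A
      (TensorProduct.map comul LinearMap.id (comul x)) =
    TensorProduct.map LinearMap.id comul (comul x)
  comul_graft_zero : ∀ x y : A, comul (graft 0 x y) =
    TensorProduct.map LinearMap.id ((graft 0).flip y) (comul x) + x ⊗ₜ[K] y +
      TensorProduct.map (graft 0 x) LinearMap.id (comul y)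
  comul_graft : ∀ {i m : ℕ} (x : A) {y : A}, y ∈ deg m → 1 ≤ i → i < m →
    comul (graft i x y) =
      ∑ k ∈ Finset.Icc 0 i,
        TensorProduct.map (toGrading.proj k) (graft (i - k) x) (comul y) +
      TensorProduct.map₂ (graft i) (graft 0) (comul x)
        (TensorProduct.map (toGrading.proj i) LinearMap.id (comul y)) +
      ∑ k ∈ Finset.Icc i m,
        TensorProduct.map (graft i x ∘ₗ toGrading.proj k) LinearMap.id (comul y)
  comul_graft_top : ∀ {m : ℕ} (x : A) {y : A}, y ∈ deg m → comul (graft m x y) =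
    ∑ k ∈ Finset.Icc 0 m,
      TensorProduct.map (toGrading.proj k) (graft (m - k) x) (comul y) + y ⊗ₜ[K] x +
      TensorProduct.map ((graft m).flip y) LinearMap.id (comul x)

/-- A `Prim_gr` algebra: a positively graded space `V` with a bracket `{x, y}` and operations
`x •_p y`, written `comp p x y`, for `y` homogeneous of degree `n` and `1 ≤ p < n`.  To have
operations that are defined everywhere, `•_p` is extended by zero to the other components. -/
structure PrimGrAlgebra (K V : Type*) [Field K] [AddCommGroup V] [Module K V] extends
    Grading K V where
  deg_zero : deg 0 = ⊥
  bracket : V →ₗ[K] V →ₗ[K] V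
  comp : ℕ → V →ₗ[K] V →ₗ[K] V
  bracket_mem : ∀ {n m : ℕ} {x y : V}, x ∈ deg n → y ∈ deg m → bracket x y ∈ deg (n + m)
  comp_of_not : ∀ {p n : ℕ} (x : V) {y : V}, y ∈ deg n → ¬ (1 ≤ p ∧ p < n) → comp p x y = 0
  comp_mem : ∀ {p n m : ℕ} {x y : V}, x ∈ deg n → y ∈ deg m → 1 ≤ p → p < m →
    comp p x y ∈ deg (n + m)
  bracket_bracket : ∀ {n : ℕ} {x : V} (y z : V), x ∈ deg n →
    bracket (bracket x y) z = bracket x (bracket y z) + comp n y (bracket x z)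
  bracket_comp_left : ∀ {p m : ℕ} (x : V) {y : V} (z : V), y ∈ deg m → 1 ≤ p → p < m →
    bracket (comp p x y) z = comp p x (bracket y z)
  bracket_comp_right : ∀ {p n r : ℕ} {x : V} (y : V) {z : V}, x ∈ deg n → z ∈ deg r →
    1 ≤ p → p < r → bracket x (comp p y z) = comp (n + p) y (bracket x z)
  comp_bracket_left : ∀ {p n r : ℕ} {x : V} (y : V) {z : V}, x ∈ deg n → z ∈ deg r →
    1 ≤ p → p < r →
    comp p (bracket x y) z = comp (n + p) y (comp p x z) - comp p x (comp p y z)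
  comp_assoc : ∀ {p q m r : ℕ} (x : V) {y z : V}, y ∈ deg m → z ∈ deg r →
    1 ≤ p → p < m → 1 ≤ q → q < r → comp q (comp p x y) z = comp (p + q) x (comp q y z)
  comp_comm : ∀ {p q n r : ℕ} {x : V} (y : V) {z : V}, x ∈ deg n → z ∈ deg r →
    1 ≤ p → p < q → q < r → comp p x (comp q y z) = comp (n + q) y (comp p x z)

namespace PreshuffleAlgebra

variable {K A : Type*} [Field K] [AddCommGroup A] [Module K A]

/-- The linear map `x ↦ (y ↦ y •_{|x|} x)`, that is, the product `x •_top y`. -/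
noncomputable def top (G : PreshuffleAlgebra K A) : A →ₗ[K] A →ₗ[K] A :=
  DirectSum.toModule K ℕ (A →ₗ[K] A)
      (fun n => (G.graft n).flip ∘ₗ (G.deg n).subtype) ∘ₗ
    G.decomp.toLinearMap

theorem top_of_mem (G : PreshuffleAlgebra K A) {n : ℕ} {x : A} (hx : x ∈ G.deg n) (y : A) :
    G.top x y = G.graft n y x := by
  simp [top, G.decomp_of_mem hx, DirectSum.toModule_lof]

/-- The bracket `{x, y} = x •_top y - x •₀ y`. -/
noncomputable def bracket (G : PreshuffleAlgebra K A) : A →ₗ[K] A →ₗ[K] A :=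
  G.top - G.graft 0

theorem bracket_of_mem (G : PreshuffleAlgebra K A) {n : ℕ} {x : A} (hx : x ∈ G.deg n) (y : A) :
    G.bracket x y = G.graft n y x - G.graft 0 x y := by
  simp [bracket, G.top_of_mem hx]

/-- The operation `x •_p y` for `1 ≤ p < |y|`, extended by zero. -/
noncomputable def inner (G : PreshuffleAlgebra K A) (p : ℕ) : A →ₗ[K] A →ₗ[K] A :=
  if p = 0 then 0 else G.graft p - (G.graft p).compl₂ (G.proj p)

theorem inner_of_mem (G : PreshuffleAlgebra K A) {p n : ℕ} (x : A) {y : A} (hy : y ∈ G.deg n)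
    (hp : 1 ≤ p) (hn : p < n) : G.inner p x y = G.graft p x y := by
  simp [inner, show p ≠ 0 by omega, G.proj_of_mem_ne hy (show n ≠ p by omega)]

theorem inner_of_not (G : PreshuffleAlgebra K A) {p n : ℕ} (x : A) {y : A} (hy : y ∈ G.deg n)
    (h : ¬ (1 ≤ p ∧ p < n)) : G.inner p x y = 0 := by
  unfold inner
  split_ifs with h0
  · simp
  · rcases eq_or_ne n p with rfl | h1
    · simp [G.proj_of_mem hy]
    · simp [G.proj_of_mem_ne hy h1, G.graft_of_lt x hy (show n < p by omega)]

end PreshuffleAlgebra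

namespace GraftingAlgebra

variable {K A : Type*} [Field K] [AddCommGroup A] [Module K A]

/-- The `Prim_gr` algebra structure of a positively graded grafting algebra. -/
noncomputable def toPrimGr (G : GraftingAlgebra K A) (h0 : G.deg 0 = ⊥) : PrimGrAlgebra K A where
  toGrading := G.toGrading
  deg_zero := h0
  bracket := G.bracket
  comp := G.inner
  bracket_mem {n m x y} hx hy := by
    rw [G.bracket_of_mem hx]
    have h1 := G.graft_mem hy hx le_rfl
    rw [add_comm m n] at h1
    exact Submodule.sub_mem _ h1 (G.graft_mem hx hy (Nat.zero_le _))
  comp_of_not x _ hy h := G.inner_of_not x hy h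
  comp_mem {p n m x y} hx hy h1 h2 := by
    rw [G.inner_of_mem x hy h1 h2]
    exact G.graft_mem hx hy h2.le
  bracket_bracket {n x} y z hx := by
    rcases Nat.eq_zero_or_pos n with rfl | hn
    · rw [h0, Submodule.mem_bot] at hx
      simp [hx]
    induction y using G.toGrading.homogeneous_induction with
    | add y y' h h' =>
      simp only [map_add, LinearMap.add_apply, h, h']
      abel
    | mem m y hy =>
    induction z using G.toGrading.homogeneous_induction with
    | add z z' h h' =>
      simp only [map_add, h, h']
      abel
    | mem r z hz =>
    rcases Nat.eq_zero_or_pos m with rfl | hm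
    · rw [h0, Submodule.mem_bot] at hy
      simp [hy]
    rcases Nat.eq_zero_or_pos r with rfl | hr
    · rw [h0, Submodule.mem_bot] at hz
      simp [hz]
    have a1 := G.graft_mem hy hx le_rfl
    have a2 := G.graft_mem hx hy (Nat.zero_le _)
    have a3 := G.graft_mem hz hx le_rfl
    rw [add_comm] at a1 a3
    have a4 := G.graft_mem hx hz (Nat.zero_le _)
    have a5 : G.bracket x z ∈ G.deg (n + r) := by
      rw [G.bracket_of_mem hx]; exact Submodule.sub_mem _ a3 a4
    have e1 := G.graft_assoc z hy hx le_rfl le_rfl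
    have e2 := G.graft_comm z hx hy hm le_rfl
    have e3 := G.graft_assoc x hy hz (Nat.zero_le _) (Nat.zero_le _)
    have e4 := G.graft_assoc y hz hx (Nat.zero_le _) le_rfl
    have e5 := G.graft_assoc y hx hz le_rfl (Nat.zero_le _)
    rw [G.inner_of_mem y a5 hn (by omega), G.bracket_of_mem hx z, G.bracket_of_mem hx y,
      G.bracket_of_mem hx, G.bracket_of_mem hy z, map_sub, LinearMap.sub_apply,
      G.bracket_of_mem a1, G.bracket_of_mem a2]
    simp only [map_sub, LinearMap.sub_apply]
    rw [e1, e2, e3, e4, e5]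
    simp only [zero_add, add_zero, add_comm m n]
    abel
  bracket_comp_left {p m} x y z hy h1 h2 := by
    induction x using G.toGrading.homogeneous_induction with
    | add x x' h h' => simp only [map_add, LinearMap.add_apply, h, h']
    | mem n x hx =>
    induction z using G.toGrading.homogeneous_induction with
    | add z z' h h' => simp only [map_add, h, h']
    | mem r z hz =>
    have a1 := G.graft_mem hx hy h2.le
    have a2 := G.graft_mem hz hy le_rfl
    have a3 := G.graft_mem hy hz (Nat.zero_le _)
    rw [add_comm] at a2
    have a4 : G.bracket y z ∈ G.deg (m + r) := by
      rw [G.bracket_of_mem hy]; exact Submodule.sub_mem _ a2 a3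
    have e1 := G.graft_comm z hx hy h2 le_rfl
    have e2 := G.graft_assoc x hy hz h2.le (Nat.zero_le _)
    rw [G.inner_of_mem x a4 h1 (by omega), G.inner_of_mem x hy h1 h2, G.bracket_of_mem a1,
      G.bracket_of_mem hy, map_sub, e1, e2]
    simp only [add_zero, add_comm m n]
  bracket_comp_right {p n r x} y z hx hz h1 h2 := by
    induction y using G.toGrading.homogeneous_induction with
    | add y y' h h' => simp only [map_add, LinearMap.add_apply, h, h']
    | mem m y hy =>
    have a2 := G.graft_mem hz hx le_rfl
    have a3 := G.graft_mem hx hz (Nat.zero_le _)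
    rw [add_comm] at a2
    have a4 : G.bracket x z ∈ G.deg (n + r) := by
      rw [G.bracket_of_mem hx]; exact Submodule.sub_mem _ a2 a3
    have e1 := G.graft_assoc y hz hx h2.le le_rfl
    have e2 := G.graft_comm y hx hz h1 h2.le
    rw [G.inner_of_mem y a4 (by omega) (by omega), G.inner_of_mem y hz h1 h2,
      G.bracket_of_mem hx, G.bracket_of_mem hx, map_sub, e1, e2]
    simp only [add_comm p n]
  comp_bracket_left {p n r x} y z hx hz h1 h2 := by
    induction y using G.toGrading.homogeneous_induction with
    | add y y' h h' =>
      simp only [map_add, LinearMap.add_apply, h, h']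
      abel
    | mem m y hy =>
    have a1 := G.graft_mem hx hz h2.le
    have a2 := G.graft_mem hy hz h2.le
    have e1 := G.graft_assoc y hx hz le_rfl h2.le
    have e2 := G.graft_assoc x hy hz (Nat.zero_le _) h2.le
    rw [G.inner_of_mem _ hz h1 h2, G.inner_of_mem _ hz h1 h2, G.inner_of_mem _ hz h1 h2,
      G.inner_of_mem y a1 (by omega) (by omega), G.inner_of_mem x a2 h1 (by omega),
      G.bracket_of_mem hx, map_sub, LinearMap.sub_apply, e1, e2, zero_add]
  comp_assoc {p q m r} x y z hy hz h1 h2 h3 h4 := by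
    have a1 := G.graft_mem hy hz h4.le
    rw [G.inner_of_mem _ hz h3 h4, G.inner_of_mem _ hy h1 h2, G.inner_of_mem _ hz h3 h4,
      G.inner_of_mem x a1 (by omega) (by omega), G.graft_assoc x hy hz h2.le h4.le]
  comp_comm {p q n r x} y z hx hz h1 h2 h3 := by
    induction y using G.toGrading.homogeneous_induction with
    | add y y' h h' => simp only [map_add, LinearMap.add_apply, h, h']
    | mem m y hy =>
    have a1 := G.graft_mem hx hz (h2.trans h3).le
    have a2 := G.graft_mem hy hz h3.le
    rw [G.inner_of_mem _ hz (by omega) h3, G.inner_of_mem x a2 h1 (by omega),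
      G.inner_of_mem x hz h1 (by omega), G.inner_of_mem y a1 (by omega) (by omega),
      G.graft_comm y hx hz h2 h3.le, add_comm q n]

end GraftingAlgebra

namespace PrimGrAlgebra

variable {K V : Type*} [Field K] [AddCommGroup V] [Module K V]

/-- The `Prim_gr` algebra structure on a graded subspace closed under the operations. -/
def restrict (P : PrimGrAlgebra K V) (W : Submodule K V) (hW : ∀ n, ∀ x ∈ W, P.proj n x ∈ W)
    (hb : ∀ x ∈ W, ∀ y ∈ W, P.bracket x y ∈ W)
    (hc : ∀ p, ∀ x ∈ W, ∀ y ∈ W, P.comp p x y ∈ W) : PrimGrAlgebra K W where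
  toGrading := P.toGrading.restrict W hW
  deg_zero := by
    show (P.deg 0).comap W.subtype = ⊥
    rw [P.deg_zero]
    exact Submodule.ker_subtype W
  bracket := LinearMap.mk₂ K (fun x y => ⟨P.bracket x y, hb x x.2 y y.2⟩)
    (fun _ _ _ => by ext; simp) (fun _ _ _ => by ext; simp) (fun _ _ _ => by ext; simp)
    (fun _ _ _ => by ext; simp)
  comp p := LinearMap.mk₂ K (fun x y => ⟨P.comp p x y, hc p x x.2 y y.2⟩)
    (fun _ _ _ => by ext; simp) (fun _ _ _ => by ext; simp) (fun _ _ _ => by ext; simp)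
    (fun _ _ _ => by ext; simp)
  bracket_mem hx hy := P.bracket_mem hx hy
  comp_of_not x _ hy h := Subtype.ext (P.comp_of_not (x : V) hy h)
  comp_mem hx hy h1 h2 := P.comp_mem hx hy h1 h2
  bracket_bracket y z hx := Subtype.ext (P.bracket_bracket (y : V) (z : V) hx)
  bracket_comp_left x _ z hy h1 h2 :=
    Subtype.ext (P.bracket_comp_left (x : V) (z : V) hy h1 h2)
  bracket_comp_right y _ hx hz h1 h2 := Subtype.ext (P.bracket_comp_right (y : V) hx hz h1 h2)
  comp_bracket_left y _ hx hz h1 h2 := Subtype.ext (P.comp_bracket_left (y : V) hx hz h1 h2)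
  comp_assoc x _ _ hy hz h1 h2 h3 h4 := Subtype.ext (P.comp_assoc (x : V) hy hz h1 h2 h3 h4)
  comp_comm y _ hx hz h1 h2 h3 := Subtype.ext (P.comp_comm (y : V) hx hz h1 h2 h3)

/-- An isomorphism of `Prim_gr` algebras. -/
structure Iso {V' : Type*} [AddCommGroup V'] [Module K V'] (P : PrimGrAlgebra K V)
    (Q : PrimGrAlgebra K V') where
  toLinearEquiv : V ≃ₗ[K] V'
  map_mem : ∀ n, ∀ x ∈ P.deg n, toLinearEquiv x ∈ Q.deg n
  map_bracket : ∀ x y, toLinearEquiv (P.bracket x y) =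
    Q.bracket (toLinearEquiv x) (toLinearEquiv y)
  map_comp : ∀ p x y, toLinearEquiv (P.comp p x y) =
    Q.comp p (toLinearEquiv x) (toLinearEquiv y)

end PrimGrAlgebra

namespace GraftingBialgebra

variable {K A : Type*} [Field K] [AddCommGroup A] [Module K A]

/-- The subspace of primitive elements. -/
def prim (H : GraftingBialgebra K A) : Submodule K A := LinearMap.ker H.comul

theorem mem_prim (H : GraftingBialgebra K A) {x : A} : x ∈ H.prim ↔ H.comul x = 0 := Iff.rfl

theorem comul_proj (H : GraftingBialgebra K A) (n : ℕ) (x : A) :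
    H.comul (H.proj n x) = ∑ p ∈ Finset.HasAntidiagonal.antidiagonal n,
      TensorProduct.map (H.proj p.1) (H.proj p.2) (H.comul x) := by
  induction x using H.toGrading.homogeneous_induction with
  | add x y hx hy => simp only [map_add, hx, hy, Finset.sum_add_distrib]
  | mem m x hx =>
  have key : ∀ t ∈ ⨆ p ∈ Finset.HasAntidiagonal.antidiagonal m,
      LinearMap.range (TensorProduct.map (H.deg p.1).subtype (H.deg p.2).subtype),
      ∑ p ∈ Finset.HasAntidiagonal.antidiagonal n,
        TensorProduct.map (H.proj p.1) (H.proj p.2) t = if m = n then t else 0 := by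
    intro t ht
    refine Submodule.iSup_induction _ (motive := fun t =>
      ∑ p ∈ Finset.HasAntidiagonal.antidiagonal n,
        TensorProduct.map (H.proj p.1) (H.proj p.2) t = if m = n then t else 0) ht ?_ ?_ ?_
    · intro q t ht
      by_cases hq : q ∈ Finset.HasAntidiagonal.antidiagonal m
      swap
      · simp only [hq, iSup_false, Submodule.mem_bot] at ht
        simp [ht]
      simp only [hq, iSup_true] at ht
      rw [Finset.HasAntidiagonal.mem_antidiagonal] at hq
      obtain ⟨s, rfl⟩ := ht
      induction s using TensorProduct.induction_on with
      | zero => simp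
      | add s s' h h' =>
        simp only [map_add, Finset.sum_add_distrib, h, h']
        split_ifs <;> simp
      | tmul a b =>
        simp only [TensorProduct.map_tmul, Submodule.subtype_apply]
        have hz : ∀ p : ℕ × ℕ, p ≠ q → H.proj p.1 (a : A) ⊗ₜ[K] H.proj p.2 (b : A) = 0 := by
          intro p hp
          by_cases h1 : q.1 = p.1
          · have h2 : q.2 ≠ p.2 := fun h => hp (Prod.ext h1.symm h.symm)
            rw [H.proj_of_mem_ne b.2 h2, TensorProduct.tmul_zero]
          · rw [H.proj_of_mem_ne a.2 h1, TensorProduct.zero_tmul]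
        split_ifs with h
        · subst h
          rw [Finset.sum_eq_single q (fun p _ hp => hz p hp)]
          · rw [H.proj_of_mem a.2, H.proj_of_mem b.2]
          · intro h
            exact absurd (Finset.HasAntidiagonal.mem_antidiagonal.2 hq) h
        · refine Finset.sum_eq_zero fun p hp => hz p ?_
          rintro rfl
          rw [Finset.HasAntidiagonal.mem_antidiagonal] at hp
          omega
    · simp
    · intro s s' h h'
      simp only [map_add, Finset.sum_add_distrib, h, h']
      split_ifs <;> simp
  rw [key _ (H.comul_mem hx)]
  split_ifs with h
  · subst h
    rw [H.proj_of_mem hx]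
  · rw [H.proj_of_mem_ne hx h, map_zero]

theorem proj_mem_prim (H : GraftingBialgebra K A) (n : ℕ) (x : A) (hx : x ∈ H.prim) :
    H.proj n x ∈ H.prim := by
  rw [mem_prim] at hx ⊢
  simp [comul_proj, hx]

theorem bracket_mem_prim (H : GraftingBialgebra K A) (x : A) (hx : x ∈ H.prim) (y : A)
    (hy : y ∈ H.prim) : H.bracket x y ∈ H.prim := by
  obtain ⟨N, hN⟩ := H.sum_proj x
  rw [← hN N le_rfl, map_sum, LinearMap.sum_apply]
  refine Submodule.sum_mem _ fun n _ => ?_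
  have h := H.proj_mem_prim n x hx
  have hn := H.proj_mem n x
  rw [mem_prim] at h hy ⊢
  rw [H.bracket_of_mem hn, map_sub, H.comul_graft_top y hn, H.comul_graft_zero]
  simp [h, hy]

theorem inner_mem_prim (H : GraftingBialgebra K A) (p : ℕ) (x : A) (hx : x ∈ H.prim) (y : A)
    (hy : y ∈ H.prim) : H.inner p x y ∈ H.prim := by
  obtain ⟨N, hN⟩ := H.sum_proj y
  rw [← hN N le_rfl, map_sum]
  refine Submodule.sum_mem _ fun n _ => ?_
  have h := H.proj_mem_prim n y hy
  have hn := H.proj_mem n y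
  by_cases hp : 1 ≤ p ∧ p < n
  · rw [mem_prim] at hx h ⊢
    rw [H.inner_of_mem x hn hp.1 hp.2, H.comul_graft x hn hp.1 hp.2]
    simp [h, hx]
  · rw [H.inner_of_not x hn hp]
    exact Submodule.zero_mem _

/-- The `Prim_gr` algebra `Prim(H)` of primitive elements of `H`. -/
noncomputable def primAlg (H : GraftingBialgebra K A) : PrimGrAlgebra K H.prim :=
  (H.toGraftingAlgebra.toPrimGr H.deg_zero).restrict H.prim H.proj_mem_prim
    H.bracket_mem_prim H.inner_mem_prim

/-- The filtration `F₁ = Prim(H)`, `F_{p+1} = {x | Δ x ∈ F_p ⊗ F_p}` for `p ≥ 1` (and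
`F₀ = 0`). -/
def filtration (H : GraftingBialgebra K A) : ℕ → Submodule K A
  | 0 => ⊥
  | 1 => H.prim
  | p + 2 => (LinearMap.range (TensorProduct.map (H.filtration (p + 1)).subtype
      (H.filtration (p + 1)).subtype)).comap H.comul

/-- `H` is connected if it is the union of the filtration. -/
def IsConnected (H : GraftingBialgebra K A) : Prop := ∀ x : A, ∃ p, 1 ≤ p ∧ x ∈ H.filtration p

/-- An isomorphism of grafting bialgebras. -/
structure Iso {A' : Type*} [AddCommGroup A'] [Module K A'] (H : GraftingBialgebra K A)
    (H' : GraftingBialgebra K A') where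
  toLinearEquiv : A ≃ₗ[K] A'
  map_mem : ∀ n, ∀ x ∈ H.deg n, toLinearEquiv x ∈ H'.deg n
  map_graft : ∀ i x y, toLinearEquiv (H.graft i x y) =
    H'.graft i (toLinearEquiv x) (toLinearEquiv y)
  map_comul : ∀ x, H'.comul (toLinearEquiv x) =
    TensorProduct.map toLinearEquiv.toLinearMap toLinearEquiv.toLinearMap (H.comul x)

end GraftingBialgebra

/-! ### Ideals and quotients -/

namespace GraftingAlgebra

variable {K A : Type*} [Field K] [AddCommGroup A] [Module K A]

/-- A subspace absorbing the operations on both sides. -/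
def IsIdeal (G : GraftingAlgebra K A) (I : Submodule K A) : Prop :=
  ∀ i a, ∀ x ∈ I, G.graft i a x ∈ I ∧ G.graft i x a ∈ I

/-- The ideal generated by a set. -/
def idealSpan (G : GraftingAlgebra K A) (S : Set A) : Submodule K A :=
  sInf {I | G.IsIdeal I ∧ S ⊆ I}

theorem subset_idealSpan (G : GraftingAlgebra K A) (S : Set A) : S ⊆ G.idealSpan S := by
  intro x hx
  simp only [idealSpan, SetLike.mem_coe, Submodule.mem_sInf]
  exact fun I hI => hI.2 hx

theorem idealSpan_le (G : GraftingAlgebra K A) {S : Set A} {I : Submodule K A}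
    (h : G.IsIdeal I) (hS : S ⊆ I) : G.idealSpan S ≤ I := sInf_le ⟨h, hS⟩

theorem isIdeal_idealSpan (G : GraftingAlgebra K A) (S : Set A) :
    G.IsIdeal (G.idealSpan S) := by
  intro i a x hx
  simp only [idealSpan, Submodule.mem_sInf] at hx ⊢
  exact ⟨fun I hI => (hI.1 i a x (hx I hI)).1, fun I hI => (hI.1 i a x (hx I hI)).2⟩

theorem proj_graft_mem (G : GraftingAlgebra K A) {I : Submodule K A} (hI : G.IsIdeal I)
    (i n : ℕ) (x y : A) (h : (∀ k, G.proj k x ∈ I) ∨ ∀ k, G.proj k y ∈ I) :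
    G.proj n (G.graft i x y) ∈ I := by
  obtain ⟨N, hN⟩ := G.sum_proj x
  obtain ⟨M, hM⟩ := G.sum_proj y
  rw [← hN N le_rfl, ← hM M le_rfl]
  simp only [map_sum, LinearMap.sum_apply]
  refine Submodule.sum_mem _ fun k _ => Submodule.sum_mem _ fun l _ => ?_
  have hm : G.graft i (G.proj l x) (G.proj k y) ∈ I := by
    rcases h with h | h
    · exact (hI i _ _ (h l)).2
    · exact (hI i _ _ (h k)).1
  by_cases hi : i ≤ k
  · have hd := G.graft_mem (G.proj_mem l x) (G.proj_mem k y) hi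
    by_cases hn : l + k = n
    · subst hn
      rwa [G.proj_of_mem hd]
    · rw [G.proj_of_mem_ne hd hn]
      exact Submodule.zero_mem _
  · rw [G.graft_of_lt _ (G.proj_mem k y) (by omega), map_zero]
    exact Submodule.zero_mem _

theorem proj_mem_idealSpan (G : GraftingAlgebra K A) {S : Set A}
    (hS : ∀ s ∈ S, ∃ n, s ∈ G.deg n) (n : ℕ) (x : A) (hx : x ∈ G.idealSpan S) :
    G.proj n x ∈ G.idealSpan S := by
  have h : G.idealSpan S ≤ ⨅ k, (G.idealSpan S).comap (G.proj k) := by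
    refine G.idealSpan_le ?_ ?_
    · intro i a x hx
      simp only [Submodule.mem_iInf, Submodule.mem_comap] at hx ⊢
      exact ⟨fun k => G.proj_graft_mem (G.isIdeal_idealSpan S) i k a x (Or.inr hx),
        fun k => G.proj_graft_mem (G.isIdeal_idealSpan S) i k x a (Or.inl hx)⟩
    · intro s hs
      simp only [SetLike.mem_coe, Submodule.mem_iInf, Submodule.mem_comap]
      intro k
      obtain ⟨m, hm⟩ := hS s hs
      by_cases hk : m = k
      · subst hk
        rw [G.proj_of_mem hm]
        exact G.subset_idealSpan S hs
      · rw [G.proj_of_mem_ne hm hk]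
        exact Submodule.zero_mem _
  have := h hx
  simp only [Submodule.mem_iInf, Submodule.mem_comap] at this
  exact this n

/-- The operation `•ᵢ` on the quotient by an ideal. -/
def quotGraft (G : GraftingAlgebra K A) (I : Submodule K A) (hI : G.IsIdeal I) (i : ℕ) :
    (A ⧸ I) →ₗ[K] (A ⧸ I) →ₗ[K] (A ⧸ I) :=
  (I.liftQ (I.liftQ ((G.graft i).compr₂ I.mkQ) (by
    intro x hx
    ext y
    simpa using (hI i y x hx).2)).flip (by
      intro y hy
      refine LinearMap.ext fun x => ?_
      obtain ⟨x, rfl⟩ := I.mkQ_surjective x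
      show I.mkQ (G.graft i x y) = 0
      simpa using (hI i x y hy).1)).flip

theorem quotGraft_mk (G : GraftingAlgebra K A) (I : Submodule K A) (hI : G.IsIdeal I) (i : ℕ)
    (x y : A) : G.quotGraft I hI i (I.mkQ x) (I.mkQ y) = I.mkQ (G.graft i x y) := rfl

/-- The quotient of a grafting algebra by a graded ideal. -/
def quot (G : GraftingAlgebra K A) (I : Submodule K A) (hI : G.IsIdeal I)
    (hp : ∀ n, ∀ x ∈ I, G.proj n x ∈ I) : GraftingAlgebra K (A ⧸ I) where
  toGrading := G.toGrading.quot I hp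
  graft := G.quotGraft I hI
  graft_of_lt := by
    rintro i m x _ ⟨y, hy, rfl⟩ h
    obtain ⟨x, rfl⟩ := I.mkQ_surjective x
    rw [quotGraft_mk, G.graft_of_lt x hy h, map_zero]
  graft_mem := by
    rintro i n m _ _ ⟨x, hx, rfl⟩ ⟨y, hy, rfl⟩ h
    exact ⟨_, G.graft_mem hx hy h, rfl⟩
  graft_assoc := by
    rintro i j m r x _ _ ⟨y, hy, rfl⟩ ⟨z, hz, rfl⟩ h h'
    obtain ⟨x, rfl⟩ := I.mkQ_surjective x
    simp only [quotGraft_mk, G.graft_assoc x hy hz h h']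
  graft_comm := by
    rintro i j n r _ y _ ⟨x, hx, rfl⟩ ⟨z, hz, rfl⟩ h h'
    obtain ⟨y, rfl⟩ := I.mkQ_surjective y
    simp only [quotGraft_mk, G.graft_comm y hx hz h h']

theorem quot_proj (G : GraftingAlgebra K A) (I : Submodule K A) (hI : G.IsIdeal I)
    (hp : ∀ n, ∀ x ∈ I, G.proj n x ∈ I) (n : ℕ) (x : A) :
    (G.quot I hI hp).proj n (I.mkQ x) = I.mkQ (G.proj n x) := by
  induction x using G.toGrading.homogeneous_induction with
  | add x y hx hy => simp only [map_add, hx, hy]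
  | mem m x hx =>
  have h : I.mkQ x ∈ (G.quot I hI hp).deg m := ⟨x, hx, rfl⟩
  by_cases hm : m = n
  · subst hm
    rw [G.proj_of_mem hx, (G.quot I hI hp).proj_of_mem h]
  · rw [G.proj_of_mem_ne hx hm, (G.quot I hI hp).proj_of_mem_ne h hm, map_zero]

end GraftingAlgebra

namespace GraftingBialgebra

variable {K A : Type*} [Field K] [AddCommGroup A] [Module K A]

section

variable {B : Type*} [AddCommGroup B] [Module K B]

theorem map_map_eq (f : A →ₗ[K] B) {g h : A →ₗ[K] A} {g' h' : B →ₗ[K] B}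
    (hg : ∀ a, f (g a) = g' (f a)) (hh : ∀ a, f (h a) = h' (f a)) (t : A ⊗[K] A) :
    TensorProduct.map f f (TensorProduct.map g h t) =
      TensorProduct.map g' h' (TensorProduct.map f f t) := by
  induction t using TensorProduct.induction_on with
  | zero => simp
  | add s s' h h' => simp only [map_add, h, h']
  | tmul a b => simp [hg, hh]

theorem map_map₂_eq (f : A →ₗ[K] B) {g h : A →ₗ[K] A →ₗ[K] A} {g' h' : B →ₗ[K] B →ₗ[K] B}
    (hg : ∀ a b, f (g a b) = g' (f a) (f b)) (hh : ∀ a b, f (h a b) = h' (f a) (f b))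
    (s t : A ⊗[K] A) :
    TensorProduct.map f f (TensorProduct.map₂ g h s t) =
      TensorProduct.map₂ g' h' (TensorProduct.map f f s) (TensorProduct.map f f t) := by
  induction s using TensorProduct.induction_on with
  | zero => simp
  | add s s' h h' => simp only [map_add, LinearMap.add_apply, h, h']
  | tmul a b =>
    induction t using TensorProduct.induction_on with
    | zero => simp
    | add s s' h h' => simp only [map_add, h, h']
    | tmul c d => simp [hg, hh]

end

section

variable (H : GraftingBialgebra K A) (I : Submodule K A)
  (hI : H.toGraftingAlgebra.IsIdeal I) (hp : ∀ n, ∀ x ∈ I, H.proj n x ∈ I)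

theorem mkQ_comul_graft_zero (x y : A) :
    TensorProduct.map I.mkQ I.mkQ (H.comul (H.graft 0 x y)) =
      TensorProduct.map LinearMap.id ((H.quotGraft I hI 0).flip (I.mkQ y))
        (TensorProduct.map I.mkQ I.mkQ (H.comul x)) + I.mkQ x ⊗ₜ[K] I.mkQ y +
      TensorProduct.map (H.quotGraft I hI 0 (I.mkQ x)) LinearMap.id
        (TensorProduct.map I.mkQ I.mkQ (H.comul y)) := by
  have h1 : ∀ a, I.mkQ ((H.graft 0).flip y a) =
    (H.quotGraft I hI 0).flip (I.mkQ y) (I.mkQ a) := fun a =>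
      (H.quotGraft_mk I hI 0 a y).symm
  have h2 : ∀ a, I.mkQ (H.graft 0 x a) = H.quotGraft I hI 0 (I.mkQ x) (I.mkQ a) := fun a =>
      (H.quotGraft_mk I hI 0 x a).symm
  have h3 : ∀ a, I.mkQ ((LinearMap.id : A →ₗ[K] A) a) =
    (LinearMap.id : A ⧸ I →ₗ[K] A ⧸ I) (I.mkQ a) := fun _ => rfl
  rw [H.comul_graft_zero, map_add, map_add, TensorProduct.map_tmul, map_map_eq I.mkQ h3 h1,
    map_map_eq I.mkQ h2 h3]

theorem mkQ_comul_graft {i m : ℕ} (x : A) {y : A} (hy : y ∈ H.deg m) (h1 : 1 ≤ i)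
    (h2 : i < m) :
    TensorProduct.map I.mkQ I.mkQ (H.comul (H.graft i x y)) =
      ∑ k ∈ Finset.Icc 0 i, TensorProduct.map ((H.toGraftingAlgebra.quot I hI hp).proj k)
        (H.quotGraft I hI (i - k) (I.mkQ x)) (TensorProduct.map I.mkQ I.mkQ (H.comul y)) +
      TensorProduct.map₂ (H.quotGraft I hI i) (H.quotGraft I hI 0)
        (TensorProduct.map I.mkQ I.mkQ (H.comul x))
        (TensorProduct.map ((H.toGraftingAlgebra.quot I hI hp).proj i) LinearMap.id
          (TensorProduct.map I.mkQ I.mkQ (H.comul y))) +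
      ∑ k ∈ Finset.Icc i m, TensorProduct.map (H.quotGraft I hI i (I.mkQ x) ∘ₗ
        (H.toGraftingAlgebra.quot I hI hp).proj k) LinearMap.id
          (TensorProduct.map I.mkQ I.mkQ (H.comul y)) := by
  have hq := fun k a => (H.toGraftingAlgebra.quot_proj I hI hp k a).symm
  have hg : ∀ j a, I.mkQ (H.graft j x a) = H.quotGraft I hI j (I.mkQ x) (I.mkQ a) :=
    fun j a => (H.quotGraft_mk I hI j x a).symm
  have hgp : ∀ k a, I.mkQ ((H.graft i x ∘ₗ H.proj k) a) = (H.quotGraft I hI i (I.mkQ x) ∘ₗ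
      (H.toGraftingAlgebra.quot I hI hp).proj k) (I.mkQ a) := fun k a => by
    rw [LinearMap.comp_apply, LinearMap.comp_apply, hg, hq]
  have hg2 : ∀ j a b, I.mkQ (H.graft j a b) = H.quotGraft I hI j (I.mkQ a) (I.mkQ b) :=
    fun j a b => (H.quotGraft_mk I hI j a b).symm
  have h3 : ∀ a, I.mkQ ((LinearMap.id : A →ₗ[K] A) a) =
    (LinearMap.id : A ⧸ I →ₗ[K] A ⧸ I) (I.mkQ a) := fun _ => rfl
  rw [H.comul_graft x hy h1 h2, map_add, map_add, map_sum, map_sum,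
    map_map₂_eq I.mkQ (hg2 i) (hg2 0), map_map_eq I.mkQ (hq i) h3,
    Finset.sum_congr rfl fun k _ => map_map_eq I.mkQ (hq k) (hg (i - k)) (H.comul y),
    Finset.sum_congr rfl fun k _ => map_map_eq I.mkQ (hgp k) h3 (H.comul y)]

theorem mkQ_comul_graft_top {m : ℕ} (x : A) {y : A} (hy : y ∈ H.deg m) :
    TensorProduct.map I.mkQ I.mkQ (H.comul (H.graft m x y)) =
      ∑ k ∈ Finset.Icc 0 m, TensorProduct.map ((H.toGraftingAlgebra.quot I hI hp).proj k)
        (H.quotGraft I hI (m - k) (I.mkQ x)) (TensorProduct.map I.mkQ I.mkQ (H.comul y)) +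
      I.mkQ y ⊗ₜ[K] I.mkQ x +
      TensorProduct.map ((H.quotGraft I hI m).flip (I.mkQ y)) LinearMap.id
        (TensorProduct.map I.mkQ I.mkQ (H.comul x)) := by
  have hq := fun k a => (H.toGraftingAlgebra.quot_proj I hI hp k a).symm
  have hg : ∀ j a, I.mkQ (H.graft j x a) = H.quotGraft I hI j (I.mkQ x) (I.mkQ a) :=
    fun j a => (H.quotGraft_mk I hI j x a).symm
  have h1 : ∀ a, I.mkQ ((H.graft m).flip y a) =
    (H.quotGraft I hI m).flip (I.mkQ y) (I.mkQ a) := fun a =>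
      (H.quotGraft_mk I hI m a y).symm
  have h3 : ∀ a, I.mkQ ((LinearMap.id : A →ₗ[K] A) a) =
    (LinearMap.id : A ⧸ I →ₗ[K] A ⧸ I) (I.mkQ a) := fun _ => rfl
  rw [H.comul_graft_top x hy, map_add, map_add, map_sum, TensorProduct.map_tmul,
    map_map_eq I.mkQ h1 h3,
    Finset.sum_congr rfl fun k _ => map_map_eq I.mkQ (hq k) (hg (m - k)) (H.comul y)]

/-- A graded ideal generated by primitive elements is a coideal. -/
theorem mkQ_comul_idealSpan {S : Set A} (hS : ∀ s ∈ S, ∃ n, s ∈ H.deg n)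
    (hS' : ∀ s ∈ S, H.comul s = 0) (x : A) (hx : x ∈ H.idealSpan S) :
    TensorProduct.map (H.idealSpan S).mkQ (H.idealSpan S).mkQ (H.comul x) = 0 := by
  set I := H.idealSpan S with hIdef
  have hI : H.toGraftingAlgebra.IsIdeal I := H.isIdeal_idealSpan S
  have hp : ∀ n, ∀ x ∈ I, H.proj n x ∈ I := H.proj_mem_idealSpan hS
  let J : Submodule K A := I ⊓ LinearMap.ker (TensorProduct.map I.mkQ I.mkQ ∘ₗ H.comul)
  let N : Submodule K A := ⨅ k, J.comap (H.proj k)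
  have hJ : ∀ x, x ∈ J ↔ x ∈ I ∧ TensorProduct.map I.mkQ I.mkQ (H.comul x) = 0 :=
    fun x => Iff.rfl
  have hN : ∀ x, x ∈ N ↔ ∀ k, H.proj k x ∈ J := fun x => by
    simp only [N, Submodule.mem_iInf, Submodule.mem_comap]
  have hz : ∀ x ∈ I, I.mkQ x = 0 := fun x hx => by simpa using hx
  have hg : ∀ i n m x y, x ∈ H.deg n → y ∈ H.deg m → x ∈ J ∨ y ∈ J → H.graft i x y ∈ N := by
    intro i n m x y hx hy h
    rw [hN]
    intro k
    rcases lt_or_ge m i with hi | hi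
    · rw [H.graft_of_lt x hy hi, map_zero]
      exact Submodule.zero_mem _
    have hd := H.graft_mem hx hy hi
    by_cases hk : n + m = k
    swap
    · rw [H.proj_of_mem_ne hd hk]
      exact Submodule.zero_mem _
    subst hk
    rw [H.proj_of_mem hd, hJ]
    refine ⟨?_, ?_⟩
    · rcases h with h | h
      · exact (hI i y x h.1).2
      · exact (hI i x y h.1).1
    · simp only [hJ] at h
      rcases Nat.eq_zero_or_pos i with rfl | hi0
      · rw [H.mkQ_comul_graft_zero I hI]
        rcases h with h | h <;> simp [h.2, hz _ h.1]
      rcases eq_or_lt_of_le hi with rfl | hi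
      · rw [H.mkQ_comul_graft_top I hI hp x hy]
        rcases h with h | h <;> simp [h.2, hz _ h.1]
      · rw [H.mkQ_comul_graft I hI hp x hy hi0 hi]
        rcases h with h | h <;> simp [h.2, hz _ h.1]
  have hsum : ∀ i a b, (∀ k, H.proj k a ∈ J) ∨ (∀ k, H.proj k b ∈ J) → H.graft i a b ∈ N := by
    intro i a b h
    obtain ⟨M, hM⟩ := H.sum_proj a
    obtain ⟨M', hM'⟩ := H.sum_proj b
    rw [← hM M le_rfl, ← hM' M' le_rfl]
    simp only [map_sum, LinearMap.sum_apply]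
    refine Submodule.sum_mem _ fun k _ => Submodule.sum_mem _ fun l _ =>
      hg i l k _ _ (H.proj_mem _ _) (H.proj_mem _ _) ?_
    exact h.imp (fun h => h l) fun h => h k
  have hle : I ≤ N := by
    refine H.idealSpan_le ?_ ?_
    · intro i a y hy
      rw [hN] at hy
      exact ⟨hsum i a y (Or.inr hy), hsum i y a (Or.inl hy)⟩
    · intro s hs
      rw [SetLike.mem_coe, hN]
      intro k
      obtain ⟨n, hn⟩ := hS s hs
      by_cases hk : n = k
      · subst hk
        rw [H.proj_of_mem hn, hJ, hS' s hs, map_zero]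
        exact ⟨H.subset_idealSpan S hs, rfl⟩
      · rw [H.proj_of_mem_ne hn hk]
        exact Submodule.zero_mem _
  obtain ⟨M, hM⟩ := H.sum_proj x
  rw [← hM M le_rfl, map_sum, map_sum]
  exact Finset.sum_eq_zero fun k _ => ((hJ _).1 ((hN x).1 (hle hx) k)).2

/-- The quotient of a grafting bialgebra by a graded ideal that is a coideal. -/
noncomputable def quot
    (hc : ∀ x ∈ I, TensorProduct.map I.mkQ I.mkQ (H.comul x) = 0) :
    GraftingBialgebra K (A ⧸ I) where
  toGraftingAlgebra := H.toGraftingAlgebra.quot I hI hp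
  deg_zero := by
    show (H.deg 0).map I.mkQ = ⊥
    rw [H.deg_zero, Submodule.map_bot]
  comul := I.liftQ (TensorProduct.map I.mkQ I.mkQ ∘ₗ H.comul) hc
  comul_mem := by
    rintro n _ ⟨x, hx, rfl⟩
    show TensorProduct.map I.mkQ I.mkQ (H.comul x) ∈
      ⨆ p ∈ Finset.HasAntidiagonal.antidiagonal n, LinearMap.range (TensorProduct.map
        ((H.deg p.1).map I.mkQ).subtype ((H.deg p.2).map I.mkQ).subtype)
    have h := Submodule.mem_map_of_mem (f := TensorProduct.map I.mkQ I.mkQ) (H.comul_mem hx)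
    simp only [Submodule.map_iSup] at h
    refine SetLike.le_def.1 (iSup_mono fun p => iSup_mono fun _ => ?_) h
    rintro _ ⟨_, ⟨t, rfl⟩, rfl⟩
    refine ⟨TensorProduct.map ((I.mkQ.comp (H.deg p.1).subtype).codRestrict
      ((H.deg p.1).map I.mkQ) fun c => Submodule.mem_map_of_mem c.2) ((I.mkQ.comp (H.deg p.2).subtype).codRestrict
      ((H.deg p.2).map I.mkQ) fun c => Submodule.mem_map_of_mem c.2) t, ?_⟩
    induction t using TensorProduct.induction_on with
    | zero => simp
    | add s s' h h' => simp only [map_add, h, h']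
    | tmul a b => rfl
  coassoc := by
    intro x
    obtain ⟨x, rfl⟩ := I.mkQ_surjective x
    have h := congrArg (TensorProduct.map I.mkQ (TensorProduct.map I.mkQ I.mkQ)) (H.coassoc x)
    have h1 : ∀ t : A ⊗[K] A, TensorProduct.map I.mkQ (TensorProduct.map I.mkQ I.mkQ)
        (TensorProduct.map LinearMap.id H.comul t) = TensorProduct.map LinearMap.id
          (I.liftQ (TensorProduct.map I.mkQ I.mkQ ∘ₗ H.comul) hc)
          (TensorProduct.map I.mkQ I.mkQ t) := by
      intro t
      induction t using TensorProduct.induction_on with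
      | zero => simp
      | add s s' h h' => simp only [map_add, h, h']
      | tmul a b => rfl
    have h2 : ∀ t : (A ⊗[K] A) ⊗[K] A, TensorProduct.map I.mkQ
        (TensorProduct.map I.mkQ I.mkQ) (TensorProduct.assoc K A A A t) =
        TensorProduct.assoc K _ _ _ (TensorProduct.map (TensorProduct.map I.mkQ I.mkQ) I.mkQ t) := by
      intro t
      induction t using TensorProduct.induction_on with
      | zero => simp
      | add s s' h h' => simp only [map_add, h, h']
      | tmul a b =>
        induction a using TensorProduct.induction_on with
        | zero => simp
        | add s s' h h' => simp only [map_add, TensorProduct.add_tmul, h, h']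
        | tmul a c => rfl
    have h3 : ∀ t : A ⊗[K] A, TensorProduct.map (TensorProduct.map I.mkQ I.mkQ) I.mkQ
        (TensorProduct.map H.comul LinearMap.id t) = TensorProduct.map
          (I.liftQ (TensorProduct.map I.mkQ I.mkQ ∘ₗ H.comul) hc) LinearMap.id
          (TensorProduct.map I.mkQ I.mkQ t) := by
      intro t
      induction t using TensorProduct.induction_on with
      | zero => simp
      | add s s' h h' => simp only [map_add, h, h']
      | tmul a b => rfl
    rw [h1, h2, h3] at h
    exact h
  comul_graft_zero := by
    intro x y
    obtain ⟨x, rfl⟩ := I.mkQ_surjective x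
    obtain ⟨y, rfl⟩ := I.mkQ_surjective y
    exact H.mkQ_comul_graft_zero I hI x y
  comul_graft := by
    rintro i m x _ ⟨y, hy, rfl⟩ h1 h2
    obtain ⟨x, rfl⟩ := I.mkQ_surjective x
    exact H.mkQ_comul_graft I hI hp x hy h1 h2
  comul_graft_top := by
    rintro m x _ ⟨y, hy, rfl⟩
    obtain ⟨x, rfl⟩ := I.mkQ_surjective x
    exact H.mkQ_comul_graft_top I hI hp x hy

end

end GraftingBialgebra


/-! ### Coloured planar trees -/

/-- Planar rooted trees whose vertices are coloured by elements of the graded set `ι`: a vertex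
coloured by `x` of degree `d x` has `d x + 1` ordered inputs.  `leaf` is the tree `|`. -/
inductive PTree {ι : Type*} (d : ι → ℕ) where
  | leaf : PTree d
  | node (x : ι) (c : Fin (d x + 1) → PTree d) : PTree d

namespace PTree

variable {ι : Type*} {d : ι → ℕ}

/-- The degree of a tree: the number of its leaves minus one. -/
def degree : PTree d → ℕ
  | leaf => 0
  | node x c => d x + ∑ k, (c k).degree

/-- The number of leaves of the trees `c j`, `j < k`. -/
def offset {n : ℕ} (c : Fin n → PTree d) (k : Fin n) : ℕ :=
  ∑ j ∈ Finset.univ.filter (· < k), ((c j).degree + 1)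

/-- `graft s i t` is obtained by attaching the root of `s` to the leaf of `t` with number `i`,
the leaves of `t` being numbered from left to right by `0, …, degree t`. -/
def graft (s : PTree d) (i : ℕ) : PTree d → PTree d
  | leaf => s
  | node x c => node x fun k =>
      if offset c k ≤ i ∧ i ≤ offset c k + (c k).degree then
        graft s (i - offset c k) (c k)
      else c k

/-- The corolla with its vertex coloured by `x`. -/
def corolla (d : ι → ℕ) (x : ι) : PTree d := node x fun _ => leaf

/-- The terms of the counital coproduct `Δ₊` for which the colours are primitive:
`Δ₊(|) = | ⊗ |` and
`Δ₊(⋁ₓ(t⁰, …, tⁿ)) = ∑ t⁰₁ ⊗ ⋁ₓ(t⁰₂, t¹, …, tⁿ) + ∑ ⋁ₓ(t⁰, …, tⁿ⁻¹, tⁿ₁) ⊗ tⁿ₂`. -/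
def cuts : PTree d → Multiset (PTree d × PTree d)
  | leaf => {(leaf, leaf)}
  | node x c =>
      (c 0).cuts.map (fun p => (p.1, node x (Function.update c 0 p.2))) +
      (c (Fin.last _)).cuts.map (fun p => (node x (Function.update c (Fin.last _) p.1), p.2))

theorem graft_leaf_left (i : ℕ) (t : PTree d) : graft leaf i t = t := by
  induction t generalizing i with
  | leaf => rfl
  | node x c ih =>
    simp only [graft]
    congr 1
    funext k
    split_ifs
    · exact ih k _
    · rfl

/-- The children of `graft s i (node x c)`. -/
def graftChildren (s : PTree d) (i : ℕ) {n : ℕ} (c : Fin n → PTree d) : Fin n → PTree d :=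
  fun k => if offset c k ≤ i ∧ i ≤ offset c k + (c k).degree then
    graft s (i - offset c k) (c k) else c k

theorem graft_node (s : PTree d) (i : ℕ) (x : ι) (c : Fin (d x + 1) → PTree d) :
    graft s i (node x c) = node x (graftChildren s i c) := rfl

theorem offset_zero {n : ℕ} (c : Fin (n + 1) → PTree d) : offset c 0 = 0 := by
  simp [offset]

theorem offset_succ {n : ℕ} (c : Fin n → PTree d) (k : ℕ) (hk : k + 1 < n) :
    offset c ⟨k + 1, hk⟩ = offset c ⟨k, by omega⟩ + ((c ⟨k, by omega⟩).degree + 1) := by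
  have : Finset.univ.filter (fun j : Fin n => j < ⟨k + 1, hk⟩) =
      insert ⟨k, by omega⟩ (Finset.univ.filter (fun j : Fin n => j < ⟨k, by omega⟩)) := by
    ext j
    simp only [Finset.mem_filter, Finset.mem_univ, true_and, Finset.mem_insert, Fin.lt_def,
      Fin.ext_iff]
    omega
  rw [offset, this, Finset.sum_insert (by simp), offset, add_comm]

theorem offset_last {x : ι} (c : Fin (d x + 1) → PTree d) :
    offset c (Fin.last _) + (c (Fin.last _)).degree = (node x c).degree := by
  have h : Finset.univ.filter (fun j : Fin (d x + 1) => j < Fin.last _) =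
      Finset.univ.erase (Fin.last _) := by
    ext j
    simp [Fin.lt_last_iff_ne_last]
  have h2 := Finset.add_sum_erase Finset.univ (fun j => (c j).degree)
    (Finset.mem_univ (Fin.last (d x)))
  rw [degree, offset, h, Finset.sum_add_distrib, ← h2]
  simp
  omega

theorem offset_mono_bound {n : ℕ} (c : Fin n → PTree d) {j k : Fin n} (h : j < k) :
    offset c j + (c j).degree < offset c k := by
  have hsub : insert j (Finset.univ.filter (· < j)) ⊆ Finset.univ.filter (· < k) := by
    intro l hl
    simp only [Finset.mem_filter, Finset.mem_univ, true_and, Finset.mem_insert] at hl ⊢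
    rcases hl with rfl | hl
    · exact h
    · exact hl.trans h
  have := Finset.sum_le_sum_of_subset (f := fun j => (c j).degree + 1) hsub
  rw [Finset.sum_insert (by simp)] at this
  simp only [offset]
  omega

theorem degree_graft (s : PTree d) (t : PTree d) : ∀ i, i ≤ t.degree →
    (graft s i t).degree = s.degree + t.degree := by
  induction t with
  | leaf => intro i hi; simp [graft, degree]
  | node x c ih =>
    intro i hi
    have key : ∀ k : Fin (d x + 1), (graftChildren s i c k).degree = (c k).degree +
        if offset c k ≤ i ∧ i ≤ offset c k + (c k).degree then s.degree else 0 := by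
      intro k
      simp only [graftChildren]
      split_ifs with h
      · rw [ih k _ (by omega), add_comm]
      · rfl
    have hex : ∀ m (hm : m < d x + 1), i ≤ offset c ⟨m, hm⟩ + (c ⟨m, hm⟩).degree →
        ∃ k : Fin (d x + 1), offset c k ≤ i ∧ i ≤ offset c k + (c k).degree := by
      intro m
      induction m with
      | zero =>
        intro hm h
        refine ⟨⟨0, hm⟩, ?_, h⟩
        exact (offset_zero c).le.trans (Nat.zero_le _)
      | succ m ihm =>
        intro hm h
        by_cases h' : offset c ⟨m + 1, hm⟩ ≤ i
        · exact ⟨_, h', h⟩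
        · refine ihm (by omega) ?_
          rw [offset_succ c m hm] at h'
          omega
    obtain ⟨k, hk⟩ := hex (d x) (by omega) (by
      have := offset_last c
      simp only [Fin.last] at this
      omega)
    have huniq : ∀ j, j ≠ k → ¬ (offset c j ≤ i ∧ i ≤ offset c j + (c j).degree) := by
      intro j hj h
      rcases lt_or_gt_of_ne hj with hj | hj
      · have := offset_mono_bound c hj
        omega
      · have := offset_mono_bound c hj
        omega
    rw [graft_node, degree, degree, Finset.sum_congr rfl fun k _ => key k,
      Finset.sum_add_distrib, Finset.sum_eq_single k (fun j _ hj => if_neg (huniq j hj))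
        (fun h => absurd (Finset.mem_univ k) h), if_pos hk]
    omega

theorem degree_graftChildren (s : PTree d) (i : ℕ) {n : ℕ} (c : Fin n → PTree d) (k : Fin n) :
    (graftChildren s i c k).degree = (c k).degree +
      if offset c k ≤ i ∧ i ≤ offset c k + (c k).degree then s.degree else 0 := by
  simp only [graftChildren]
  split_ifs with h
  · rw [degree_graft s _ _ (by omega), add_comm]
  · rfl

theorem offset_graftChildren (s : PTree d) (i : ℕ) {n : ℕ} (c : Fin n → PTree d) (k : Fin n) :
    offset (graftChildren s i c) k = offset c k + if i < offset c k then s.degree else 0 := by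
  obtain ⟨k, hk⟩ := k
  induction k with
  | zero =>
    obtain ⟨n, rfl⟩ : ∃ m, n = m + 1 := ⟨n - 1, by omega⟩
    have h1 := offset_zero c
    have h2 := offset_zero (graftChildren s i c)
    simp only [Fin.mk_zero'] at *
    simp [h1, h2]
  | succ k ih =>
    have ih := ih (by omega)
    have h := degree_graftChildren s i c ⟨k, by omega⟩
    rw [offset_succ _ k hk, offset_succ _ k hk, ih, h]
    split_ifs <;> omega

theorem graftChildren_of (s : PTree d) {i : ℕ} {n : ℕ} (c : Fin n → PTree d) {k : Fin n}
    (h1 : offset c k ≤ i) (h2 : i ≤ offset c k + (c k).degree) :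
    graftChildren s i c k = graft s (i - offset c k) (c k) := if_pos ⟨h1, h2⟩

theorem graftChildren_of_not (s : PTree d) {i : ℕ} {n : ℕ} (c : Fin n → PTree d) {k : Fin n}
    (h : ¬ (offset c k ≤ i ∧ i ≤ offset c k + (c k).degree)) :
    graftChildren s i c k = c k := if_neg h

theorem graft_assoc (s t u : PTree d) : ∀ i j, i ≤ t.degree → j ≤ u.degree →
    graft (graft s i t) j u = graft s (i + j) (graft t j u) := by
  induction u with
  | leaf =>
    intro i j hi hj
    simp only [degree, Nat.le_zero] at hj
    subst hj
    rfl
  | node x c ih =>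
    intro i j hi hj
    rw [graft_node, graft_node, graft_node]
    congr 1
    funext k
    have h1 := degree_graftChildren t j c k
    have h2 := offset_graftChildren t j c k
    by_cases hA : offset c k ≤ j ∧ j ≤ offset c k + (c k).degree
    · rw [if_pos hA] at h1
      rw [if_neg (by omega)] at h2
      rw [graftChildren_of _ _ hA.1 hA.2, graftChildren_of s _ (by omega) (by omega), h2,
        graftChildren_of _ _ hA.1 hA.2, ih k _ _ hi (by omega)]
      congr 1
      omega
    · rw [if_neg hA] at h1
      rw [graftChildren_of_not _ _ hA, graftChildren_of_not s _ (by split_ifs at h2 <;> omega),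
        graftChildren_of_not _ _ hA]

theorem graft_comm (s t u : PTree d) : ∀ i j, i < j → j ≤ u.degree →
    graft s i (graft t j u) = graft t (j + s.degree) (graft s i u) := by
  induction u with
  | leaf =>
    intro i j hi hj
    simp only [degree] at hj
    omega
  | node x c ih =>
    intro i j hi hj
    rw [graft_node, graft_node, graft_node, graft_node]
    congr 1
    funext k
    have h1 := degree_graftChildren t j c k
    have h2 := offset_graftChildren t j c k
    have h3 := degree_graftChildren s i c k
    have h4 := offset_graftChildren s i c k
    by_cases hA : offset c k ≤ j ∧ j ≤ offset c k + (c k).degree <;>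
    by_cases hB : offset c k ≤ i ∧ i ≤ offset c k + (c k).degree
    · rw [if_pos hA] at h1
      rw [if_neg (by omega)] at h2
      rw [if_pos hB] at h3
      rw [if_neg (by omega)] at h4
      rw [graftChildren_of s _ (by omega) (by omega), h2, graftChildren_of _ _ hA.1 hA.2,
        graftChildren_of t _ (by omega) (by omega), h4, graftChildren_of _ _ hB.1 hB.2,
        ih k _ _ (by omega) (by omega)]
      congr 1
      omega
    · rw [if_pos hA] at h1
      rw [if_neg (by omega)] at h2
      rw [if_neg hB] at h3
      rw [if_pos (by omega)] at h4
      rw [graftChildren_of_not s _ (by omega), graftChildren_of _ _ hA.1 hA.2,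
        graftChildren_of t _ (by omega) (by omega), h4, graftChildren_of_not _ _ hB]
      congr 1
      omega
    · rw [if_neg hA] at h1
      rw [if_neg (by omega)] at h2
      rw [if_pos hB] at h3
      rw [if_neg (by omega)] at h4
      rw [graftChildren_of s _ (by omega) (by omega), h2, graftChildren_of_not _ _ hA,
        graftChildren_of_not t _ (by omega), graftChildren_of _ _ hB.1 hB.2, add_zero]
    · rw [if_neg hA] at h1
      rw [if_neg hB] at h3
      rw [graftChildren_of_not s _ (by split_ifs at h2 <;> omega), graftChildren_of_not _ _ hA,
        graftChildren_of_not t _ (by split_ifs at h4 <;> omega), graftChildren_of_not _ _ hB]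

/-! #### Cuts -/

theorem degree_update {x : ι} (c : Fin (d x + 1) → PTree d) (k : Fin (d x + 1)) (t : PTree d) :
    (node x (Function.update c k t)).degree + (c k).degree = (node x c).degree + t.degree := by
  have h := Finset.add_sum_erase Finset.univ (fun j => (c j).degree) (Finset.mem_univ k)
  have h' := Finset.add_sum_erase Finset.univ (fun j => (Function.update c k t j).degree)
    (Finset.mem_univ k)
  have h2 : ∑ j ∈ Finset.univ.erase k, (Function.update c k t j).degree =
      ∑ j ∈ Finset.univ.erase k, (c j).degree :=
    Finset.sum_congr rfl fun j hj => by
      rw [Function.update_of_ne (Finset.ne_of_mem_erase hj)]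
  rw [degree, degree, ← h, ← h', h2]
  simp only [Function.update_self]
  omega

theorem degree_cuts (t : PTree d) : ∀ p ∈ t.cuts, p.1.degree + p.2.degree = t.degree := by
  induction t with
  | leaf => intro p hp; simp only [cuts, Multiset.mem_singleton] at hp; subst hp; rfl
  | node x c ih =>
    intro p hp
    simp only [cuts, Multiset.mem_add, Multiset.mem_map] at hp
    rcases hp with ⟨q, hq, rfl⟩ | ⟨q, hq, rfl⟩
    · have h1 := ih _ q hq
      have h2 := degree_update c 0 q.2
      simp only
      omega
    · have h1 := ih _ q hq
      have h2 := degree_update c (Fin.last _) q.1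
      simp only
      omega

/-- Besides `| ⊗ t` and `t ⊗ |`, the terms of `Δ₊(t)` involve no trivial tree. -/
theorem cuts_eq (t : PTree d) (ht : t ≠ leaf) : ∃ R : Multiset (PTree d × PTree d),
    t.cuts = (leaf, t) ::ₘ (t, leaf) ::ₘ R ∧ ∀ p ∈ R, p.1 ≠ leaf ∧ p.2 ≠ leaf := by
  induction t with
  | leaf => exact absurd rfl ht
  | node x c ih =>
    obtain ⟨R, hR, hR'⟩ : ∃ R : Multiset (PTree d × PTree d),
        (c 0).cuts.map (fun p => (p.1, node x (Function.update c 0 p.2))) =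
          (leaf, node x c) ::ₘ R ∧ ∀ p ∈ R, p.1 ≠ leaf ∧ p.2 ≠ leaf := by
      by_cases h0 : c 0 = leaf
      · refine ⟨0, ?_, by simp⟩
        have : Function.update c 0 leaf = c := by rw [← h0, Function.update_eq_self]
        rw [h0, cuts, Multiset.map_singleton, this]
        rfl
      · obtain ⟨R, hR, hR'⟩ := ih 0 h0
        refine ⟨(c 0, node x (Function.update c 0 leaf)) ::ₘ
          R.map (fun p => (p.1, node x (Function.update c 0 p.2))), ?_, ?_⟩
        · simp [hR]
        · intro p hp
          simp only [Multiset.mem_cons, Multiset.mem_map] at hp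
          rcases hp with rfl | ⟨q, hq, rfl⟩
          · exact ⟨h0, by simp⟩
          · exact ⟨(hR' q hq).1, by simp⟩
    obtain ⟨R₂, hR₂, hR₂'⟩ : ∃ R : Multiset (PTree d × PTree d),
        (c (Fin.last _)).cuts.map
          (fun p => (node x (Function.update c (Fin.last _) p.1), p.2)) =
          (node x c, leaf) ::ₘ R ∧ ∀ p ∈ R, p.1 ≠ leaf ∧ p.2 ≠ leaf := by
      by_cases h0 : c (Fin.last _) = leaf
      · refine ⟨0, ?_, by simp⟩
        have : Function.update c (Fin.last _) leaf = c := by rw [← h0, Function.update_eq_self]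
        rw [h0, cuts, Multiset.map_singleton, this]
        rfl
      · obtain ⟨R, hR, hR'⟩ := ih (Fin.last _) h0
        refine ⟨(node x (Function.update c (Fin.last _) leaf), c (Fin.last _)) ::ₘ
          R.map (fun p => (node x (Function.update c (Fin.last _) p.1), p.2)), ?_, ?_⟩
        · rw [hR, Multiset.map_cons, Multiset.map_cons, Multiset.cons_swap]
          simp
        · intro p hp
          simp only [Multiset.mem_cons, Multiset.mem_map] at hp
          rcases hp with rfl | ⟨q, hq, rfl⟩
          · exact ⟨by simp, h0⟩
          · exact ⟨by simp, (hR' q hq).2⟩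
    refine ⟨R + R₂, ?_, ?_⟩
    · rw [cuts, hR, hR₂, Multiset.cons_add, Multiset.add_cons]
    · intro p hp
      rcases Multiset.mem_add.1 hp with hp | hp
      · exact hR' p hp
      · exact hR₂' p hp

theorem zero_ne_last (hd : ∀ x, 0 < d x) (x : ι) : (0 : Fin (d x + 1)) ≠ Fin.last _ := by
  intro h
  have := congrArg Fin.val h
  have := hd x
  simp at *
  omega

theorem cuts_coassoc (hd : ∀ x, 0 < d x) (t : PTree d) :
    (t.cuts.bind fun p => p.1.cuts.map fun q => (q.1, q.2, p.2)) =
      t.cuts.bind fun p => p.2.cuts.map fun q => (p.1, q.1, q.2) := by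
  induction t with
  | leaf => rfl
  | node x c ih =>
    have hne := zero_ne_last hd x
    have i0 := congrArg (Multiset.map fun r : PTree d × PTree d × PTree d =>
      (r.1, r.2.1, node x (Function.update c 0 r.2.2))) (ih 0)
    have i1 := congrArg (Multiset.map fun r : PTree d × PTree d × PTree d =>
      (node x (Function.update c (Fin.last _) r.1), r.2.1, r.2.2)) (ih (Fin.last _))
    simp only [Multiset.map_bind, Multiset.map_map, Function.comp_def] at i0 i1
    simp only [cuts, Multiset.add_bind, Multiset.bind_map, Multiset.map_add, Multiset.map_map,
      Function.comp_def, Function.update_self, Function.update_idem, Multiset.bind_add,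
      Function.update_of_ne hne, Function.update_of_ne hne.symm, i0, i1,
      Function.update_comm hne.symm]
    rw [Multiset.bind_map_comm]
    abel

theorem offset_update_last {x : ι} (c : Fin (d x + 1) → PTree d) (a : PTree d)
    (k : Fin (d x + 1)) : offset (Function.update c (Fin.last _) a) k = offset c k := by
  refine Finset.sum_congr rfl fun j hj => ?_
  have hj' : j < k := (Finset.mem_filter.1 hj).2
  rw [Function.update_of_ne (ne_of_lt (lt_of_lt_of_le hj' (Fin.le_last k)))]

theorem offset_update_zero {x : ι} (c : Fin (d x + 1) → PTree d) (b : PTree d)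
    (k : Fin (d x + 1)) (hk : k ≠ 0) :
    offset (Function.update c 0 b) k + (c 0).degree = offset c k + b.degree := by
  have h0 : (0 : Fin (d x + 1)) ∈ Finset.univ.filter (· < k) := by
    simp [Fin.pos_iff_ne_zero, hk]
  rw [offset, offset, ← Finset.add_sum_erase _ _ h0, ← Finset.add_sum_erase _ _ h0,
    Function.update_self, Finset.sum_congr rfl fun j hj => by
      rw [Function.update_of_ne (Finset.ne_of_mem_erase hj)]]
  omega

theorem graftChildren_zero (s : PTree d) {x : ι} (c : Fin (d x + 1) → PTree d) {i : ℕ}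
    (hi : i ≤ (c 0).degree) :
    graftChildren s i c = Function.update c 0 (graft s i (c 0)) := by
  funext k
  by_cases hk : k = 0
  · subst hk
    have h := offset_zero c
    rw [graftChildren_of s c (by omega) (by omega), Function.update_self, h, Nat.sub_zero]
  · have h := offset_mono_bound c (Fin.pos_iff_ne_zero.2 hk)
    have h0 := offset_zero c
    rw [graftChildren_of_not s c (by omega), Function.update_of_ne hk]

theorem graftChildren_last (s : PTree d) {x : ι} (c : Fin (d x + 1) → PTree d) {i : ℕ}
    (hi : offset c (Fin.last _) ≤ i)
    (hi' : i ≤ offset c (Fin.last _) + (c (Fin.last _)).degree) :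
    graftChildren s i c = Function.update c (Fin.last _)
      (graft s (i - offset c (Fin.last _)) (c (Fin.last _))) := by
  funext k
  by_cases hk : k = Fin.last _
  · subst hk
    rw [graftChildren_of s c hi hi', Function.update_self]
  · have h := offset_mono_bound c (Fin.lt_last_iff_ne_last.2 hk)
    rw [graftChildren_of_not s c (by omega), Function.update_of_ne hk]

theorem graft_update_zero_of_lt (s : PTree d) {x : ι} (c : Fin (d x + 1) → PTree d)
    (b : PTree d) {i j : ℕ} (hj : b.degree < j) (hi : i + b.degree = j + (c 0).degree) :
    graft s j (node x (Function.update c 0 b)) =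
      node x (Function.update (graftChildren s i c) 0 b) := by
  rw [graft_node]
  congr 1
  funext k
  by_cases hk : k = 0
  · subst hk
    have h := offset_zero (Function.update c 0 b)
    rw [graftChildren_of_not _ _ (by simp only [Function.update_self]; omega),
      Function.update_self, Function.update_self]
  · have h := offset_update_zero c b k hk
    have h' : (Function.update c 0 b k) = c k := Function.update_of_ne hk _ _
    rw [Function.update_of_ne hk]
    by_cases hA : offset c k ≤ i ∧ i ≤ offset c k + (c k).degree
    · rw [graftChildren_of _ _ hA.1 hA.2, graftChildren_of _ _ (by omega)
        (by rw [h']; omega), h']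
      congr 1
      omega
    · rw [graftChildren_of_not _ _ hA, graftChildren_of_not _ _ (by rw [h']; omega), h']

theorem graft_update_last_of_lt (s : PTree d) {x : ι} (c : Fin (d x + 1) → PTree d)
    (a : PTree d) {i : ℕ} (hi : i < offset c (Fin.last _)) :
    graft s i (node x (Function.update c (Fin.last _) a)) =
      node x (Function.update (graftChildren s i c) (Fin.last _) a) := by
  rw [graft_node]
  congr 1
  funext k
  have h := offset_update_last c a k
  by_cases hk : k = Fin.last _
  · subst hk
    rw [graftChildren_of_not _ _ (by omega), Function.update_self, Function.update_self]
  · have h' : (Function.update c (Fin.last _) a k) = c k := Function.update_of_ne hk _ _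
    rw [Function.update_of_ne hk]
    simp only [graftChildren, h, h']

theorem graft_update_zero (s : PTree d) {x : ι} (c : Fin (d x + 1) → PTree d)
    (b : PTree d) {j : ℕ} (hj : j ≤ b.degree) :
    graft s j (node x (Function.update c 0 b)) = node x (Function.update c 0 (graft s j b)) := by
  rw [graft_node, graftChildren_zero s _ (by simpa using hj), Function.update_self,
    Function.update_idem]

theorem graft_update_last (s : PTree d) {x : ι} (c : Fin (d x + 1) → PTree d)
    (a : PTree d) {i : ℕ} (hi : offset c (Fin.last _) ≤ i)
    (hi' : i ≤ offset c (Fin.last _) + a.degree) :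
    graft s i (node x (Function.update c (Fin.last _) a)) =
      node x (Function.update c (Fin.last _) (graft s (i - offset c (Fin.last _)) a)) := by
  rw [graft_node, graftChildren_last s _ (by rwa [offset_update_last])
    (by rwa [offset_update_last, Function.update_self]), Function.update_self,
    Function.update_idem, offset_update_last]

theorem cuts_graft (s t : PTree d) : ∀ i, i ≤ t.degree →
    (graft s i t).cuts = t.cuts.bind fun p =>
      if p.1.degree < i then {(p.1, graft s (i - p.1.degree) p.2)}
      else if i < p.1.degree then {(graft s i p.1, p.2)}
      else s.cuts.map fun q => (graft q.1 i p.1, graft q.2 0 p.2) := by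
  induction t with
  | leaf =>
    intro i hi
    simp only [degree, Nat.le_zero] at hi
    subst hi
    simp [cuts, graft, degree]
  | node x c ih =>
    intro i hi
    rw [graft_node, cuts, cuts, Multiset.add_bind, Multiset.bind_map, Multiset.bind_map]
    congr 1
    · by_cases h0 : i ≤ (c 0).degree
      · rw [graftChildren_zero s c h0, Function.update_self, ih 0 i h0, Multiset.map_bind]
        refine Multiset.bind_congr fun p hp => ?_
        have hdeg := degree_cuts _ p hp
        simp only [Function.update_idem]
        split_ifs with h1 h2
        · rw [Multiset.map_singleton, graft_update_zero _ _ _ (by omega)]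
        · rw [Multiset.map_singleton]
        · rw [Multiset.map_map]
          refine Multiset.map_congr rfl fun q _ => ?_
          rw [graft_update_zero _ _ _ (Nat.zero_le _)]
          rfl
      · have hc : graftChildren s i c 0 = c 0 :=
          graftChildren_of_not s c (by rw [offset_zero]; omega)
        rw [hc, ← Multiset.bind_singleton]
        refine Multiset.bind_congr fun p hp => ?_
        have hdeg := degree_cuts _ p hp
        rw [if_pos (by simp only; omega),
          graft_update_zero_of_lt s c p.2 (i := i) (by simp only; omega) (by simp only; omega)]
    · have hlast := offset_last c
      by_cases h0 : offset c (Fin.last _) ≤ i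
      · rw [graftChildren_last s c h0 (by omega), Function.update_self,
          ih (Fin.last _) _ (by omega), Multiset.map_bind]
        refine Multiset.bind_congr fun p hp => ?_
        have hdeg := degree_cuts _ p hp
        have hdeg2 := degree_update c (Fin.last _) p.1
        simp only [Function.update_idem]
        split_ifs with h1 h2 h3 h4 h5 h6 <;> try omega
        · rw [Multiset.map_singleton, show i - (node x (Function.update c (Fin.last _) p.1)).degree =
            i - offset c (Fin.last _) - p.1.degree by omega]
        · rw [Multiset.map_singleton, graft_update_last _ _ _ h0 (by omega)]
        · rw [Multiset.map_map]
          refine Multiset.map_congr rfl fun q _ => ?_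
          rw [graft_update_last _ _ _ h0 (by omega)]
          rfl
      · have hc : graftChildren s i c (Fin.last _) = c (Fin.last _) :=
          graftChildren_of_not s c (by omega)
        rw [hc, ← Multiset.bind_singleton]
        refine Multiset.bind_congr fun p hp => ?_
        have hdeg := degree_cuts _ p hp
        have hdeg2 := degree_update c (Fin.last _) p.1
        rw [if_neg (by simp only; omega), if_pos (by simp only; omega),
          graft_update_last_of_lt s c p.1 (by omega)]

end PTree

/-! ### The free grafting bialgebra on a positively graded set -/

/-- The vector space `K[T_{∞,X}]` spanned by the coloured planar trees different from `|`. -/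
abbrev TreeSpace (K : Type*) [Field K] {ι : Type*} (d : ι → ℕ) : Type _ :=
  {t : PTree d // t ≠ PTree.leaf} →₀ K

noncomputable section

namespace TreeSpace

open PTree

variable {K : Type*} [Field K] {ι : Type*} {d : ι → ℕ}

/-- The basis vector of a tree; the trivial tree `|` is sent to zero. -/
noncomputable def vec (K : Type*) [Field K] : PTree d → TreeSpace K d
  | leaf => 0
  | node x c => Finsupp.single ⟨node x c, by simp⟩ 1

theorem vec_leaf : vec K (leaf : PTree d) = 0 := rfl

theorem single_eq_vec (t : {t : PTree d // t ≠ leaf}) :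
    (Finsupp.single t 1 : TreeSpace K d) = vec K t.1 := by
  obtain ⟨t, ht⟩ := t
  cases t with
  | leaf => exact absurd rfl ht
  | node x c => rfl

theorem vec_induction {p : TreeSpace K d → Prop} (add : ∀ x y, p x → p y → p (x + y))
    (smul : ∀ (a : K) x, p x → p (a • x)) (vec : ∀ t, t ≠ leaf → p (vec K t))
    (zero : p 0) (x : TreeSpace K d) : p x := by
  induction x using Finsupp.induction_linear with
  | zero => exact zero
  | add x y hx hy => exact add x y hx hy
  | single t a =>
    rw [← mul_one a, ← smul_eq_mul, ← Finsupp.smul_single, single_eq_vec]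
    exact smul _ _ (vec _ t.2)

/-- The homogeneous component of degree `n`. -/
def deg (K : Type*) [Field K] (d : ι → ℕ) (n : ℕ) : Submodule K (TreeSpace K d) :=
  Submodule.span K (vec K '' {t | t.degree = n})

theorem vec_mem (t : PTree d) : vec K t ∈ deg K d t.degree :=
  Submodule.subset_span ⟨t, rfl, rfl⟩

theorem deg_induction {n : ℕ} {p : TreeSpace K d → Prop}
    (add : ∀ x y, p x → p y → p (x + y)) (smul : ∀ (a : K) x, p x → p (a • x)) (zero : p 0)
    (vec : ∀ t, t ≠ leaf → t.degree = n → p (vec K t)) {x : TreeSpace K d}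
    (hx : x ∈ deg K d n) : p x := by
  refine Submodule.span_induction (p := fun x _ => p x) ?_ zero (fun x y _ _ => add x y)
    (fun a x _ => smul a x) hx
  rintro _ ⟨t, ht, rfl⟩
  cases t with
  | leaf => exact zero
  | node x c => exact vec _ (by simp) ht

/-- Linear extension of a function of trees. -/
noncomputable def extend {M : Type*} [AddCommGroup M] [Module K M] (f : PTree d → M) :
    TreeSpace K d →ₗ[K] M :=
  Finsupp.linearCombination K fun t => f t.1

theorem extend_vec {M : Type*} [AddCommGroup M] [Module K M] (f : PTree d → M) {t : PTree d}
    (ht : t ≠ leaf) : extend (K := K) f (vec K t) = f t := by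
  rw [← single_eq_vec ⟨t, ht⟩, extend, Finsupp.linearCombination_single, one_smul]

theorem isInternal_deg (K : Type*) [Field K] (d : ι → ℕ) : DirectSum.IsInternal (deg K d) := by
  refine Grading.isInternal_of_proj _ ?_
    (fun n => extend fun t => if t.degree = n then vec K t else 0) ?_ ?_
  · rw [eq_top_iff]
    rintro x -
    induction x using vec_induction with
    | zero => exact Submodule.zero_mem _
    | add x y hx hy => exact Submodule.add_mem _ hx hy
    | smul a x hx => exact Submodule.smul_mem _ _ hx
    | vec t ht => exact Submodule.mem_iSup_of_mem _ (vec_mem t)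
  · intro n x hx
    refine deg_induction (p := fun x => extend (fun t => if t.degree = n then vec K t else 0) x
      = x) ?_ ?_ ?_ ?_ hx
    · intro x y h h'; rw [map_add, h, h']
    · intro a x h; rw [map_smul, h]
    · exact map_zero _
    · intro t ht h; rw [extend_vec _ ht, if_pos h]
  · intro n m hnm x hx
    refine deg_induction (p := fun x => extend (fun t => if t.degree = m then vec K t else 0) x
      = 0) ?_ ?_ ?_ ?_ hx
    · intro x y h h'; rw [map_add, h, h', add_zero]
    · intro a x h; rw [map_smul, h, smul_zero]
    · exact map_zero _
    · intro t ht h; rw [extend_vec _ ht, if_neg (by omega)]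

/-- The linear extension of grafting at the leaf `i`. -/
noncomputable def graft (K : Type*) [Field K] (d : ι → ℕ) (i : ℕ) :
    TreeSpace K d →ₗ[K] TreeSpace K d →ₗ[K] TreeSpace K d :=
  extend fun s => extend fun t => if i ≤ t.degree then vec K (s.graft i t) else 0

theorem graft_vec {i : ℕ} {s t : PTree d} (hs : s ≠ leaf) (ht : t ≠ leaf) (hi : i ≤ t.degree) :
    graft K d i (vec K s) (vec K t) = vec K (s.graft i t) := by
  rw [graft, extend_vec _ hs, extend_vec _ ht, if_pos hi]

theorem graft_vec_of_lt {i : ℕ} {s t : PTree d} (hs : s ≠ leaf) (ht : t ≠ leaf)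
    (hi : t.degree < i) : graft K d i (vec K s) (vec K t) = 0 := by
  rw [graft, extend_vec _ hs, extend_vec _ ht, if_neg (by omega)]

theorem graft_ne_leaf {i : ℕ} {s t : PTree d} (hs : s ≠ leaf) : s.graft i t ≠ leaf := by
  cases t with
  | leaf => exact hs
  | node x c => simp [PTree.graft]

/-- The free grafting algebra on the graded set `ι`. -/
noncomputable def graftingAlgebra (K : Type*) [Field K] {ι : Type*} (d : ι → ℕ) :
    GraftingAlgebra K (TreeSpace K d) where
  deg := deg K d
  isInternal := isInternal_deg K d
  graft := graft K d
  graft_of_lt := by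
    intro i m x y hy hi
    induction x using vec_induction with
    | zero => simp
    | add x x' h h' => rw [map_add, LinearMap.add_apply, h, h', add_zero]
    | smul a x h => rw [map_smul, LinearMap.smul_apply, h, smul_zero]
    | vec s hs =>
    refine deg_induction (p := fun y => graft K d i (vec K s) y = 0)
      (fun x y h h' => ?_) (fun a x h => ?_) (map_zero _) (fun t ht h => ?_) hy
    · rw [map_add, h, h', add_zero]
    · rw [map_smul, h, smul_zero]
    · exact graft_vec_of_lt hs ht (by omega)
  graft_mem := by
    intro i n m x y hx hy hi
    refine deg_induction (p := fun x => graft K d i x y ∈ deg K d (n + m))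
      (fun x y h h' => ?_) (fun a x h => ?_) (by simp) (fun s hs hsn => ?_) hx
    · rw [map_add, LinearMap.add_apply]; exact Submodule.add_mem _ h h'
    · rw [map_smul, LinearMap.smul_apply]; exact Submodule.smul_mem _ _ h
    refine deg_induction (p := fun y => graft K d i (vec K s) y ∈ deg K d (n + m))
      (fun x y h h' => ?_) (fun a x h => ?_) (by simp) (fun t ht htm => ?_) hy
    · rw [map_add]; exact Submodule.add_mem _ h h'
    · rw [map_smul]; exact Submodule.smul_mem _ _ h
    · rw [graft_vec hs ht (by omega), ← hsn, ← htm, ← degree_graft s t i (by omega)]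
      exact vec_mem _
  graft_assoc := by
    intro i j m r x y z hy hz hi hj
    induction x using vec_induction with
    | zero => simp
    | add x x' h h' => simp only [map_add, LinearMap.add_apply, h, h']
    | smul a x h => simp only [map_smul, LinearMap.smul_apply, h]
    | vec s hs =>
    refine deg_induction (p := fun y => graft K d j (graft K d i (vec K s) y) z =
        graft K d (i + j) (vec K s) (graft K d j y z))
      (fun x y h h' => ?_) (fun a x h => ?_) (by simp) (fun t ht htm => ?_) hy
    · simp only [map_add, LinearMap.add_apply, h, h']
    · simp only [map_smul, LinearMap.smul_apply, h]
    refine deg_induction (p := fun z => graft K d j (graft K d i (vec K s) (vec K t)) z =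
        graft K d (i + j) (vec K s) (graft K d j (vec K t) z))
      (fun x y h h' => ?_) (fun a x h => ?_) (by simp) (fun u hu hur => ?_) hz
    · simp only [map_add, h, h']
    · simp only [map_smul, h]
    have h1 := degree_graft t u j (by omega)
    rw [graft_vec hs ht (by omega), graft_vec ht hu (by omega),
      graft_vec (graft_ne_leaf hs) hu (by omega), graft_vec hs (graft_ne_leaf ht) (by omega),
      PTree.graft_assoc s t u i j (by omega) (by omega)]
  graft_comm := by
    intro i j n r x y z hx hz hi hj
    refine deg_induction (p := fun x => graft K d i x (graft K d j y z) =
        graft K d (j + n) y (graft K d i x z))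
      (fun x y h h' => ?_) (fun a x h => ?_) (by simp) (fun s hs hsn => ?_) hx
    · simp only [map_add, LinearMap.add_apply, h, h']
    · simp only [map_smul, LinearMap.smul_apply, h]
    induction y using vec_induction with
    | zero => simp
    | add x x' h h' => simp only [map_add, LinearMap.add_apply, h, h']
    | smul a x h => simp only [map_smul, LinearMap.smul_apply, h]
    | vec t ht =>
    refine deg_induction (p := fun z => graft K d i (vec K s) (graft K d j (vec K t) z) =
        graft K d (j + n) (vec K t) (graft K d i (vec K s) z))
      (fun x y h h' => ?_) (fun a x h => ?_) (by simp) (fun u hu hur => ?_) hz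
    · simp only [map_add, h, h']
    · simp only [map_smul, h]
    have h1 := degree_graft t u j (by omega)
    have h2 := degree_graft s u i (by omega)
    rw [graft_vec ht hu (by omega), graft_vec hs hu (by omega),
      graft_vec hs (graft_ne_leaf ht) (by omega), graft_vec ht (graft_ne_leaf hs) (by omega),
      PTree.graft_comm s t u i j hi (by omega), hsn]

theorem proj_vec (n : ℕ) (t : PTree d) :
    (graftingAlgebra K d).proj n (vec K t) = if t.degree = n then vec K t else 0 := by
  have h : vec K t ∈ (graftingAlgebra K d).deg t.degree := vec_mem t
  split_ifs with hn
  · subst hn; exact (graftingAlgebra K d).proj_of_mem h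
  · exact (graftingAlgebra K d).proj_of_mem_ne h hn

/-- The coproduct for which the colours are primitive. -/
noncomputable def comul (K : Type*) [Field K] (d : ι → ℕ) :
    TreeSpace K d →ₗ[K] TreeSpace K d ⊗[K] TreeSpace K d :=
  extend fun t => (t.cuts.map fun p => vec K p.1 ⊗ₜ[K] vec K p.2).sum

theorem comul_vec (t : PTree d) :
    comul K d (vec K t) = (t.cuts.map fun p => vec K p.1 ⊗ₜ[K] vec K p.2).sum := by
  cases t with
  | leaf => simp [cuts, vec_leaf]
  | node x c => rw [comul, extend_vec _ (by simp)]

theorem exists_comul_vec {t : PTree d} (ht : t ≠ leaf) :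
    ∃ R : Multiset (PTree d × PTree d), t.cuts = (leaf, t) ::ₘ (t, leaf) ::ₘ R ∧
      (∀ p ∈ R, p.1 ≠ leaf ∧ p.2 ≠ leaf ∧ p.1.degree + p.2.degree = t.degree) ∧
      comul K d (vec K t) = (R.map fun p => vec K p.1 ⊗ₜ[K] vec K p.2).sum := by
  obtain ⟨R, hR, hR'⟩ := cuts_eq t ht
  refine ⟨R, hR, fun p hp => ⟨(hR' p hp).1, (hR' p hp).2, degree_cuts t p (by simp [hR, hp])⟩, ?_⟩
  rw [comul_vec, hR]
  simp [vec_leaf]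

theorem degree_pos (hd : ∀ x, 0 < d x) {t : PTree d} (ht : t ≠ leaf) : 0 < t.degree := by
  cases t with
  | leaf => exact absurd rfl ht
  | node x c =>
    have := hd x
    rw [degree]
    omega

theorem comul_graft_vec {s t : PTree d} {i : ℕ} (hi : i ≤ t.degree) :
    comul K d (vec K (s.graft i t)) = (t.cuts.map fun p =>
      if p.1.degree < i then vec K p.1 ⊗ₜ[K] vec K (s.graft (i - p.1.degree) p.2)
      else if i < p.1.degree then vec K (s.graft i p.1) ⊗ₜ[K] vec K p.2
      else (s.cuts.map fun q =>
        vec K (q.1.graft i p.1) ⊗ₜ[K] vec K (q.2.graft 0 p.2)).sum).sum := by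
  rw [comul_vec, cuts_graft s t i hi, Multiset.map_bind, Multiset.sum_bind]
  congr 1
  refine Multiset.map_congr rfl fun p _ => ?_
  split_ifs <;> simp [Multiset.map_map]

theorem sum_proj_left (i : ℕ) (f : ℕ → TreeSpace K d →ₗ[K] TreeSpace K d) (a : PTree d)
    (y : TreeSpace K d) :
    ∑ k ∈ Finset.Icc 0 i, TensorProduct.map ((graftingAlgebra K d).proj k) (f k)
      (vec K a ⊗ₜ[K] y) = if a.degree ≤ i then vec K a ⊗ₜ[K] f a.degree y else 0 := by
  simp only [TensorProduct.map_tmul, proj_vec]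
  split_ifs with h
  · rw [Finset.sum_eq_single a.degree]
    · simp
    · intro b _ hb; simp [hb.symm]
    · intro h'; exact absurd (Finset.mem_Icc.2 ⟨Nat.zero_le _, h⟩) h'
  · refine Finset.sum_eq_zero fun k hk => ?_
    rw [if_neg (by have := (Finset.mem_Icc.1 hk).2; omega), TensorProduct.zero_tmul]

theorem sum_proj_right (i m : ℕ) (f : TreeSpace K d →ₗ[K] TreeSpace K d) (a : PTree d)
    (y : TreeSpace K d) (ham : a.degree ≤ m) :
    ∑ k ∈ Finset.Icc i m, TensorProduct.map (f ∘ₗ (graftingAlgebra K d).proj k) LinearMap.id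
      (vec K a ⊗ₜ[K] y) = if i ≤ a.degree then f (vec K a) ⊗ₜ[K] y else 0 := by
  simp only [TensorProduct.map_tmul, LinearMap.comp_apply, LinearMap.id_apply, proj_vec]
  split_ifs with h
  · rw [Finset.sum_eq_single a.degree]
    · simp
    · intro b _ hb; simp [hb.symm]
    · intro h'; exact absurd (Finset.mem_Icc.2 ⟨h, ham⟩) h'
  · refine Finset.sum_eq_zero fun k hk => ?_
    rw [if_neg (by have := (Finset.mem_Icc.1 hk).1; omega), map_zero, TensorProduct.zero_tmul]

theorem comul_graft_zero_vec (hd : ∀ x, 0 < d x) {s t : PTree d} (hs : s ≠ leaf)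
    (ht : t ≠ leaf) : comul K d (graft K d 0 (vec K s) (vec K t)) =
      TensorProduct.map LinearMap.id ((graft K d 0).flip (vec K t)) (comul K d (vec K s)) +
        vec K s ⊗ₜ[K] vec K t +
        TensorProduct.map (graft K d 0 (vec K s)) LinearMap.id (comul K d (vec K t)) := by
  obtain ⟨R, hR, hR', hRs⟩ := exists_comul_vec (K := K) hs
  obtain ⟨T, hT, hT', hTs⟩ := exists_comul_vec (K := K) ht
  have htp := degree_pos hd ht
  rw [graft_vec hs ht (Nat.zero_le _), comul_graft_vec (Nat.zero_le _), hT, hTs, hRs]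
  simp only [Multiset.map_cons, Multiset.sum_cons, map_multiset_sum, Multiset.map_map,
    Function.comp_def, TensorProduct.map_tmul, LinearMap.id_apply, LinearMap.flip_apply]
  rw [if_neg (Nat.not_lt_zero _), if_neg (by simp [degree]), if_neg (Nat.not_lt_zero _),
    if_pos htp, vec_leaf, TensorProduct.tmul_zero, zero_add, hR]
  simp only [Multiset.map_cons, Multiset.sum_cons, graft_leaf_left, PTree.graft, vec_leaf,
    TensorProduct.zero_tmul, zero_add]
  rw [add_comm (vec K s ⊗ₜ[K] vec K t)]
  congr 1
  · congr 2
    refine Multiset.map_congr rfl fun p hp => ?_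
    rw [graft_vec (hR' p hp).2.1 ht (Nat.zero_le _)]
  · congr 1
    refine Multiset.map_congr rfl fun p hp => ?_
    have hp' := hT' p hp
    rw [if_neg (Nat.not_lt_zero _), if_pos (degree_pos hd hp'.1),
      graft_vec hs hp'.1 (Nat.zero_le _)]

theorem comul_graft_vec_top (hd : ∀ x, 0 < d x) {s t : PTree d} (hs : s ≠ leaf)
    (ht : t ≠ leaf) : comul K d (graft K d t.degree (vec K s) (vec K t)) =
      ∑ k ∈ Finset.Icc 0 t.degree, TensorProduct.map ((graftingAlgebra K d).proj k)
        (graft K d (t.degree - k) (vec K s)) (comul K d (vec K t)) +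
      vec K t ⊗ₜ[K] vec K s +
      TensorProduct.map ((graft K d t.degree).flip (vec K t)) LinearMap.id
        (comul K d (vec K s)) := by
  obtain ⟨R, hR, hR', hRs⟩ := exists_comul_vec (K := K) hs
  obtain ⟨T, hT, hT', hTs⟩ := exists_comul_vec (K := K) ht
  have htp := degree_pos hd ht
  rw [graft_vec hs ht le_rfl, comul_graft_vec le_rfl, hT, hTs, hRs, ← LinearMap.sum_apply]
  simp only [Multiset.map_cons, Multiset.sum_cons, map_multiset_sum, Multiset.map_map,
    Function.comp_def, TensorProduct.map_tmul, LinearMap.id_apply, LinearMap.flip_apply,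
    LinearMap.sum_apply, proj_vec]
  rw [if_pos (show (leaf : PTree d).degree < t.degree from htp), vec_leaf, TensorProduct.zero_tmul, zero_add, if_neg (lt_irrefl _),
    if_neg (lt_irrefl _), hR]
  simp only [Multiset.map_cons, Multiset.sum_cons, graft_leaf_left, PTree.graft, vec_leaf,
    TensorProduct.tmul_zero, zero_add]
  rw [add_comm, ← add_assoc]
  congr 1
  · congr 2
    refine Multiset.map_congr rfl fun p hp => ?_
    have hp' := hT' p hp
    have h := sum_proj_left t.degree (fun k => graft K d (t.degree - k) (vec K s)) p.1 (vec K p.2)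
    simp only [TensorProduct.map_tmul, proj_vec] at h
    have h2 := degree_pos hd hp'.2.1
    rw [h, if_pos (by omega), if_pos (by omega), graft_vec hs hp'.2.1 (by omega)]
  · congr 1
    refine Multiset.map_congr rfl fun p hp => ?_
    rw [graft_vec (hR' p hp).1 ht le_rfl]

theorem map₂_sum_vec {i : ℕ} {p : PTree d × PTree d} (hp : p.1 ≠ leaf ∧ p.2 ≠ leaf)
    (hi : i ≤ p.1.degree) (R : Multiset (PTree d × PTree d))
    (hR : ∀ q ∈ R, q.1 ≠ leaf ∧ q.2 ≠ leaf) :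
    TensorProduct.map₂ (graft K d i) (graft K d 0)
      (R.map fun q => vec K q.1 ⊗ₜ[K] vec K q.2).sum (vec K p.1 ⊗ₜ[K] vec K p.2) =
    (R.map fun q => vec K (q.1.graft i p.1) ⊗ₜ[K] vec K (q.2.graft 0 p.2)).sum := by
  induction R using Multiset.induction_on with
  | empty => simp
  | cons q R ih =>
    have hq := hR q (Multiset.mem_cons_self _ _)
    simp only [Multiset.map_cons, Multiset.sum_cons, map_add, LinearMap.add_apply,
      ih fun q hq => hR q (Multiset.mem_cons_of_mem hq), TensorProduct.map₂_apply_tmul]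
    simp only [TensorProduct.map_tmul, graft_vec hq.1 hp.1 hi, graft_vec hq.2 hp.2 (Nat.zero_le _)]

theorem comul_graft_vec_mid {s t : PTree d} (hs : s ≠ leaf) (ht : t ≠ leaf) {i : ℕ}
    (h1 : 1 ≤ i) (h2 : i < t.degree) : comul K d (graft K d i (vec K s) (vec K t)) =
      ∑ k ∈ Finset.Icc 0 i, TensorProduct.map ((graftingAlgebra K d).proj k)
        (graft K d (i - k) (vec K s)) (comul K d (vec K t)) +
      TensorProduct.map₂ (graft K d i) (graft K d 0) (comul K d (vec K s))
        (TensorProduct.map ((graftingAlgebra K d).proj i) LinearMap.id (comul K d (vec K t))) +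
      ∑ k ∈ Finset.Icc i t.degree, TensorProduct.map
        (graft K d i (vec K s) ∘ₗ (graftingAlgebra K d).proj k) LinearMap.id
          (comul K d (vec K t)) := by
  obtain ⟨R, hR, hR', hRs⟩ := exists_comul_vec (K := K) hs
  obtain ⟨T, hT, hT', hTs⟩ := exists_comul_vec (K := K) ht
  rw [graft_vec hs ht h2.le, comul_graft_vec h2.le, hT, hTs, ← LinearMap.sum_apply,
    ← LinearMap.sum_apply]
  simp only [Multiset.map_cons, Multiset.sum_cons]
  rw [if_pos (by simp only [degree]; omega), if_neg (by omega), if_pos (by omega), vec_leaf,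
    TensorProduct.zero_tmul, TensorProduct.tmul_zero, zero_add, zero_add]
  simp only [map_multiset_sum, Multiset.map_map, Function.comp_def, ← Multiset.sum_map_add]
  congr 1
  refine Multiset.map_congr rfl fun p hp => ?_
  have hp' := hT' p hp
  rw [LinearMap.sum_apply, LinearMap.sum_apply,
    sum_proj_left i (fun k => graft K d (i - k) (vec K s)), sum_proj_right _ _ _ _ _ (by omega),
    TensorProduct.map_tmul, proj_vec, LinearMap.id_apply]
  rcases lt_trichotomy p.1.degree i with h | h | h
  · rw [if_pos h, if_pos h.le, if_neg h.ne, if_neg (by omega), TensorProduct.zero_tmul, map_zero,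
      add_zero, add_zero, graft_vec hs hp'.2.1 (by omega)]
  · rw [if_neg (by omega), if_neg (by omega), if_pos h.le, if_pos h, if_pos h.ge, hR, hRs, h,
      Nat.sub_self, graft_vec hs hp'.2.1 (Nat.zero_le _), graft_vec hs hp'.1 h.ge]
    simp only [Multiset.map_cons, Multiset.sum_cons, graft_leaf_left]
    rw [add_assoc, add_comm (vec K (PTree.graft s i p.1) ⊗ₜ[K] vec K p.2)]
    congr 2
    exact (map₂_sum_vec ⟨hp'.1, hp'.2.1⟩ h.ge R fun q hq => ⟨(hR' q hq).1, (hR' q hq).2.1⟩).symm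
  · rw [if_neg (by omega), if_pos h, if_neg (by omega), if_neg h.ne', if_pos h.le,
      TensorProduct.zero_tmul, map_zero, zero_add, zero_add, graft_vec hs hp'.1 h.le]

/-- The free grafting bialgebra on the positively graded set `ι`, with primitive colours. -/
noncomputable def graftingBialgebra (K : Type*) [Field K] {ι : Type*} (d : ι → ℕ)
    (hd : ∀ x, 0 < d x) : GraftingBialgebra K (TreeSpace K d) where
  toGraftingAlgebra := graftingAlgebra K d
  deg_zero := by
    refine Submodule.span_eq_bot.2 ?_
    rintro _ ⟨t, ht, rfl⟩
    cases t with
    | leaf => rfl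
    | node x c => exact absurd ht (degree_pos hd (t := node x c) (by simp)).ne'
  comul := comul K d
  comul_mem := by
    intro n x hx
    refine deg_induction (p := fun x => comul K d x ∈ _)
      (fun x y h h' => ?_) (fun a x h => ?_) (by simp) (fun t ht htn => ?_) hx
    · rw [map_add]; exact Submodule.add_mem _ h h'
    · rw [map_smul]; exact Submodule.smul_mem _ _ h
    · rw [comul_vec]
      refine multiset_sum_mem _ fun y hy => ?_
      obtain ⟨p, hp, rfl⟩ := Multiset.mem_map.1 hy
      refine Submodule.mem_iSup_of_mem (p.1.degree, p.2.degree) (Submodule.mem_iSup_of_mem ?_ ?_)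
      · rw [Finset.HasAntidiagonal.mem_antidiagonal, ← htn]
        exact degree_cuts t p hp
      · exact ⟨⟨_, vec_mem p.1⟩ ⊗ₜ ⟨_, vec_mem p.2⟩, rfl⟩
  coassoc := by
    intro x
    induction x using vec_induction with
    | zero => simp
    | add x x' h h' => simp only [map_add, h, h']
    | smul a x h => simp only [map_smul, h]
    | vec t ht =>
    have h := congrArg (fun s => (s.map fun q : PTree d × PTree d × PTree d =>
      vec K q.1 ⊗ₜ[K] (vec K q.2.1 ⊗ₜ[K] vec K q.2.2)).sum) (cuts_coassoc hd t)
    simp only [Multiset.map_bind, Multiset.sum_bind, Multiset.map_map, Function.comp_def] at h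
    have e1 : ∀ p : PTree d × PTree d, TensorProduct.assoc K (TreeSpace K d) (TreeSpace K d)
        (TreeSpace K d) (comul K d (vec K p.1) ⊗ₜ[K] vec K p.2) =
        (p.1.cuts.map fun q => vec K q.1 ⊗ₜ[K] (vec K q.2 ⊗ₜ[K] vec K p.2)).sum := by
      intro p
      rw [comul_vec]
      generalize p.1.cuts = s
      induction s using Multiset.induction_on with
      | empty => simp
      | cons a s ih => simp [TensorProduct.add_tmul, ih]
    have e2 : ∀ p : PTree d × PTree d, vec K p.1 ⊗ₜ[K] comul K d (vec K p.2) =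
        (p.2.cuts.map fun q => vec K p.1 ⊗ₜ[K] (vec K q.1 ⊗ₜ[K] vec K q.2)).sum := by
      intro p
      rw [comul_vec]
      generalize p.2.cuts = s
      induction s using Multiset.induction_on with
      | empty => simp
      | cons a s ih => simp [TensorProduct.tmul_add, ih]
    rw [comul_vec]
    simp only [map_multiset_sum, Multiset.map_map, Function.comp_def, TensorProduct.map_tmul,
      LinearMap.id_apply, e1, e2]
    exact h
  comul_graft_zero := by
    intro x y
    show comul K d (graft K d 0 x y) = TensorProduct.map LinearMap.id ((graft K d 0).flip y)
      (comul K d x) + x ⊗ₜ[K] y + TensorProduct.map (graft K d 0 x) LinearMap.id (comul K d y)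
    induction x using vec_induction with
    | zero => simp
    | add x x' h h' =>
      simp only [map_add, LinearMap.add_apply, h, h', TensorProduct.add_tmul,
        TensorProduct.map_add_left]
      abel
    | smul a x h =>
      simp only [map_smul, LinearMap.smul_apply, h, ← TensorProduct.smul_tmul',
        TensorProduct.map_smul_left, smul_add]
    | vec s hs =>
    induction y using vec_induction with
    | zero => simp
    | add x x' h h' =>
      simp only [map_add, h, h', TensorProduct.tmul_add, TensorProduct.map_add_right,
        LinearMap.add_apply]
      abel
    | smul a x h =>
      simp only [map_smul, LinearMap.smul_apply, h, TensorProduct.tmul_smul,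
        TensorProduct.map_smul_right, smul_add]
    | vec t ht =>
    exact comul_graft_zero_vec hd hs ht
  comul_graft := by
    intro i m x y hy h1 h2
    show comul K d (graft K d i x y) = ∑ k ∈ Finset.Icc 0 i,
        TensorProduct.map ((graftingAlgebra K d).proj k) (graft K d (i - k) x) (comul K d y) +
      TensorProduct.map₂ (graft K d i) (graft K d 0) (comul K d x)
        (TensorProduct.map ((graftingAlgebra K d).proj i) LinearMap.id (comul K d y)) +
      ∑ k ∈ Finset.Icc i m, TensorProduct.map
        (graft K d i x ∘ₗ (graftingAlgebra K d).proj k) LinearMap.id (comul K d y)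
    induction x using vec_induction with
    | zero => simp
    | add x x' h h' =>
      simp only [map_add, LinearMap.add_apply, h, h', TensorProduct.map_add_left,
        TensorProduct.map_add_right, LinearMap.add_comp, Finset.sum_add_distrib]
      abel
    | smul a x h =>
      simp only [map_smul, LinearMap.smul_apply, h, TensorProduct.map_smul_left,
        TensorProduct.map_smul_right, smul_add, LinearMap.smul_comp, Finset.smul_sum]
    | vec s hs =>
    refine deg_induction (p := fun y => comul K d (graft K d i (vec K s) y) =
      ∑ k ∈ Finset.Icc 0 i, TensorProduct.map ((graftingAlgebra K d).proj k)
        (graft K d (i - k) (vec K s)) (comul K d y) +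
      TensorProduct.map₂ (graft K d i) (graft K d 0) (comul K d (vec K s))
        (TensorProduct.map ((graftingAlgebra K d).proj i) LinearMap.id (comul K d y)) +
      ∑ k ∈ Finset.Icc i m, TensorProduct.map
        (graft K d i (vec K s) ∘ₗ (graftingAlgebra K d).proj k) LinearMap.id (comul K d y))
      (fun x y h h' => ?_) (fun a x h => ?_) (by simp) (fun t ht htm => ?_) hy
    · simp only [map_add, h, h', Finset.sum_add_distrib]
      abel
    · simp only [map_smul, h, smul_add, Finset.smul_sum]
    · subst htm
      exact comul_graft_vec_mid hs ht h1 h2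
  comul_graft_top := by
    intro m x y hy
    show comul K d (graft K d m x y) = ∑ k ∈ Finset.Icc 0 m,
        TensorProduct.map ((graftingAlgebra K d).proj k) (graft K d (m - k) x) (comul K d y) +
      y ⊗ₜ[K] x + TensorProduct.map ((graft K d m).flip y) LinearMap.id (comul K d x)
    induction x using vec_induction with
    | zero => simp
    | add x x' h h' =>
      simp only [map_add, LinearMap.add_apply, h, h', TensorProduct.tmul_add,
        TensorProduct.map_add_right, Finset.sum_add_distrib]
      abel
    | smul a x h =>
      simp only [map_smul, LinearMap.smul_apply, h, TensorProduct.map_smul_right, smul_add,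
        TensorProduct.tmul_smul, Finset.smul_sum]
    | vec s hs =>
    refine deg_induction (p := fun y => comul K d (graft K d m (vec K s) y) =
      ∑ k ∈ Finset.Icc 0 m, TensorProduct.map ((graftingAlgebra K d).proj k)
        (graft K d (m - k) (vec K s)) (comul K d y) + y ⊗ₜ[K] vec K s +
      TensorProduct.map ((graft K d m).flip y) LinearMap.id (comul K d (vec K s)))
      (fun x y h h' => ?_) (fun a x h => ?_) (by simp) (fun t ht htm => ?_) hy
    · simp only [map_add, h, h', Finset.sum_add_distrib, TensorProduct.add_tmul,
        TensorProduct.map_add_left, LinearMap.add_apply]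
      abel
    · simp only [map_smul, h, smul_add, Finset.smul_sum, ← TensorProduct.smul_tmul',
        TensorProduct.map_smul_left, LinearMap.smul_apply]
    · subst htm
      exact comul_graft_vec_top hd hs ht

end TreeSpace

end


/-! ### The universal enveloping grafting bialgebra -/

/-- A basis of a graded vector space that consists of homogeneous elements. -/
structure HomogeneousBasis {K V : Type*} [Field K] [AddCommGroup V] [Module K V]
    (G : Grading K V) (ι : Type*) where
  basis : Module.Basis ι K V
  degree : ι → ℕ
  mem : ∀ i, basis i ∈ G.deg (degree i)

noncomputable section

namespace PrimGrAlgebra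

variable {K V : Type*} [Field K] [AddCommGroup V] [Module K V] {ι : Type*}

theorem degree_pos (P : PrimGrAlgebra K V) (X : HomogeneousBasis P.toGrading ι) (i : ι) :
    0 < X.degree i := by
  rcases Nat.eq_zero_or_pos (X.degree i) with h | h
  · have hm := X.mem i
    rw [h, P.deg_zero, Submodule.mem_bot] at hm
    exact absurd hm (X.basis.ne_zero i)
  · exact h

/-- The free grafting algebra `K[T_{∞,X}]` on the homogeneous basis `X` of `V`, with its
coproduct for which the elements of `X` are primitive. -/
def free (P : PrimGrAlgebra K V) (X : HomogeneousBasis P.toGrading ι) :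
    GraftingBialgebra K (TreeSpace K X.degree) :=
  TreeSpace.graftingBialgebra K X.degree (P.degree_pos X)

/-- The linear embedding of `V` in the free grafting algebra that sends an element `x` of `X`
to the corolla coloured by `x`. -/
def incl (P : PrimGrAlgebra K V) (X : HomogeneousBasis P.toGrading ι) :
    V →ₗ[K] TreeSpace K X.degree :=
  X.basis.constr K fun i => TreeSpace.vec K (PTree.corolla X.degree i)

theorem incl_basis (P : PrimGrAlgebra K V) (X : HomogeneousBasis P.toGrading ι) (i : ι) :
    P.incl X (X.basis i) = TreeSpace.vec K (PTree.corolla X.degree i) := by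
  rw [incl, Module.Basis.constr_basis]

/-- The relations of the universal enveloping algebra of `V`: for `x, y ∈ X`, the bracket and
the operations `•_p`, `1 ≤ p < |y|`, of the free grafting algebra are identified with those
of `V`. -/
def relations (P : PrimGrAlgebra K V) (X : HomogeneousBasis P.toGrading ι) :
    Set (TreeSpace K X.degree) :=
  {r | ∃ i j, r = (P.free X).bracket (P.incl X (X.basis i)) (P.incl X (X.basis j)) -
      P.incl X (P.bracket (X.basis i) (X.basis j))} ∪
  {r | ∃ i j p, 1 ≤ p ∧ p < X.degree j ∧
    r = (P.free X).graft p (P.incl X (X.basis i)) (P.incl X (X.basis j)) -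
      P.incl X (P.comp p (X.basis i) (X.basis j))}

theorem incl_basis_mem (P : PrimGrAlgebra K V) (X : HomogeneousBasis P.toGrading ι) (i : ι) :
    P.incl X (X.basis i) ∈ (P.free X).deg (X.degree i) := by
  have h := TreeSpace.vec_mem (K := K) (PTree.corolla X.degree i)
  rw [show (PTree.corolla X.degree i).degree = X.degree i by
    simp [PTree.corolla, PTree.degree]] at h
  rw [incl_basis]
  exact h

theorem incl_mem (P : PrimGrAlgebra K V) (X : HomogeneousBasis P.toGrading ι) {n : ℕ} {x : V}
    (hx : x ∈ P.deg n) : P.incl X x ∈ (P.free X).deg n := by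
  have h : P.incl X ∘ₗ P.proj n = (P.free X).proj n ∘ₗ P.incl X := by
    refine X.basis.ext fun i => ?_
    rw [LinearMap.comp_apply, LinearMap.comp_apply]
    by_cases hn : X.degree i = n
    · subst hn
      rw [P.proj_of_mem (X.mem i), (P.free X).proj_of_mem (P.incl_basis_mem X i)]
    · rw [P.proj_of_mem_ne (X.mem i) hn, (P.free X).proj_of_mem_ne (P.incl_basis_mem X i) hn,
        map_zero]
  have h' := LinearMap.congr_fun h x
  rw [LinearMap.comp_apply, LinearMap.comp_apply, P.proj_of_mem hx] at h'
  rw [h']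
  exact (P.free X).proj_mem n _

theorem incl_mem_prim (P : PrimGrAlgebra K V) (X : HomogeneousBasis P.toGrading ι) (x : V) :
    P.incl X x ∈ (P.free X).prim := by
  have h : (P.free X).comul ∘ₗ P.incl X = 0 := by
    refine X.basis.ext fun i => ?_
    rw [LinearMap.comp_apply, incl_basis, LinearMap.zero_apply]
    refine (TreeSpace.comul_vec _).trans ?_
    simp [PTree.corolla, PTree.cuts, TreeSpace.vec_leaf]
  exact LinearMap.congr_fun h x

theorem relations_homogeneous (P : PrimGrAlgebra K V) (X : HomogeneousBasis P.toGrading ι) :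
    ∀ r ∈ P.relations X, ∃ n, r ∈ (P.free X).deg n := by
  rintro r (⟨i, j, rfl⟩ | ⟨i, j, p, h1, h2, rfl⟩)
  · refine ⟨X.degree i + X.degree j, Submodule.sub_mem _ ?_
      (P.incl_mem X (P.bracket_mem (X.mem i) (X.mem j)))⟩
    exact ((P.free X).toGraftingAlgebra.toPrimGr (P.free X).deg_zero).bracket_mem
      (P.incl_basis_mem X i) (P.incl_basis_mem X j)
  · exact ⟨X.degree i + X.degree j, Submodule.sub_mem _
      ((P.free X).graft_mem (P.incl_basis_mem X i) (P.incl_basis_mem X j) h2.le)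
      (P.incl_mem X (P.comp_mem (X.mem i) (X.mem j) h1 h2))⟩

theorem relations_primitive (P : PrimGrAlgebra K V) (X : HomogeneousBasis P.toGrading ι) :
    ∀ r ∈ P.relations X, (P.free X).comul r = 0 := by
  rintro r (⟨i, j, rfl⟩ | ⟨i, j, p, h1, h2, rfl⟩)
  · exact Submodule.sub_mem (P.free X).prim ((P.free X).bracket_mem_prim _
      (P.incl_mem_prim X _) _ (P.incl_mem_prim X _)) (P.incl_mem_prim X _)
  · rw [← (P.free X).inner_of_mem _ (P.incl_basis_mem X j) h1 h2]
    exact Submodule.sub_mem (P.free X).prim ((P.free X).inner_mem_prim _ _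
      (P.incl_mem_prim X _) _ (P.incl_mem_prim X _)) (P.incl_mem_prim X _)

/-- The universal enveloping grafting bialgebra `U_gr(V)`: the quotient of the free grafting
bialgebra on a homogeneous basis `X` of `V` by the ideal generated by the relations. -/
def envelop (P : PrimGrAlgebra K V) (X : HomogeneousBasis P.toGrading ι) :
    GraftingBialgebra K (TreeSpace K X.degree ⧸ (P.free X).idealSpan (P.relations X)) :=
  (P.free X).quot _ ((P.free X).isIdeal_idealSpan _)
    ((P.free X).proj_mem_idealSpan (P.relations_homogeneous X))
    ((P.free X).mkQ_comul_idealSpan (P.relations_homogeneous X) (P.relations_primitive X))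

end PrimGrAlgebra

end

end GraftingCMM

/-! Write `U` for the enveloping bialgebra of `V`. Everything rests on a weak Poincaré–Birkhoff–Witt
statement. On the one hand `U` is spanned by the nested products v₁ •₀ (v₂ •₀ (⋯)) of elements of
`V` (`monomialSpan_eq_top`). On the other hand there is a linear map p : U → V that is the identity
on `V` and kills every product v •₀ y (`exists_envelop_proj`).

Spanning is a rewriting argument. For 1 ≤ i ≤ |u| the relations turn v •ᵢ u into an element of `V`,
plus u •₀ v when i = |u|. Hence a letter inserted into a product gives a combination of products.

The map p comes from a model. The words in the basis `X` form a grafting algebra `wordAlgebra`, in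
which •₀ is concatenation and the insertion of a letter follows the recursion that the relations
force. Its axioms all come from one identity for `V`, `act_act`, which packs the six axioms of a
Prim_gr algebra together. The universal properties of trees (`value_graft`) and of `U`
(`exists_envelop_lift`) give a map from `U` to words, and p reads off the words of length one.

The coproduct does the rest. As `V` is primitive, Δ(v •₀ y) = v ⊗ y + ∑ (v •₀ y₁) ⊗ y₂, and p kills
the left factors of the last sum. Therefore x = p(x) + ∑ p(x₁) •₀ x₂ for all x in `U`
(`exists_envelop_reconstruction`). A primitive x satisfies x = p(x), so Prim(U) = V, which is b).

For a), the universal property gives a bialgebra morphism ψ : U(Prim H) → H that is the inclusion on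
Prim H. It is injective because `U` is connected and ψ is injective on primitives. For surjectivity,
transport p to a map q : H → Prim H by a linear left inverse of ψ, and put μ(a ⊗ b) = q(a) •₀ b. If
Δx lies in the tensor square of the image, coassociativity and the reconstruction formula give
Δ(μ(Δx)) = Δx. So x differs from an element of the image by a primitive element, and induction along
the filtration applies (`eq_top_of_reconstruction`). -/

namespace GraftingCMM

/-! ### The universal property of the free grafting algebra -/

namespace PTree

variable {K A ι : Type*} [Field K] [AddCommGroup A] [Module K A] {d : ι → ℕ}

/-- The operator `y ↦ t •ᵢ y` on a grafting algebra in which the colours are evaluated by `g`;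
the trivial tree acts as the identity. -/
noncomputable def insertion (G : GraftingAlgebra K A) (g : ι → A) :
    PTree d → ℕ → Module.End K A
  | leaf => fun _ => 1
  -- The last factor of the product acts first: the leaves of the corolla are filled from right to
  -- left, so leaf `k` still has the number `k` when `c k` is inserted.
  | node x c => fun i => G.graft i ((List.ofFn fun k => insertion G g (c k) k).prod (g x))

/-- Insertion of the trees `c k` with `m ≤ k` at the places `k`. -/
noncomputable def insertionFrom (G : GraftingAlgebra K A) (g : ι → A) {n : ℕ}
    (c : Fin n → PTree d) (m : ℕ) : Module.End K A :=
  ((List.ofFn fun k => insertion G g (c k) k).drop m).prod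

/-- The value of a tree in a grafting algebra in which the colours are evaluated by `g`. -/
noncomputable def value (G : GraftingAlgebra K A) (g : ι → A) : PTree d → A
  -- No element of the algebra stands for the trivial tree, so `0` is a mere default; `insertion`,
  -- for which this tree is the identity, carries the inductions.
  | leaf => 0
  | node x c => insertionFrom G g c 0 (g x)

/-- The number of leaves of the trees `c j`, `j < m`. -/
def leavesBefore {n : ℕ} (c : Fin n → PTree d) (m : ℕ) : ℕ :=
  ∑ j ∈ Finset.univ.filter (fun j : Fin n => (j : ℕ) < m), ((c j).degree + 1)

theorem leavesBefore_val {n : ℕ} (c : Fin n → PTree d) (k : Fin n) :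
    leavesBefore c k = offset c k := rfl

theorem leavesBefore_zero {n : ℕ} (c : Fin n → PTree d) : leavesBefore c 0 = 0 := by
  simp [leavesBefore]

theorem leavesBefore_succ {n : ℕ} (c : Fin n → PTree d) {m : ℕ} (hm : m < n) :
    leavesBefore c (m + 1) = leavesBefore c m + ((c ⟨m, hm⟩).degree + 1) := by
  have : Finset.univ.filter (fun j : Fin n => (j : ℕ) < m + 1) =
      insert ⟨m, hm⟩ (Finset.univ.filter (fun j : Fin n => (j : ℕ) < m)) := by
    ext j
    simp only [Finset.mem_filter, Finset.mem_univ, true_and, Finset.mem_insert, Fin.ext_iff]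
    omega
  rw [leavesBefore, this, Finset.sum_insert (by simp), leavesBefore, add_comm]

theorem leavesBefore_le {n : ℕ} (c : Fin n → PTree d) {m m' : ℕ} (h : m ≤ m') :
    leavesBefore c m ≤ leavesBefore c m' := by
  refine Finset.sum_le_sum_of_subset fun j hj => ?_
  simp only [Finset.mem_filter, Finset.mem_univ, true_and] at hj ⊢
  omega

theorem leavesBefore_top (x : ι) (c : Fin (d x + 1) → PTree d) :
    leavesBefore c (d x + 1) = (node x c).degree + 1 := by
  have h : Finset.univ.filter (fun j : Fin (d x + 1) => (j : ℕ) < d x + 1) = Finset.univ :=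
    Finset.filter_true_of_mem fun j _ => j.2
  rw [leavesBefore, h, Finset.sum_add_distrib, degree]
  simp
  omega

/-! ### Evaluation of trees and its compatibility with grafting -/

variable (G : GraftingAlgebra K A) (g : ι → A)

theorem insertion_leaf (i : ℕ) : insertion G g (leaf : PTree d) i = 1 := by
  rw [insertion]

theorem insertion_of_ne_leaf {t : PTree d} (ht : t ≠ leaf) (i : ℕ) :
    insertion G g t i = G.graft i (value G g t) := by
  cases t with
  | leaf => exact absurd rfl ht
  | node x c => rw [insertion, value, insertionFrom, List.drop_zero]

theorem insertionFrom_of_lt {n : ℕ} (c : Fin n → PTree d) {m : ℕ} (hm : m < n) :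
    insertionFrom G g c m = insertion G g (c ⟨m, hm⟩) m * insertionFrom G g c (m + 1) := by
  rw [insertionFrom, List.drop_eq_getElem_cons (by simpa using hm), List.prod_cons,
    List.getElem_ofFn, insertionFrom]

theorem insertionFrom_of_le {n : ℕ} (c : Fin n → PTree d) {m : ℕ} (hm : n ≤ m) :
    insertionFrom G g c m = 1 := by
  rw [insertionFrom, List.drop_eq_nil_of_le (by simpa using hm), List.prod_nil]

theorem insertionFrom_congr {n : ℕ} {c c' : Fin n → PTree d} {m : ℕ}
    (h : ∀ k : Fin n, m ≤ k → c k = c' k) : insertionFrom G g c m = insertionFrom G g c' m := by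
  by_cases hm : n ≤ m
  · rw [insertionFrom_of_le G g c hm, insertionFrom_of_le G g c' hm]
  refine Nat.decreasingInduction' (n := n) (m := m) (P := fun r =>
    insertionFrom G g c r = insertionFrom G g c' r) ?_ (by omega) ?_
  · intro r hr hmr ih
    rw [insertionFrom_of_lt G g c hr, insertionFrom_of_lt G g c' hr, ih, h _ hmr]
  · rw [insertionFrom_of_le G g c le_rfl, insertionFrom_of_le G g c' le_rfl]

variable {G g}

/-- When only the leaves `m, …, d x` of the corolla are filled, the first `m` children count for one
leaf each instead of `leavesBefore c m` leaves in all. The equation for `q` records this without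
subtraction. Taking `hc` as a hypothesis allows the use inside an induction on trees. -/
theorem insertionFrom_mem {x : ι} (hg : g x ∈ G.deg (d x)) {c : Fin (d x + 1) → PTree d}
    (hc : ∀ k i q y, y ∈ G.deg q → i ≤ q →
      insertion G g (c k) i y ∈ G.deg ((c k).degree + q)) {m : ℕ} (hm : m ≤ d x + 1) :
    ∀ q, q + leavesBefore c m = (node x c).degree + m →
      insertionFrom G g c m (g x) ∈ G.deg q := by
  have htop := leavesBefore_top x c
  refine Nat.decreasingInduction' (n := d x + 1) (m := m) (P := fun m => ∀ q,
    q + leavesBefore c m = (node x c).degree + m → insertionFrom G g c m (g x) ∈ G.deg q)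
    ?_ hm ?_
  · intro r hr _ ih q hq
    have h1 := leavesBefore_succ c hr
    have h2 := leavesBefore_le c (show r + 1 ≤ d x + 1 from hr)
    have h3 : q = (c ⟨r, hr⟩).degree + (q - (c ⟨r, hr⟩).degree) := by omega
    rw [insertionFrom_of_lt G g c hr, h3]
    exact hc _ _ _ _ (ih _ (by omega)) (by omega)
  · intro q hq
    rw [insertionFrom_of_le G g c le_rfl]
    rw [show q = d x by omega]
    exact hg

theorem insertion_mem (hg : ∀ x, g x ∈ G.deg (d x)) (t : PTree d) : ∀ i q y, y ∈ G.deg q →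
    i ≤ q → insertion G g t i y ∈ G.deg (t.degree + q) := by
  induction t with
  | leaf =>
    intro i q y hy _
    rw [insertion_leaf, degree, zero_add]
    exact hy
  | node x c ih =>
    intro i q y hy hi
    rw [insertion_of_ne_leaf _ _ (by simp)]
    refine G.graft_mem ?_ hy hi
    exact insertionFrom_mem (hg x) ih (Nat.zero_le _) _ (by rw [leavesBefore_zero])

theorem value_mem (hg : ∀ x, g x ∈ G.deg (d x)) (t : PTree d) : value G g t ∈ G.deg t.degree := by
  cases t with
  | leaf => exact Submodule.zero_mem _
  | node x c =>
    exact insertionFrom_mem (hg x) (fun k => insertion_mem hg (c k)) (Nat.zero_le _) _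
      (by rw [leavesBefore_zero])

/-- The commutation axiom extended to trivial trees, which act as the identity and have degree `0`.
-/
theorem insertion_comm (hg : ∀ x, g x ∈ G.deg (d x)) (s t : PTree d) {i j q : ℕ} {y : A}
    (hy : y ∈ G.deg q) (hi : i < j) (hj : j ≤ q) :
    insertion G g s i (insertion G g t j y) =
      insertion G g t (j + s.degree) (insertion G g s i y) := by
  by_cases hs : s = leaf
  · subst hs
    simp [insertion_leaf, degree]
  by_cases ht : t = leaf
  · subst ht
    simp [insertion_leaf]
  rw [insertion_of_ne_leaf _ _ hs, insertion_of_ne_leaf _ _ ht, insertion_of_ne_leaf _ _ ht]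
  exact G.graft_comm _ (value_mem hg s) hy hi hj

/-- Both trees are filled from right to left and compared at each stage. Once the leaves from `m` on
are filled, leaf `a` of the full tree has the number `a - leavesBefore c m + m`. On passing from `m
+ 1` to `m` there are two cases: `a` lies in `c m`, and associativity for that child applies, or `a`
lies further right, and the insertions of `s` and `c m` commute. -/
theorem value_graft_node (hg : ∀ x, g x ∈ G.deg (d x)) (s : PTree d) (x : ι)
    (c : Fin (d x + 1) → PTree d)
    (ih : ∀ k a i q y, a ≤ (c k).degree → y ∈ G.deg q → i ≤ q →
      insertion G g (graft s a (c k)) i y = insertion G g s (i + a) (insertion G g (c k) i y))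
    {a : ℕ} (ha : a ≤ (node x c).degree) :
    value G g (graft s a (node x c)) = insertion G g s a (value G g (node x c)) := by
  have htop := leavesBefore_top x c
  -- Written with `leavesBefore c 0` and `+ 0` to fit the motive of the downward induction.
  have key : leavesBefore c 0 ≤ a → insertionFrom G g (graftChildren s a c) 0 (g x) =
      insertion G g s (a - leavesBefore c 0 + 0) (insertionFrom G g c 0 (g x)) := by
    refine Nat.decreasingInduction' (n := d x + 1) (m := 0) (P := fun m => leavesBefore c m ≤ a →
      insertionFrom G g (graftChildren s a c) m (g x) =
        insertion G g s (a - leavesBefore c m + m) (insertionFrom G g c m (g x)))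
      ?_ (Nat.zero_le _) ?_
    · intro m hm _ ihm ham
      have h1 := leavesBefore_succ c hm
      have h2 := leavesBefore_le c (show m + 1 ≤ d x + 1 from hm)
      have h3 := leavesBefore_val c ⟨m, hm⟩
      simp only at h3
      have hmem := insertionFrom_mem (hg x) (fun k => insertion_mem hg (c k))
        (show m + 1 ≤ d x + 1 from hm)
        ((node x c).degree + (m + 1) - leavesBefore c (m + 1)) (by omega)
      rw [insertionFrom_of_lt _ _ _ hm, insertionFrom_of_lt G g c hm, Module.End.mul_apply,
        Module.End.mul_apply]
      by_cases hA : a ≤ leavesBefore c m + (c ⟨m, hm⟩).degree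
      · rw [graftChildren_of s c (by omega) (by omega), insertionFrom_congr G g (c' := c),
          ih _ _ _ _ _ (by omega) hmem (by omega), ← h3, add_comm m]
        intro k hk
        have h4 := offset_mono_bound c (show (⟨m, hm⟩ : Fin (d x + 1)) < k from hk)
        exact graftChildren_of_not s c (by omega)
      · rw [graftChildren_of_not s c (by omega), ihm (by omega),
          insertion_comm hg _ _ hmem (by omega) (by omega)]
        congr 2
        omega
    -- At the start of the induction, `a` would lie beyond the last leaf of the tree, against `ha`.
    · intro h
      omega
  rw [leavesBefore_zero] at key
  exact key (Nat.zero_le _)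

/-- Associativity in operator form. The induction runs over this statement and not over
`value_graft`, because a child may be trivial and then its value says nothing. -/
theorem insertion_graft (hg : ∀ x, g x ∈ G.deg (d x)) (s t : PTree d) :
    ∀ a i q y, a ≤ t.degree → y ∈ G.deg q → i ≤ q →
      insertion G g (graft s a t) i y = insertion G g s (i + a) (insertion G g t i y) := by
  induction t with
  | leaf =>
    intro a i q y ha _ _
    rw [degree, Nat.le_zero] at ha
    subst ha
    simp [insertion_leaf, graft]
  | node x c ih =>
    intro a i q y ha hy hi
    have hv := value_graft_node hg s x c ih ha
    rw [insertion_of_ne_leaf _ _ (by simp [graft]), hv, insertion_of_ne_leaf G g (t := node x c)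
      (by simp)]
    by_cases hs : s = leaf
    · subst hs
      simp [insertion_leaf]
    · rw [insertion_of_ne_leaf _ _ hs, insertion_of_ne_leaf _ _ hs,
        G.graft_assoc _ (value_mem hg _) hy ha hi, add_comm]

theorem value_graft (hg : ∀ x, g x ∈ G.deg (d x)) {s t : PTree d} (hs : s ≠ leaf) (ht : t ≠ leaf)
    {a : ℕ} (ha : a ≤ t.degree) :
    value G g (graft s a t) = G.graft a (value G g s) (value G g t) := by
  cases t with
  | leaf => exact absurd rfl ht
  | node x c =>
    rw [value_graft_node hg s x c (fun k => insertion_graft hg s (c k)) ha,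
      insertion_of_ne_leaf _ _ hs]

theorem value_corolla (x : ι) : value G g (corolla d x) = g x := by
  simp [corolla, value, insertionFrom, insertion_leaf, List.ofFn_const]

/-- Every tree is obtained from corollas by grafting. -/
theorem graft_induction {p : PTree d → Prop} (hc : ∀ x, p (corolla d x))
    (hg : ∀ s t i, s ≠ leaf → t ≠ leaf → i ≤ t.degree → p s → p t → p (graft s i t))
    (t : PTree d) (ht : t ≠ leaf) : p t := by
  induction t with
  | leaf => exact absurd rfl ht
  | node x c ih =>
    -- The corolla is filled from right to left: at stage `m` the children with index at least `m`
    -- are in place and the others are still leaves.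
    have key : p (node x fun k => if 0 ≤ (k : ℕ) then c k else leaf) := by
      refine Nat.decreasingInduction' (n := d x + 1) (m := 0) (P := fun m =>
        p (node x fun k => if m ≤ (k : ℕ) then c k else leaf)) ?_ (Nat.zero_le _) ?_
      · intro m hm _ h
        set c' : Fin (d x + 1) → PTree d := fun k => if m + 1 ≤ (k : ℕ) then c k else leaf
        -- The children before place `m` are single leaves, so child `m` is reached by grafting at
        -- leaf `m`.
        have hoff : ∀ k : Fin (d x + 1), (k : ℕ) ≤ m → offset c' k = k := by
          intro k hk
          rw [offset, Finset.sum_congr rfl (g := fun _ => 1)]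
          · rw [Finset.sum_const, smul_eq_mul, mul_one]
            exact (congrArg Finset.card (Finset.filter_gt_eq_Iio (a := k))).trans (Fin.card_Iio k)
          · intro j hj
            have hj : j < k := (Finset.mem_filter.1 hj).2
            rw [show c' j = leaf from if_neg (by have := Fin.lt_def.1 hj; omega), degree]
        have hm' : c' ⟨m, hm⟩ = leaf := if_neg (by simp)
        have hom := hoff ⟨m, hm⟩ le_rfl
        -- A trivial child leaves the tree as it is; it must be set apart since `hg` grafts
        -- nontrivial trees only.
        by_cases hl : c ⟨m, hm⟩ = leaf
        · convert h using 2
          funext k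
          simp only [c']
          rcases lt_trichotomy (k : ℕ) m with hk | hk | hk
          · rw [if_neg (by omega), if_neg (by omega)]
          · rw [if_pos (by omega), if_neg (by omega), ← hl]
            congr 1
            exact Fin.ext hk
          · rw [if_pos (by omega), if_pos (by omega)]
        have hdeg : m ≤ (node x c').degree := by
          rw [degree]
          omega
        have := hg _ _ m hl (by simp) hdeg (ih _ hl) h
        rw [graft_node] at this
        convert this using 2
        funext k
        rcases lt_trichotomy (k : ℕ) m with hk | hk | hk
        · have hk' : c' k = leaf := if_neg (by omega)
          have := hoff k hk.le
          rw [graftChildren_of_not _ _ (by rw [hk', degree]; omega), if_neg (by omega), hk']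
        · obtain rfl : k = ⟨m, hm⟩ := Fin.ext hk
          rw [graftChildren_of _ _ (by omega) (by rw [hm', degree]; omega), hm', graft,
            if_pos le_rfl]
        · have := offset_mono_bound c' (show (⟨m, hm⟩ : Fin (d x + 1)) < k from hk)
          rw [graftChildren_of_not _ _ (by simp only at hom; omega), if_pos hk.le]
          exact (if_pos hk).symm
      · convert hc x using 1
        rw [corolla]
        congr 1
        funext k
        exact if_neg (by omega)
    simpa using key

end PTree

/-! ### Morphisms out of the free grafting algebra -/

namespace TreeSpace

open PTree

variable {K A ι : Type*} [Field K] [AddCommGroup A] [Module K A] {d : ι → ℕ}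

/-- The morphism from the free grafting algebra that extends a map on the colours. -/
noncomputable def lift (G : GraftingAlgebra K A) (g : ι → A) : TreeSpace K d →ₗ[K] A :=
  extend (value G g)

variable {G : GraftingAlgebra K A} {g : ι → A}

theorem lift_corolla (x : ι) : lift G g (vec K (corolla d x)) = g x := by
  rw [lift, extend_vec _ (by simp [corolla]), value_corolla]

theorem lift_mem (hg : ∀ x, g x ∈ G.deg (d x)) {n : ℕ} {x : TreeSpace K d}
    (hx : x ∈ deg K d n) : lift G g x ∈ G.deg n := by
  refine deg_induction (p := fun x => lift G g x ∈ G.deg n) (fun x y h h' => ?_)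
    (fun a x h => ?_) (by simp) (fun t ht htn => ?_) hx
  · rw [map_add]; exact Submodule.add_mem _ h h'
  · rw [map_smul]; exact Submodule.smul_mem _ _ h
  · rw [lift, extend_vec _ ht, ← htn]; exact value_mem hg t

theorem lift_graft (hg : ∀ x, g x ∈ G.deg (d x)) (i : ℕ) (x y : TreeSpace K d) :
    lift G g (graft K d i x y) = G.graft i (lift G g x) (lift G g y) := by
  induction x using vec_induction with
  | zero => simp
  | add x x' h h' => simp only [map_add, LinearMap.add_apply, h, h']
  | smul a x h => simp only [map_smul, LinearMap.smul_apply, h]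
  | vec s hs =>
  induction y using vec_induction with
  | zero => simp
  | add x x' h h' => simp only [map_add, h, h']
  | smul a x h => simp only [map_smul, h]
  | vec t ht =>
  rcases le_or_gt i t.degree with hi | hi
  · rw [graft_vec hs ht hi, lift, extend_vec _ (graft_ne_leaf hs), extend_vec _ hs,
      extend_vec _ ht, value_graft hg hs ht hi]
  · rw [graft_vec_of_lt hs ht hi, map_zero, G.graft_of_lt _ (lift_mem hg (vec_mem t)) hi]

/-- A subspace that contains the corollas and is closed under grafting is everything. -/
theorem eq_top_of_graft_mem (S : Submodule K (TreeSpace K d))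
    (hS : ∀ x, vec K (corolla d x) ∈ S)
    (hS' : ∀ i, ∀ x ∈ S, ∀ y ∈ S, graft K d i x y ∈ S) : S = ⊤ := by
  rw [eq_top_iff]
  rintro x -
  induction x using vec_induction with
  | zero => exact S.zero_mem
  | add x y hx hy => exact S.add_mem hx hy
  | smul a x hx => exact S.smul_mem a hx
  | vec t ht =>
  refine graft_induction (p := fun t => vec K t ∈ S) hS (fun s t i hs ht hi h h' => ?_) t ht
  rw [← graft_vec hs ht hi]
  exact hS' i _ h _ h'

end TreeSpace

end GraftingCMM

namespace GraftingCMM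

/-! ### The grafting algebra of words -/

/-! ### Linear induction along a homogeneous basis -/

namespace HomogeneousBasis

variable {K V ι : Type*} [Field K] [AddCommGroup V] [Module K V] {G : Grading K V}

theorem induction (X : HomogeneousBasis G ι) {p : V → Prop}
    (zero : p 0) (add : ∀ x y, p x → p y → p (x + y)) (smul : ∀ (a : K) x, p x → p (a • x))
    (basis : ∀ i, p (X.basis i)) (x : V) : p x := by
  refine Submodule.span_induction (p := fun x _ => p x) ?_ zero (fun x y _ _ => add x y)
    (fun a x _ => smul a x) (X.basis.mem_span x)
  rintro _ ⟨i, rfl⟩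
  exact basis i

/-- The induction is run on the projection of a general vector to degree `n`, where the basis
vectors of other degrees become zero. -/
theorem deg_induction (X : HomogeneousBasis G ι) {n : ℕ} {p : V → Prop}
    (zero : p 0) (add : ∀ x y, p x → p y → p (x + y)) (smul : ∀ (a : K) x, p x → p (a • x))
    (basis : ∀ i, X.degree i = n → p (X.basis i)) {x : V} (hx : x ∈ G.deg n) : p x := by
  rw [← G.proj_of_mem hx]
  refine X.induction (p := fun x => p (G.proj n x)) ?_ (fun x y h h' => ?_) (fun a x h => ?_)
    (fun i => ?_) x
  · rwa [map_zero]
  · rw [map_add]; exact add _ _ h h'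
  · rw [map_smul]; exact smul _ _ h
  · by_cases hi : X.degree i = n
    · rw [G.proj_of_mem (hi ▸ X.mem i)]
      exact basis i hi
    · rwa [G.proj_of_mem_ne (X.mem i) hi]

end HomogeneousBasis

/-! ### One family of operations for bracket and compositions -/

namespace PrimGrAlgebra

variable {K V ι : Type*} [Field K] [AddCommGroup V] [Module K V] (P : PrimGrAlgebra K V)

/-- The operations `v •_i u` for `1 ≤ i < |u|` together with the bracket `{u, v}` for
`i = |u|`. -/
noncomputable def act (i : ℕ) : V →ₗ[K] V →ₗ[K] V :=
  -- The summands have disjoint supports: the first lives on `u` of degree above `i`, the second on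
  -- degree `i`. Together they give the part of v •ᵢ u that lies in `V` once the relations of the
  -- envelope hold.
  P.comp i + (P.bracket ∘ₗ P.proj i).flip

theorem act_of_lt {i n : ℕ} (v : V) {u : V} (hu : u ∈ P.deg n) (h : n < i) :
    P.act i v u = 0 := by
  simp [act, P.comp_of_not v hu (p := i) (by omega), P.proj_of_mem_ne hu h.ne]

theorem act_self {n : ℕ} (v : V) {u : V} (hu : u ∈ P.deg n) :
    P.act n v u = P.bracket u v := by
  simp [act, P.comp_of_not v hu (p := n) (by omega), P.proj_of_mem hu]

theorem act_of_gt {i n : ℕ} (v : V) {u : V} (hu : u ∈ P.deg n) (h : i < n) :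
    P.act i v u = P.comp i v u := by
  simp [act, P.proj_of_mem_ne hu h.ne']

theorem act_mem {i n m : ℕ} {v u : V} (hv : v ∈ P.deg m) (hu : u ∈ P.deg n) :
    P.act i v u ∈ P.deg (m + n) := by
  rcases lt_trichotomy i n with h | rfl | h
  · rw [P.act_of_gt v hu h]
    rcases Nat.eq_zero_or_pos i with rfl | hi
    · rw [P.comp_of_not v hu (by omega)]
      exact Submodule.zero_mem _
    · exact P.comp_mem hv hu hi h
  · rw [P.act_self v hu, add_comm]
    exact P.bracket_mem hu hv
  · rw [P.act_of_lt v hu h]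
    exact Submodule.zero_mem _

/-- The axioms of a `Prim_gr` algebra in terms of the operations `act`. -/
theorem act_act {i j n m : ℕ} (hi : 1 ≤ i) (hj : 1 ≤ j) (v : V) {u w : V} (hu : u ∈ P.deg n)
    (hw : w ∈ P.deg m) : P.act (i + j) v (P.act j u w) =
      P.act j (P.act i v u) w + if n ≤ i then P.act j u (P.act (i - n + j) v w) else 0 := by
  induction v using P.toGrading.homogeneous_induction with
  | add v v' h h' =>
    simp only [map_add, LinearMap.add_apply, h, h']
    split_ifs <;> abel
  | mem q v hv =>
  rcases Nat.eq_zero_or_pos q with rfl | hq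
  · rw [P.deg_zero, Submodule.mem_bot] at hv
    simp [hv]
  rcases Nat.eq_zero_or_pos n with rfl | hn
  · rw [P.deg_zero, Submodule.mem_bot] at hu
    simp [hu]
  -- Nine cases follow. Six of them are the six axioms, one each; in the other three every term
  -- vanishes because a place lies beyond the degree.
  rcases lt_trichotomy m j with hmj | rfl | hmj
  · rw [P.act_of_lt u hw hmj, P.act_of_lt _ hw hmj, map_zero, zero_add]
    split_ifs with h
    · rw [P.act_of_lt v hw (by omega), map_zero]
    · rfl
  · rw [P.act_self u hw, P.act_self _ hw]
    have hwu := P.bracket_mem hw hu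
    rcases lt_trichotomy i n with h | rfl | h
    · rw [if_neg (by omega), P.act_of_gt v hwu (by omega), P.act_of_gt v hu h, add_zero,
        P.bracket_comp_right v hw hu hi h, add_comm]
    · have hwv := P.bracket_mem hw hv
      rw [if_pos le_rfl, Nat.sub_self, zero_add, P.act_self v hw, add_comm, P.act_self v hwu,
        P.act_self v hu, P.act_of_gt u hwv (by omega), P.bracket_bracket u v hw]
    · rw [if_pos h.le, P.act_of_lt v hwu (by omega), P.act_of_lt v hu h, map_zero,
        P.act_of_lt v hw (by omega), map_zero, add_zero]
  · have huw := P.comp_mem hu hw hj hmj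
    rw [P.act_of_gt u hw hmj, P.act_of_gt _ hw hmj]
    rcases lt_trichotomy i n with h | rfl | h
    · rw [if_neg (by omega), P.act_of_gt v huw (by omega), P.act_of_gt v hu h, add_zero,
        P.comp_assoc v hu hw hi h hj hmj]
    · have hvw := P.comp_mem hv hw hj hmj
      rw [if_pos le_rfl, Nat.sub_self, zero_add, P.act_of_gt v hw hmj, P.act_of_gt v huw (by omega),
        P.act_self v hu, P.act_of_gt u hvw (by omega), P.comp_bracket_left v hu hw hj hmj,
        sub_add_cancel]
    · rw [if_pos h.le, P.act_of_lt v hu h, map_zero, LinearMap.zero_apply, zero_add]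
      rcases lt_trichotomy (i - n + j) m with hk | hk | hk
      · have hvw := P.comp_mem hv hw (p := i - n + j) (by omega) hk
        rw [P.act_of_gt v hw hk, P.act_of_gt v huw (by omega), P.act_of_gt u hvw (by omega),
          P.comp_comm v hu hw hj (by omega) hk, show n + (i - n + j) = i + j by omega]
      · have hwv := P.bracket_mem hw hv
        rw [hk, P.act_self v hw, P.act_of_gt u hwv (by omega), show i + j = n + m by omega,
          P.act_self v huw, P.bracket_comp_left u v hw hj hmj]
      · rw [P.act_of_lt v hw hk, P.act_of_lt v huw (by omega), map_zero]

variable {P}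

/-- Multiplication of words by elements of `V` from the left. -/
noncomputable def consWord (X : HomogeneousBasis P.toGrading ι) :
    V →ₗ[K] (List ι →₀ K) →ₗ[K] (List ι →₀ K) :=
  X.basis.constr K fun a => Finsupp.lmapDomain K K (List.cons a)

/-- The value of `v •_i l` for `v` in `V` and a word `l`. -/
noncomputable def insertIntoWord (X : HomogeneousBasis P.toGrading ι) :
    List ι → ℕ → V →ₗ[K] (List ι →₀ K)
  -- The empty word is a unit of degree zero, with `0` as its only place.
  | [], i => if i = 0 then (consWord X).flip (Finsupp.single [] 1) else 0
  | a :: l, i =>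
    if i = 0 then (consWord X).flip (Finsupp.single (a :: l) 1)
    -- The first summand puts `v` into the letter `a`, the second passes `a` and goes on in `l`. At
    -- `i = X.degree a` both occur, as in v •ᵢ a = {a, v} + a •₀ v.
    else (consWord X).flip (Finsupp.single l 1) ∘ₗ (P.act i).flip (X.basis a) +
      if X.degree a ≤ i then consWord X (X.basis a) ∘ₗ insertIntoWord X l (i - X.degree a) else 0

/-- The operator `t ↦ v •_i t` on words, for `v` in `V`. -/
noncomputable def insertLetter (X : HomogeneousBasis P.toGrading ι) (i : ℕ) :
    V →ₗ[K] Module.End K (List ι →₀ K) :=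
  (Finsupp.linearCombination K fun l => insertIntoWord X l i).flip

/-! ### Insertion of a letter into a word -/

variable (X : HomogeneousBasis P.toGrading ι)

theorem consWord_basis (a : ι) (l : List ι) :
    consWord X (X.basis a) (Finsupp.single l (1 : K)) = Finsupp.single (a :: l) 1 := by
  simp [consWord]

theorem words_induction {p : (List ι →₀ K) → Prop} (add : ∀ x y, p x → p y → p (x + y))
    (smul : ∀ (a : K) x, p x → p (a • x)) (word : ∀ l, p (Finsupp.single l 1))
    (x : List ι →₀ K) : p x := by
  induction x using Finsupp.induction_linear with
  | zero => simpa using smul 0 _ (word [])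
  | add x y hx hy => exact add x y hx hy
  | single t a =>
    rw [← mul_one a, ← smul_eq_mul, ← Finsupp.smul_single]
    exact smul _ _ (word t)

theorem insertLetter_single (i : ℕ) (v : V) (l : List ι) :
    insertLetter X i v (Finsupp.single l 1) = insertIntoWord X l i v := by
  simp [insertLetter]

theorem insertLetter_zero (v : V) : insertLetter X 0 v = consWord X v := by
  refine LinearMap.ext fun t => ?_
  induction t using words_induction with
  | add x y h h' => rw [map_add, map_add, h, h']
  | smul a x h => rw [map_smul, map_smul, h]
  | word l =>
    rw [insertLetter_single]
    cases l <;> simp [insertIntoWord]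

theorem insertLetter_nil {i : ℕ} (hi : 1 ≤ i) (v : V) :
    insertLetter X i v (Finsupp.single [] 1) = 0 := by
  rw [insertLetter_single, insertIntoWord, if_neg (by omega), LinearMap.zero_apply]

/-- The defining recursion, freed from the basis: the first letter may be any homogeneous `u`. Place
`0` is excluded, since there `v` is only put in front. -/
theorem insertLetter_consWord {i n : ℕ} (hi : 1 ≤ i) (v : V) {u : V} (hu : u ∈ P.deg n)
    (t : List ι →₀ K) : insertLetter X i v (consWord X u t) = consWord X (P.act i v u) t +
      if n ≤ i then consWord X u (insertLetter X (i - n) v t) else 0 := by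
  refine X.deg_induction (p := fun u => insertLetter X i v (consWord X u t) =
    consWord X (P.act i v u) t +
      if n ≤ i then consWord X u (insertLetter X (i - n) v t) else 0) ?_ ?_ ?_ ?_ hu
  · simp
  · intro x y h h'
    simp only [map_add, LinearMap.add_apply, h, h']
    split_ifs <;> abel
  · intro a x h
    simp only [map_smul, LinearMap.smul_apply, h, smul_add, smul_ite, smul_zero]
  · rintro a rfl
    induction t using words_induction with
    | add x y h h' =>
      simp only [map_add, h, h']
      split_ifs <;> abel
    | smul a x h => simp only [map_smul, h, smul_add, smul_ite, smul_zero]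
    | word l =>
      rw [consWord_basis, insertLetter_single, insertIntoWord, if_neg (by omega)]
      split_ifs
      · rw [insertLetter_single]
        rfl
      · simp

/-- The identity `act_act` lifted from a letter `w` to a word; it contains both associativity and
commutation for letters. For `j = 0` it is the recursion `insertLetter_consWord`. For `j ≥ 1` the
first letter is split off: `act_act` accounts for the terms where both insertions meet it, the
induction hypothesis for those where both pass it. -/
theorem insertLetter_insertLetter {i j n : ℕ} (hi : 1 ≤ i) (v : V) {u : V} (hu : u ∈ P.deg n)
    (t : List ι →₀ K) : insertLetter X (i + j) v (insertLetter X j u t) =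
      insertLetter X j (P.act i v u) t +
        if n ≤ i then insertLetter X j u (insertLetter X (i - n + j) v t) else 0 := by
  induction v using P.toGrading.homogeneous_induction with
  | add v v' h h' =>
    simp only [map_add, LinearMap.add_apply, h, h']
    split_ifs <;> abel
  | mem q v hv =>
  rcases Nat.eq_zero_or_pos q with rfl | hq
  · rw [P.deg_zero, Submodule.mem_bot] at hv
    simp [hv]
  induction t using words_induction with
  | add x y h h' =>
    simp only [map_add, h, h']
    split_ifs <;> abel
  | smul a x h => simp only [map_smul, h, smul_add, smul_ite, smul_zero]
  | word l =>
  induction l generalizing j with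
  | nil =>
    rcases Nat.eq_zero_or_pos j with rfl | hj
    · simp only [insertLetter_zero, add_zero]
      exact insertLetter_consWord X hi v hu _
    · simp [insertLetter_nil X hj, insertLetter_nil X (show 1 ≤ i - n + j by omega)]
  | cons a l ih =>
    rcases Nat.eq_zero_or_pos j with rfl | hj
    · simp only [insertLetter_zero, add_zero]
      exact insertLetter_consWord X hi v hu _
    have hw := X.mem a
    simp only [← consWord_basis X]
    generalize X.degree a = m at hw
    generalize X.basis a = w at hw
    generalize (Finsupp.single l 1 : List ι →₀ K) = t at ih
    have e1 := insertLetter_consWord X (show 1 ≤ i + j by omega) v (P.act_mem (i := j) hu hw) t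
    have e2 := insertLetter_consWord X hj u (P.act_mem (i := i - n + j) hv hw) t
    rw [P.act_act hi hj v hu hw] at e1
    rw [insertLetter_consWord X hj u hw, insertLetter_consWord X hj _ hw,
      insertLetter_consWord X (show 1 ≤ i - n + j by omega) v hw, map_add, map_add, e1, e2]
    -- The condition forces `m < i - n + j`, because `q > 0`; then `v` finds no place in `w` and the
    -- new first letter is zero.
    have h0 : (if q + m ≤ j then consWord X (P.act (i - n + j) v w)
        (insertLetter X (j - (q + m)) u t) else 0) = 0 := by
      split_ifs
      · rw [P.act_of_lt v hw (by omega)]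
        simp
      · rfl
    rw [h0]
    -- For `m ≤ j` the insertion of `u` can pass `w`; only there is the induction hypothesis needed,
    -- with `j - m` in place of `j`.
    by_cases hmj : m ≤ j
    · rw [if_pos hmj, if_pos hmj, insertLetter_consWord X (show 1 ≤ i + j by omega) v hw,
        P.act_of_lt v hw (show m < i + j by omega), if_pos (show m ≤ i + j by omega),
        show i + j - m = i + (j - m) by omega, ih]
      by_cases hni : n ≤ i
      · rw [if_pos hni, if_pos hni, if_pos hni, if_pos (show n + m ≤ i + j by omega),
          if_pos (show m ≤ i - n + j by omega), insertLetter_consWord X hj u hw,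
          if_pos hmj, show i - n + (j - m) = i - n + j - m by omega,
          show i + j - (n + m) = i - n + j - m by omega]
        simp only [map_add, LinearMap.add_apply, map_zero, LinearMap.zero_apply]
        abel
      · rw [if_neg hni, if_neg hni, if_neg hni]
        have : (if n + m ≤ i + j then consWord X (P.act j u w)
            (insertLetter X (i + j - (n + m)) v t) else 0) = 0 := by
          split_ifs
          · rw [P.act_of_lt u hw (by omega)]
            simp
          · rfl
        rw [this]
        simp only [map_zero, LinearMap.zero_apply, add_zero, zero_add]
    · rw [if_neg hmj, if_neg hmj, map_zero, add_zero, add_zero]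
      by_cases hni : n ≤ i
      · rw [if_pos hni, if_pos hni]
        by_cases hk : m ≤ i - n + j
        · rw [if_pos hk, if_pos (show n + m ≤ i + j by omega), insertLetter_consWord X hj u hw,
            if_neg hmj, show i + j - (n + m) = i - n + j - m by omega]
          simp only [map_add, LinearMap.add_apply]
          abel
        · rw [if_neg hk, if_neg (show ¬ n + m ≤ i + j by omega)]
          simp only [map_add, LinearMap.add_apply, map_zero]
          abel
      · rw [if_neg hni, if_neg hni, if_neg (show ¬ n + m ≤ i + j by omega), add_zero, add_zero,
          add_zero]

/-- The previous identity at `i = k + n - j`: here `i > n`, so `v` does not fit into `u` and only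
the term with the insertions exchanged is left. -/
theorem insertLetter_comm {j k n : ℕ} (h : j < k) (v : V) {u : V} (hu : u ∈ P.deg n)
    (t : List ι →₀ K) : insertLetter X j u (insertLetter X k v t) =
      insertLetter X (k + n) v (insertLetter X j u t) := by
  have := insertLetter_insertLetter X (i := k + n - j) (j := j) (by omega) v hu t
  rw [show k + n - j + j = k + n by omega, if_pos (by omega), P.act_of_lt v hu (by omega),
    show k + n - j - n + j = k by omega, map_zero, LinearMap.zero_apply, zero_add] at this
  exact this.symm

/-! ### Insertion of a word into a word -/

/-- The operator `t ↦ x •_j t` on words, defined for all words `x` and `t` without regard to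
the degree of `t`. -/
noncomputable def insertWord (j : ℕ) : (List ι →₀ K) →ₗ[K] Module.End K (List ι →₀ K) :=
  -- Forced by associativity, (a •₀ l) •_j z = a •_j (l •_j z): all letters go to the same place,
  -- the last one first.
  Finsupp.linearCombination K fun l => (l.map fun a => insertLetter X j (X.basis a)).prod

theorem insertWord_nil (j : ℕ) : insertWord X j (Finsupp.single [] 1) = 1 := by
  simp [insertWord]

theorem insertWord_cons (j : ℕ) (a : ι) (l : List ι) :
    insertWord X j (Finsupp.single (a :: l) 1) =
      insertLetter X j (X.basis a) * insertWord X j (Finsupp.single l 1) := by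
  simp [insertWord]

theorem insertWord_consWord (j : ℕ) (v : V) (t : List ι →₀ K) :
    insertWord X j (consWord X v t) = insertLetter X j v * insertWord X j t := by
  induction v using X.induction with
  | zero => simp
  | add x y h h' => simp only [map_add, LinearMap.add_apply, h, h', add_mul]
  | smul a x h => simp only [map_smul, LinearMap.smul_apply, h, smul_mul_assoc]
  | basis a =>
  induction t using words_induction with
  | add x y h h' => simp only [map_add, h, h', mul_add]
  | smul a x h => simp only [map_smul, h, mul_smul_comm]
  | word l => rw [consWord_basis, insertWord_cons]

/-! ### The grading of the space of words -/

/-- The homogeneous components of the space of words. -/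
noncomputable def wordDeg (n : ℕ) : Submodule K (List ι →₀ K) :=
  Submodule.span K ((fun l => Finsupp.single l 1) '' {l | (l.map X.degree).sum = n})

theorem single_mem_wordDeg (l : List ι) :
    Finsupp.single l 1 ∈ wordDeg X (l.map X.degree).sum :=
  Submodule.subset_span ⟨l, rfl, rfl⟩

theorem wordDeg_induction {n : ℕ} {p : (List ι →₀ K) → Prop} (zero : p 0)
    (add : ∀ x y, p x → p y → p (x + y)) (smul : ∀ (a : K) x, p x → p (a • x))
    (word : ∀ l : List ι, (l.map X.degree).sum = n → p (Finsupp.single l 1))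
    {x : List ι →₀ K} (hx : x ∈ wordDeg X n) : p x := by
  refine Submodule.span_induction (p := fun x _ => p x) ?_ zero (fun x y _ _ => add x y)
    (fun a x _ => smul a x) hx
  rintro _ ⟨l, hl, rfl⟩
  exact word l hl

theorem isInternal_wordDeg : DirectSum.IsInternal (wordDeg X) := by
  refine Grading.isInternal_of_proj _ ?_ (fun n => Finsupp.linearCombination K fun l =>
    if (l.map X.degree).sum = n then Finsupp.single l 1 else 0) ?_ ?_
  · rw [eq_top_iff]
    rintro x -
    induction x using words_induction with
    | add x y hx hy => exact Submodule.add_mem _ hx hy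
    | smul a x hx => exact Submodule.smul_mem _ _ hx
    | word l => exact Submodule.mem_iSup_of_mem _ (single_mem_wordDeg X l)
  · intro n x hx
    refine wordDeg_induction X (p := fun x => Finsupp.linearCombination K _ x = x) ?_ ?_ ?_ ?_ hx
    · exact map_zero _
    · intro x y h h'; rw [map_add, h, h']
    · intro a x h; rw [map_smul, h]
    · intro l h; rw [Finsupp.linearCombination_single, if_pos h, one_smul]
  · intro n m hnm x hx
    refine wordDeg_induction X (p := fun x => Finsupp.linearCombination K _ x = 0) ?_ ?_ ?_ ?_ hx
    · exact map_zero _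
    · intro x y h h'; rw [map_add, h, h', add_zero]
    · intro a x h; rw [map_smul, h, smul_zero]
    · intro l h; rw [Finsupp.linearCombination_single, if_neg (by omega), smul_zero]

theorem consWord_mem {n m : ℕ} {v : V} (hv : v ∈ P.deg n) {t : List ι →₀ K}
    (ht : t ∈ wordDeg X m) : consWord X v t ∈ wordDeg X (n + m) := by
  refine X.deg_induction (p := fun v => consWord X v t ∈ wordDeg X (n + m))
    (by simp) (fun x y h h' => ?_) (fun a x h => ?_) (fun a ha => ?_) hv
  · rw [map_add]; exact Submodule.add_mem _ h h'
  · rw [map_smul]; exact Submodule.smul_mem _ _ h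
  refine wordDeg_induction X (p := fun t => consWord X (X.basis a) t ∈ wordDeg X (n + m))
    (by simp) (fun x y h h' => ?_) (fun a x h => ?_) (fun l hl => ?_) ht
  · rw [map_add]; exact Submodule.add_mem _ h h'
  · rw [map_smul]; exact Submodule.smul_mem _ _ h
  · rw [consWord_basis, ← ha, ← hl]
    simpa using single_mem_wordDeg X (a :: l)

theorem insertLetter_mem {i n m : ℕ} {v : V} (hv : v ∈ P.deg n) {t : List ι →₀ K}
    (ht : t ∈ wordDeg X m) : insertLetter X i v t ∈ wordDeg X (n + m) := by
  refine wordDeg_induction X (p := fun t => insertLetter X i v t ∈ wordDeg X (n + m))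
    (by simp) (fun x y h h' => ?_) (fun a x h => ?_) (fun l hl => ?_) ht
  · rw [map_add]; exact Submodule.add_mem _ h h'
  · rw [map_smul]; exact Submodule.smul_mem _ _ h
  clear ht
  induction l generalizing i m with
  | nil =>
    rcases Nat.eq_zero_or_pos i with rfl | hi
    · rw [insertLetter_zero, ← hl]
      exact consWord_mem X hv (single_mem_wordDeg X [])
    · rw [insertLetter_nil X hi]
      exact Submodule.zero_mem _
  | cons a l ih =>
    rcases Nat.eq_zero_or_pos i with rfl | hi
    · rw [insertLetter_zero, ← hl]
      exact consWord_mem X hv (single_mem_wordDeg X _)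
    rw [List.map_cons, List.sum_cons] at hl
    rw [← consWord_basis X, insertLetter_consWord X hi v (X.mem a), ← hl]
    refine Submodule.add_mem _ ?_ ?_
    · rw [← add_assoc]
      exact consWord_mem X (P.act_mem hv (X.mem a)) (single_mem_wordDeg X l)
    · split_ifs
      · rw [add_left_comm]
        exact consWord_mem X (X.mem a) (ih rfl)
      · exact Submodule.zero_mem _

theorem insertWord_mem {i n m : ℕ} {x t : List ι →₀ K} (hx : x ∈ wordDeg X n)
    (ht : t ∈ wordDeg X m) : insertWord X i x t ∈ wordDeg X (n + m) := by
  refine wordDeg_induction X (p := fun x => insertWord X i x t ∈ wordDeg X (n + m))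
    (by simp) (fun x y h h' => ?_) (fun a x h => ?_) (fun l hl => ?_) hx
  · rw [map_add]; exact Submodule.add_mem _ h h'
  · rw [map_smul]; exact Submodule.smul_mem _ _ h
  clear hx
  subst hl
  induction l with
  | nil => simpa [insertWord_nil] using ht
  | cons a l ih =>
    rw [insertWord_cons, Module.End.mul_apply, List.map_cons, List.sum_cons, add_assoc]
    exact insertLetter_mem X (X.mem a) ih

/-- The two terms of the recursion for v •ᵢ (a l) correspond to the two terms of
`insertLetter_insertLetter`. The bound `hi` is essential at the empty word: there v •ᵢ gives zero
for `i > 0`, while the right side need not vanish. -/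
theorem insertWord_insertLetter {i j m : ℕ} (v : V) {y : List ι →₀ K} (hy : y ∈ wordDeg X m)
    (hi : i ≤ m) (z : List ι →₀ K) :
    insertWord X j (insertLetter X i v y) z = insertLetter X (i + j) v (insertWord X j y z) := by
  refine wordDeg_induction X (p := fun y => insertWord X j (insertLetter X i v y) z =
    insertLetter X (i + j) v (insertWord X j y z))
    (by simp) (fun x y h h' => ?_) (fun a x h => ?_) (fun l hl => ?_) hy
  · simp only [map_add, LinearMap.add_apply, h, h']
  · simp only [map_smul, LinearMap.smul_apply, h]
  clear hy
  induction l generalizing i m with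
  | nil =>
    simp only [List.map_nil, List.sum_nil] at hl
    obtain rfl : i = 0 := by omega
    rw [insertLetter_zero, insertWord_consWord, zero_add]
    rfl
  | cons a l ih =>
    rcases Nat.eq_zero_or_pos i with rfl | hi
    · rw [insertLetter_zero, insertWord_consWord, zero_add]
      rfl
    rw [List.map_cons, List.sum_cons] at hl
    rw [← consWord_basis X, insertLetter_consWord X hi v (X.mem a), map_add,
      insertWord_consWord, insertWord_consWord, LinearMap.add_apply, Module.End.mul_apply,
      Module.End.mul_apply, insertLetter_insertLetter X hi v (X.mem a)]
    congr 1
    split_ifs with h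
    · rw [insertWord_consWord, Module.End.mul_apply, ih (by omega) rfl]
    · simp

/-- A word acts as the composite of its letters, so `insertWord_insertLetter` is iterated along `x`.
-/
theorem insertWord_insertWord {i j m : ℕ} (x : List ι →₀ K) {y : List ι →₀ K}
    (hy : y ∈ wordDeg X m) (hi : i ≤ m) (z : List ι →₀ K) :
    insertWord X j (insertWord X i x y) z = insertWord X (i + j) x (insertWord X j y z) := by
  induction x using words_induction with
  | add x x' h h' => simp only [map_add, LinearMap.add_apply, h, h']
  | smul a x h => simp only [map_smul, LinearMap.smul_apply, h]
  | word l =>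
  induction l with
  | nil => simp [insertWord_nil]
  | cons a l ih =>
    rw [insertWord_cons, insertWord_cons, Module.End.mul_apply, Module.End.mul_apply,
      insertWord_insertLetter X _ (insertWord_mem X (single_mem_wordDeg X l) hy) (by omega), ih]

theorem insertLetter_insertWord {i j n : ℕ} {u : V} (hu : u ∈ P.deg n) (hi : i < j)
    (y z : List ι →₀ K) : insertLetter X i u (insertWord X j y z) =
      insertWord X (j + n) y (insertLetter X i u z) := by
  induction y using words_induction with
  | add x x' h h' => simp only [map_add, LinearMap.add_apply, h, h']
  | smul a x h => simp only [map_smul, LinearMap.smul_apply, h]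
  | word l =>
  induction l with
  | nil => simp [insertWord_nil]
  | cons a l ih =>
    rw [insertWord_cons, insertWord_cons, Module.End.mul_apply, Module.End.mul_apply,
      insertLetter_comm X hi _ hu, ih]

/-- The letters of `x` pass the insertion of `y` one after another, the last one first; each shifts
its place by its own degree, in total by `n`. -/
theorem insertWord_comm {i j n : ℕ} {x : List ι →₀ K} (hx : x ∈ wordDeg X n) (hi : i < j)
    (y z : List ι →₀ K) : insertWord X i x (insertWord X j y z) =
      insertWord X (j + n) y (insertWord X i x z) := by
  refine wordDeg_induction X (p := fun x => insertWord X i x (insertWord X j y z) =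
      insertWord X (j + n) y (insertWord X i x z))
    (by simp) (fun x y h h' => ?_) (fun a x h => ?_) (fun l hl => ?_) hx
  · simp only [map_add, LinearMap.add_apply, h, h']
  · simp only [map_smul, LinearMap.smul_apply, h]
  clear hx
  subst hl
  induction l with
  | nil => simp [insertWord_nil]
  | cons a l ih =>
    rw [insertWord_cons, Module.End.mul_apply, Module.End.mul_apply, ih,
      insertLetter_insertWord X (X.mem a) (by omega), List.map_cons, List.sum_cons,
      add_assoc, add_comm (List.sum _)]

/-! ### The words as a grafting algebra -/

/-- The operation `•_i` on words. -/
noncomputable def graftWord (i : ℕ) :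
    (List ι →₀ K) →ₗ[K] (List ι →₀ K) →ₗ[K] (List ι →₀ K) :=
  -- The cut-off is not automatic: `insertWord` does not vanish beyond the end of a word, since the
  -- empty word acts as the identity at every place.
  (Finsupp.linearCombination K fun l => if i ≤ (l.map X.degree).sum then
    (insertWord X i).flip (Finsupp.single l 1) else 0).flip

theorem graftWord_of_le {i m : ℕ} (x : List ι →₀ K) {y : List ι →₀ K} (hy : y ∈ wordDeg X m)
    (hi : i ≤ m) : graftWord X i x y = insertWord X i x y := by
  refine wordDeg_induction X (p := fun y => graftWord X i x y = insertWord X i x y)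
    (by simp) (fun x y h h' => ?_) (fun a x h => ?_) (fun l hl => ?_) hy
  · simp only [map_add, h, h']
  · simp only [map_smul, h]
  · rw [graftWord, LinearMap.flip_apply, Finsupp.linearCombination_single, if_pos (by omega),
      one_smul, LinearMap.flip_apply]

theorem graftWord_of_lt {i m : ℕ} (x : List ι →₀ K) {y : List ι →₀ K} (hy : y ∈ wordDeg X m)
    (hi : m < i) : graftWord X i x y = 0 := by
  refine wordDeg_induction X (p := fun y => graftWord X i x y = 0)
    (by simp) (fun x y h h' => ?_) (fun a x h => ?_) (fun l hl => ?_) hy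
  · rw [map_add, h, h', add_zero]
  · rw [map_smul, h, smul_zero]
  · rw [graftWord, LinearMap.flip_apply, Finsupp.linearCombination_single, if_neg (by omega),
      one_smul, LinearMap.zero_apply]

/-- The grafting algebra of words in a homogeneous basis of a `Prim_gr` algebra. -/
noncomputable def wordAlgebra : GraftingAlgebra K (List ι →₀ K) where
  -- The empty word is nonzero of degree `0`, so this algebra is not positively graded. It serves
  -- only as a target for the universal property, and no coproduct on it is needed.
  deg := wordDeg X
  isInternal := isInternal_wordDeg X
  graft := graftWord X
  graft_of_lt := fun x _ hy hi => graftWord_of_lt X x hy hi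
  graft_mem := by
    intro i n m x y hx hy hi
    rw [graftWord_of_le X x hy hi]
    exact insertWord_mem X hx hy
  graft_assoc := by
    intro i j m r x y z hy hz hi hj
    induction x using words_induction with
    | add x x' h h' => simp only [map_add, LinearMap.add_apply, h, h']
    | smul a x h => simp only [map_smul, LinearMap.smul_apply, h]
    | word l =>
    rw [graftWord_of_le X _ hy hi, graftWord_of_le X _ hz hj, graftWord_of_le X _ hz hj,
      graftWord_of_le X _ (insertWord_mem X hy hz) (by omega), insertWord_insertWord X _ hy hi]
  graft_comm := by
    intro i j n r x y z hx hz hi hj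
    induction y using words_induction with
    | add x x' h h' => simp only [map_add, LinearMap.add_apply, h, h']
    | smul a x h => simp only [map_smul, LinearMap.smul_apply, h]
    | word l =>
    rw [graftWord_of_le X _ hz hj, graftWord_of_le X _ hz (by omega),
      graftWord_of_le X _ (insertWord_mem X (single_mem_wordDeg X l) hz) (by omega),
      graftWord_of_le X _ (insertWord_mem X hx hz) (by omega), insertWord_comm X hx hi]

/-- The part of a linear combination of words given by the words of length one. -/
noncomputable def letterPart : (List ι →₀ K) →ₗ[K] V :=
  Finsupp.linearCombination K fun l => match l with
    | [a] => X.basis a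
    | _ => 0

theorem letterPart_consWord_nil (v : V) :
    letterPart X (consWord X v (Finsupp.single [] 1)) = v := by
  induction v using X.induction with
  | zero => simp
  | add x y h h' => simp only [map_add, LinearMap.add_apply, h, h']
  | smul a x h => simp only [map_smul, LinearMap.smul_apply, h]
  | basis a => simp [consWord_basis, letterPart]

/-- The positive degree keeps the empty word out of `t`, so every word in the product has at least
two letters. -/
theorem letterPart_consWord (v : V) {n : ℕ} (hn : 0 < n) {t : List ι →₀ K}
    (ht : t ∈ wordDeg X n) : letterPart X (consWord X v t) = 0 := by
  induction v using X.induction with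
  | zero => simp
  | add x y h h' => simp only [map_add, LinearMap.add_apply, h, h', add_zero]
  | smul a x h => simp only [map_smul, LinearMap.smul_apply, h, smul_zero]
  | basis a =>
  refine wordDeg_induction X (p := fun t => letterPart X (consWord X (X.basis a) t) = 0)
    (by simp) (fun x y h h' => ?_) (fun a x h => ?_) (fun l hl => ?_) ht
  · simp only [map_add, h, h', add_zero]
  · simp only [map_smul, h, smul_zero]
  cases l with
  | nil => simp only [List.map_nil, List.sum_nil] at hl; omega
  | cons b l => simp [consWord_basis, letterPart]

end PrimGrAlgebra

end GraftingCMM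

namespace GraftingCMM

/-! ### The enveloping bialgebra as a bialgebra of words -/

namespace PrimGrAlgebra

variable {K V ι : Type*} [Field K] [AddCommGroup V] [Module K V] (P : PrimGrAlgebra K V)
  (X : HomogeneousBasis P.toGrading ι)

/-- The canonical map from `V` to its enveloping bialgebra. -/
noncomputable def toEnvelop :
    V →ₗ[K] TreeSpace K X.degree ⧸ (P.free X).idealSpan (P.relations X) :=
  ((P.free X).idealSpan (P.relations X)).mkQ ∘ₗ P.incl X

theorem toEnvelop_mem {n : ℕ} {x : V} (hx : x ∈ P.deg n) :
    P.toEnvelop X x ∈ (P.envelop X).deg n :=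
  ⟨_, P.incl_mem X hx, rfl⟩

theorem comul_toEnvelop (x : V) : (P.envelop X).comul (P.toEnvelop X x) = 0 := by
  have h := P.incl_mem_prim X x
  rw [GraftingBialgebra.mem_prim] at h
  show TensorProduct.map _ _ ((P.free X).comul (P.incl X x)) = 0
  rw [h, map_zero]

/-- The ideal imposes this for pairs of basis vectors; bilinearity gives the general case. -/
theorem bracket_toEnvelop (x y : V) :
    (P.envelop X).bracket (P.toEnvelop X x) (P.toEnvelop X y) =
      P.toEnvelop X (P.bracket x y) := by
  induction x using X.induction with
  | zero => simp
  | add x x' h h' => simp only [map_add, LinearMap.add_apply, h, h']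
  | smul a x h => simp only [map_smul, LinearMap.smul_apply, h]
  | basis i =>
  induction y using X.induction with
  | zero => simp
  | add x x' h h' => simp only [map_add, h, h']
  | smul a x h => simp only [map_smul, h]
  | basis j =>
  rw [(P.envelop X).bracket_of_mem (P.toEnvelop_mem X (X.mem i)), ← sub_eq_zero]
  have h := (P.free X).subset_idealSpan (P.relations X) (Or.inl ⟨i, j, rfl⟩)
  rw [(P.free X).bracket_of_mem (P.incl_basis_mem X i)] at h
  exact (Submodule.Quotient.mk_eq_zero _).2 h

theorem graft_toEnvelop_basis {p : ℕ} (i j : ι) (h1 : 1 ≤ p) (h2 : p < X.degree j) :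
    (P.envelop X).graft p (P.toEnvelop X (X.basis i)) (P.toEnvelop X (X.basis j)) =
      P.toEnvelop X (P.comp p (X.basis i) (X.basis j)) := by
  rw [← sub_eq_zero]
  exact (Submodule.Quotient.mk_eq_zero _).2
    ((P.free X).subset_idealSpan (P.relations X) (Or.inr ⟨i, j, p, h1, h2, rfl⟩))

theorem inner_toEnvelop (p : ℕ) (x y : V) :
    (P.envelop X).inner p (P.toEnvelop X x) (P.toEnvelop X y) =
      P.toEnvelop X (P.comp p x y) := by
  induction x using X.induction with
  | zero => simp
  | add x x' h h' => simp only [map_add, LinearMap.add_apply, h, h']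
  | smul a x h => simp only [map_smul, LinearMap.smul_apply, h]
  | basis i =>
  induction y using X.induction with
  | zero => simp
  | add x x' h h' => simp only [map_add, h, h']
  | smul a x h => simp only [map_smul, h]
  | basis j =>
  have hj := P.toEnvelop_mem X (X.mem j)
  by_cases h : 1 ≤ p ∧ p < X.degree j
  · rw [(P.envelop X).inner_of_mem _ hj h.1 h.2, P.graft_toEnvelop_basis X i j h.1 h.2]
  · rw [(P.envelop X).inner_of_not _ hj h, P.comp_of_not _ (X.mem j) h, map_zero]

/-- The universal property of the enveloping bialgebra. -/
theorem exists_envelop_lift {A : Type*} [AddCommGroup A] [Module K A] (G : GraftingAlgebra K A)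
    (f : V →ₗ[K] A) (hf : ∀ i, f (X.basis i) ∈ G.deg (X.degree i))
    (hb : ∀ i j, G.bracket (f (X.basis i)) (f (X.basis j)) =
      f (P.bracket (X.basis i) (X.basis j)))
    (hc : ∀ i j p, 1 ≤ p → p < X.degree j → G.graft p (f (X.basis i)) (f (X.basis j)) =
      f (P.comp p (X.basis i) (X.basis j))) :
    ∃ ψ : (TreeSpace K X.degree ⧸ (P.free X).idealSpan (P.relations X)) →ₗ[K] A,
      (∀ v, ψ (P.toEnvelop X v) = f v) ∧
      (∀ i x y, ψ ((P.envelop X).graft i x y) = G.graft i (ψ x) (ψ y)) ∧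
      ∀ n, ∀ x ∈ (P.envelop X).deg n, ψ x ∈ G.deg n := by
  let φ : TreeSpace K X.degree →ₗ[K] A := TreeSpace.lift G fun i => f (X.basis i)
  have hφ : ∀ v, φ (P.incl X v) = f v := by
    refine LinearMap.congr_fun (f := φ ∘ₗ P.incl X) (g := f) (X.basis.ext fun i => ?_)
    rw [LinearMap.comp_apply, incl_basis]
    exact TreeSpace.lift_corolla i
  have hg : ∀ i x y, φ ((P.free X).graft i x y) = G.graft i (φ x) (φ y) :=
    TreeSpace.lift_graft hf
  have hle : (P.free X).idealSpan (P.relations X) ≤ LinearMap.ker φ := by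
    refine (P.free X).idealSpan_le (fun i a x hx => ?_) ?_
    · rw [LinearMap.mem_ker] at hx
      simp [hg, hx]
    · rintro r (⟨i, j, rfl⟩ | ⟨i, j, p, h1, h2, rfl⟩)
      · rw [SetLike.mem_coe, LinearMap.mem_ker,
          (P.free X).bracket_of_mem (P.incl_basis_mem X i), map_sub, map_sub, hg, hg, hφ, hφ, hφ,
          ← G.bracket_of_mem (hf i), hb, sub_self]
      · rw [SetLike.mem_coe, LinearMap.mem_ker, map_sub, hg, hφ, hφ, hφ, hc i j p h1 h2,
          sub_self]
  refine ⟨Submodule.liftQ _ φ hle, hφ, ?_, ?_⟩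
  · intro i x y
    obtain ⟨x, rfl⟩ := Submodule.mkQ_surjective _ x
    obtain ⟨y, rfl⟩ := Submodule.mkQ_surjective _ y
    exact hg i x y
  · rintro n _ ⟨x, hx, rfl⟩
    exact TreeSpace.lift_mem hf hx

/-! ### Products of letters span the enveloping bialgebra -/

/-- The product of the letters of the word `a :: l` in the enveloping bialgebra. -/
noncomputable def monomial :
    ι → List ι → TreeSpace K X.degree ⧸ (P.free X).idealSpan (P.relations X)
  | a, [] => P.toEnvelop X (X.basis a)
  | a, b :: l => (P.envelop X).graft 0 (P.toEnvelop X (X.basis a)) (monomial b l)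

theorem monomial_mem (a : ι) (l : List ι) :
    P.monomial X a l ∈ (P.envelop X).deg (X.degree a + (l.map X.degree).sum) := by
  induction l generalizing a with
  | nil => exact P.toEnvelop_mem X (X.mem a)
  | cons b l ih =>
    exact (P.envelop X).graft_mem (P.toEnvelop_mem X (X.mem a)) (ih b) (Nat.zero_le _)

/-- The span of the monomials. -/
noncomputable def monomialSpan :
    Submodule K (TreeSpace K X.degree ⧸ (P.free X).idealSpan (P.relations X)) :=
  Submodule.span K (Set.range fun q : ι × List ι => P.monomial X q.1 q.2)

theorem monomialSpan_induction
    {p : TreeSpace K X.degree ⧸ (P.free X).idealSpan (P.relations X) → Prop}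
    (zero : p 0) (add : ∀ x y, p x → p y → p (x + y)) (smul : ∀ (a : K) x, p x → p (a • x))
    (mem : ∀ a l, p (P.monomial X a l)) {x} (hx : x ∈ P.monomialSpan X) : p x := by
  refine Submodule.span_induction (p := fun x _ => p x) ?_ zero (fun x y _ _ => add x y)
    (fun a x _ => smul a x) hx
  rintro _ ⟨q, rfl⟩
  exact mem q.1 q.2

theorem monomial_mem_monomialSpan (a : ι) (l : List ι) :
    P.monomial X a l ∈ P.monomialSpan X :=
  Submodule.subset_span ⟨(a, l), rfl⟩

theorem toEnvelop_mem_monomialSpan (v : V) : P.toEnvelop X v ∈ P.monomialSpan X := by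
  induction v using X.induction with
  | zero => simp
  | add x x' h h' => rw [map_add]; exact Submodule.add_mem _ h h'
  | smul a x h => rw [map_smul]; exact Submodule.smul_mem _ _ h
  | basis i => exact P.monomial_mem_monomialSpan X i []

theorem graft_zero_mem_monomialSpan (v : V) {y} (hy : y ∈ P.monomialSpan X) :
    (P.envelop X).graft 0 (P.toEnvelop X v) y ∈ P.monomialSpan X := by
  induction v using X.induction with
  | zero => simp
  | add x x' h h' =>
    simp only [map_add, LinearMap.add_apply]
    exact Submodule.add_mem _ h h'
  | smul a x h =>
    simp only [map_smul, LinearMap.smul_apply]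
    exact Submodule.smul_mem _ _ h
  | basis i =>
  refine P.monomialSpan_induction X
    (p := fun y => (P.envelop X).graft 0 (P.toEnvelop X (X.basis i)) y ∈ P.monomialSpan X)
    (by simp) (fun x y h h' => ?_) (fun a x h => ?_) (fun a l => ?_) hy
  · rw [map_add]; exact Submodule.add_mem _ h h'
  · rw [map_smul]; exact Submodule.smul_mem _ _ h
  · exact P.monomial_mem_monomialSpan X i (a :: l)

/-- Insertion of a letter into a letter, followed by a product. -/
theorem graft_toEnvelop_basis_eq (i : ℕ) (a b : ι) (hi : 1 ≤ i) (hi' : i ≤ X.degree b) :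
    ∃ v, (P.envelop X).graft i (P.toEnvelop X (X.basis a)) (P.toEnvelop X (X.basis b)) =
        P.toEnvelop X v ∨
      (P.envelop X).graft i (P.toEnvelop X (X.basis a)) (P.toEnvelop X (X.basis b)) =
        P.toEnvelop X v + (P.envelop X).graft 0 (P.toEnvelop X (X.basis b))
          (P.toEnvelop X (X.basis a)) := by
  rcases hi'.lt_or_eq with h | rfl
  · exact ⟨_, Or.inl (P.graft_toEnvelop_basis X a b hi h)⟩
  · refine ⟨P.bracket (X.basis b) (X.basis a), Or.inr ?_⟩
    rw [← bracket_toEnvelop, (P.envelop X).bracket_of_mem (P.toEnvelop_mem X (X.mem b)),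
      sub_add_cancel]

/-- If the place belongs to the first letter `b`, associativity reduces the insertion to one into
`b`, where the relations apply. If it lies further right, commutation moves the insertion into the
shorter product behind `b`. -/
theorem graft_letter_mem_monomialSpan (i : ℕ) (a : ι) {y} (hy : y ∈ P.monomialSpan X) :
    (P.envelop X).graft i (P.toEnvelop X (X.basis a)) y ∈ P.monomialSpan X := by
  have ha := P.toEnvelop_mem X (X.mem a)
  refine P.monomialSpan_induction X
    (p := fun y => (P.envelop X).graft i (P.toEnvelop X (X.basis a)) y ∈ P.monomialSpan X)
    (by simp) (fun x y h h' => ?_) (fun a x h => ?_) (fun b l => ?_) hy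
  · rw [map_add]; exact Submodule.add_mem _ h h'
  · rw [map_smul]; exact Submodule.smul_mem _ _ h
  clear hy
  induction l generalizing b i with
  | nil =>
    have hb := P.toEnvelop_mem X (X.mem b)
    rw [monomial]
    rcases Nat.eq_zero_or_pos i with rfl | hi
    · exact P.graft_zero_mem_monomialSpan X _ (P.toEnvelop_mem_monomialSpan X _)
    rcases lt_or_ge (X.degree b) i with h | h
    · rw [(P.envelop X).graft_of_lt _ hb h]
      exact Submodule.zero_mem _
    obtain ⟨v, hv | hv⟩ := P.graft_toEnvelop_basis_eq X i a b hi h <;> rw [hv]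
    · exact P.toEnvelop_mem_monomialSpan X v
    · exact Submodule.add_mem _ (P.toEnvelop_mem_monomialSpan X v)
        (P.graft_zero_mem_monomialSpan X _ (P.toEnvelop_mem_monomialSpan X _))
  | cons c l ih =>
    have hb := P.toEnvelop_mem X (X.mem b)
    have hl := P.monomial_mem X c l
    have hl' := P.monomial_mem_monomialSpan X c l
    rcases Nat.eq_zero_or_pos i with rfl | hi
    · exact P.graft_zero_mem_monomialSpan X _ (P.monomial_mem_monomialSpan X b _)
    rw [monomial]
    rcases lt_or_ge (X.degree b) i with h | h
    · rcases lt_or_ge (X.degree c + (l.map X.degree).sum) (i - X.degree b) with h' | h'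
      · rw [(P.envelop X).graft_of_lt _
          ((P.envelop X).graft_mem hb hl (Nat.zero_le _)) (by omega)]
        exact Submodule.zero_mem _
      -- Commutation used backwards: the factor `b` at place `0` comes out in front, and `a` goes to
      -- place `i - X.degree b` of the rest.
      · have := (P.envelop X).graft_comm (P.toEnvelop X (X.basis a)) hb hl
          (show 0 < i - X.degree b by omega) h'
        rw [Nat.sub_add_cancel h.le] at this
        rw [← this]
        exact P.graft_zero_mem_monomialSpan X _ (ih _ _)
    · have := (P.envelop X).graft_assoc (P.toEnvelop X (X.basis a)) hb hl h (Nat.zero_le _)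
      rw [add_zero] at this
      rw [← this]
      obtain ⟨v, hv | hv⟩ := P.graft_toEnvelop_basis_eq X i a b hi h <;> rw [hv]
      · exact P.graft_zero_mem_monomialSpan X _ hl'
      · rw [map_add, LinearMap.add_apply,
          (P.envelop X).graft_assoc _ ha hl (Nat.zero_le _) (Nat.zero_le _)]
        exact Submodule.add_mem _ (P.graft_zero_mem_monomialSpan X _ hl')
          (P.graft_zero_mem_monomialSpan X _ (P.graft_zero_mem_monomialSpan X _ hl'))

/-- By associativity the letters of a product are inserted into `y` one by one, all at place `i`. -/
theorem graft_mem_monomialSpan (i : ℕ) {x y} (hx : x ∈ P.monomialSpan X)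
    (hy : y ∈ P.monomialSpan X) : (P.envelop X).graft i x y ∈ P.monomialSpan X := by
  refine P.monomialSpan_induction X
    (p := fun x => (P.envelop X).graft i x y ∈ P.monomialSpan X)
    (by simp) (fun x y h h' => ?_) (fun a x h => ?_) (fun b l => ?_) hx
  · rw [map_add]; exact Submodule.add_mem _ h h'
  · rw [map_smul]; exact Submodule.smul_mem _ _ h
  clear hx
  refine P.monomialSpan_induction X
    (p := fun y => (P.envelop X).graft i (P.monomial X b l) y ∈ P.monomialSpan X)
    (by simp) (fun x y h h' => ?_) (fun a x h => ?_) (fun c r => ?_) hy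
  · rw [map_add]; exact Submodule.add_mem _ h h'
  · rw [map_smul]; exact Submodule.smul_mem _ _ h
  have hr := P.monomial_mem X c r
  have hr' := P.monomial_mem_monomialSpan X c r
  rcases lt_or_ge (X.degree c + (r.map X.degree).sum) i with h | h
  · rw [(P.envelop X).graft_of_lt _ hr h]
    exact Submodule.zero_mem _
  induction l generalizing b with
  | nil => exact P.graft_letter_mem_monomialSpan X i b hr'
  | cons a l ih =>
    rw [monomial, (P.envelop X).graft_assoc _ (P.monomial_mem X a l) hr (Nat.zero_le _) h,
      zero_add]
    exact P.graft_letter_mem_monomialSpan X i b (ih a)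

theorem monomialSpan_eq_top : P.monomialSpan X = ⊤ := by
  have h := TreeSpace.eq_top_of_graft_mem ((P.monomialSpan X).comap
    ((P.free X).idealSpan (P.relations X)).mkQ) (fun i => ?_)
    (fun i x hx y hy => P.graft_mem_monomialSpan X i hx hy)
  · rw [eq_top_iff]
    rintro x -
    obtain ⟨x, rfl⟩ := Submodule.mkQ_surjective _ x
    have hx : x ∈ (⊤ : Submodule K (TreeSpace K X.degree)) := trivial
    rw [← h] at hx
    exact hx
  · rw [← incl_basis]
    exact P.toEnvelop_mem_monomialSpan X (X.basis i)

/-- The enveloping bialgebra is spanned by the products of elements of `V`. -/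
theorem envelop_induction
    {p : TreeSpace K X.degree ⧸ (P.free X).idealSpan (P.relations X) → Prop}
    (add : ∀ x y, p x → p y → p (x + y)) (smul : ∀ (a : K) x, p x → p (a • x))
    (mem : ∀ v, p (P.toEnvelop X v))
    (mul : ∀ v y, p y → p ((P.envelop X).graft 0 (P.toEnvelop X v) y)) (x) : p x := by
  have hx : x ∈ P.monomialSpan X := by
    rw [monomialSpan_eq_top]; trivial
  refine P.monomialSpan_induction X (by simpa using mem 0) add smul (fun a l => ?_) hx
  induction l generalizing a with
  | nil => exact mem _
  | cons b l ih => exact mul _ _ (ih b)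

/-! ### The projection onto `V` and the primitive elements of the envelope -/

/-- The projection of the enveloping bialgebra onto `V` that vanishes on products. -/
theorem exists_envelop_proj :
    ∃ p : (TreeSpace K X.degree ⧸ (P.free X).idealSpan (P.relations X)) →ₗ[K] V,
      (∀ v, p (P.toEnvelop X v) = v) ∧
      ∀ v y, p ((P.envelop X).graft 0 (P.toEnvelop X v) y) = 0 := by
  -- Elements of `V` are sent to combinations of one-letter words.
  let f : V →ₗ[K] (List ι →₀ K) := (consWord X).flip (Finsupp.single [] 1)
  have hf : ∀ {n v}, v ∈ P.deg n → f v ∈ (wordAlgebra X).deg n := by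
    intro n v hv
    have h := consWord_mem X hv (single_mem_wordDeg X [])
    rw [List.map_nil, List.sum_nil, add_zero] at h
    exact h
  have hg : ∀ {i n} (v : V) {y}, y ∈ (wordAlgebra X).deg n → i ≤ n →
      (wordAlgebra X).graft i (f v) y = insertLetter X i v y := by
    intro i n v y hy hi
    refine (graftWord_of_le X (f v) hy hi).trans ?_
    rw [LinearMap.flip_apply, insertWord_consWord, insertWord_nil, mul_one]
  -- Both relations are `insertLetter_consWord` with empty tail. At the last place of a letter x,
  -- the two-letter term x y cancels against x •₀ y and leaves the bracket.
  obtain ⟨ψ, h1, h2, h3⟩ := P.exists_envelop_lift X (wordAlgebra X) f (fun i => hf (X.mem i))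
    (fun i j => by
      have hi := X.mem i
      rw [(wordAlgebra X).bracket_of_mem (hf hi), hg _ (hf hi) le_rfl,
        hg _ (hf (X.mem j)) (Nat.zero_le _), insertLetter_zero, LinearMap.flip_apply,
        LinearMap.flip_apply, insertLetter_consWord X (P.degree_pos X i) _ hi, if_pos le_rfl,
        Nat.sub_self, insertLetter_zero, add_sub_cancel_right, P.act_self _ hi,
        LinearMap.flip_apply])
    (fun i j p hp hp' => by
      have hj := X.mem j
      rw [hg _ (hf hj) hp'.le, LinearMap.flip_apply, insertLetter_consWord X hp _ hj,
        if_neg (by omega), add_zero, P.act_of_gt _ hj hp', LinearMap.flip_apply])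
  refine ⟨letterPart X ∘ₗ ψ, fun v => ?_, fun v y => ?_⟩
  · rw [LinearMap.comp_apply, h1]
    exact letterPart_consWord_nil X v
  · induction y using (P.envelop X).toGrading.homogeneous_induction with
    | add y y' h h' => rw [map_add, map_add, h, h', add_zero]
    | mem n y hy =>
    -- Degree `0` is trivial in the envelope, though not among the words; so the image of a nonzero
    -- homogeneous `y` contains no empty word.
    rcases Nat.eq_zero_or_pos n with rfl | hn
    · rw [(P.envelop X).deg_zero, Submodule.mem_bot] at hy
      simp [hy]
    · have := h3 n y hy
      rw [LinearMap.comp_apply, h2, h1, hg v this (Nat.zero_le _), insertLetter_zero]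
      exact letterPart_consWord X v hn this

/-- As `v` is primitive, one sum of the coproduct formula disappears. In what is left, every left
tensor factor is `v` itself or a product beginning with `v`, and the projection onto `V` tells these
apart. -/
theorem comul_graft_zero_toEnvelop (v : V)
    (y : TreeSpace K X.degree ⧸ (P.free X).idealSpan (P.relations X)) :
    (P.envelop X).comul ((P.envelop X).graft 0 (P.toEnvelop X v) y) =
      P.toEnvelop X v ⊗ₜ[K] y +
        TensorProduct.map ((P.envelop X).graft 0 (P.toEnvelop X v)) LinearMap.id
          ((P.envelop X).comul y) := by
  rw [(P.envelop X).comul_graft_zero, comul_toEnvelop, map_zero, zero_add]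

/-- An element is recovered from its component in `V` and its coproduct. -/
theorem exists_envelop_reconstruction :
    ∃ p : (TreeSpace K X.degree ⧸ (P.free X).idealSpan (P.relations X)) →ₗ[K] V,
      (∀ v, p (P.toEnvelop X v) = v) ∧
      ∀ x, P.toEnvelop X (p x) + TensorProduct.lift ((P.envelop X).graft 0 ∘ₗ
        P.toEnvelop X ∘ₗ p) ((P.envelop X).comul x) = x := by
  obtain ⟨p, h1, h2⟩ := P.exists_envelop_proj X
  refine ⟨p, h1, fun x => ?_⟩
  induction x using P.envelop_induction X with
  | add x y h h' =>
    conv_rhs => rw [← h, ← h']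
    simp only [map_add]
    abel
  | smul a x h =>
    conv_rhs => rw [← h]
    simp only [map_smul, smul_add]
  | mem v => rw [h1, comul_toEnvelop, map_zero, add_zero]
  | mul v y h =>
    rw [h2, map_zero, zero_add, comul_graft_zero_toEnvelop, map_add, TensorProduct.lift.tmul,
      LinearMap.comp_apply, LinearMap.comp_apply, h1]
    -- The left factors are products v •₀ a, which `p` kills.
    have : ∀ t, TensorProduct.lift ((P.envelop X).graft 0 ∘ₗ P.toEnvelop X ∘ₗ p)
        (TensorProduct.map ((P.envelop X).graft 0 (P.toEnvelop X v)) LinearMap.id t) = 0 := by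
      intro t
      induction t using TensorProduct.induction_on with
      | zero => simp
      | add s s' h h' => rw [map_add, map_add, h, h', add_zero]
      | tmul a b => simp [h2]
    rw [this, add_zero]

theorem toEnvelop_injective : Function.Injective (P.toEnvelop X) := by
  obtain ⟨p, h, -⟩ := P.exists_envelop_proj X
  exact Function.LeftInverse.injective h

/-- For a primitive `x` the reconstruction formula has no coproduct term and exhibits `x` as the
image of `p x`. -/
theorem range_toEnvelop : LinearMap.range (P.toEnvelop X) = (P.envelop X).prim := by
  ext x
  constructor
  · rintro ⟨v, rfl⟩
    exact P.comul_toEnvelop X v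
  · intro hx
    obtain ⟨p, -, h⟩ := P.exists_envelop_reconstruction X
    refine ⟨p x, ?_⟩
    have := h x
    rwa [(P.envelop X).mem_prim.1 hx, map_zero, add_zero] at this

/-- `V` is isomorphic to the primitive part of its enveloping bialgebra. -/
noncomputable def isoPrimEnvelop : P.Iso (P.envelop X).primAlg where
  toLinearEquiv := LinearEquiv.ofBijective
    ((P.toEnvelop X).codRestrict (P.envelop X).prim (P.comul_toEnvelop X))
    ⟨fun x y h => P.toEnvelop_injective X (congrArg Subtype.val h), fun x => by
      obtain ⟨v, hv⟩ := (P.range_toEnvelop X).ge x.2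
      exact ⟨v, Subtype.ext hv⟩⟩
  map_mem _ _ hx := P.toEnvelop_mem X hx
  map_bracket x y := Subtype.ext (P.bracket_toEnvelop X x y).symm
  map_comp p x y := Subtype.ext (P.inner_toEnvelop X p x y).symm

end PrimGrAlgebra

end GraftingCMM

namespace GraftingCMM

theorem Grading.map_proj {K V V' : Type*} [Field K] [AddCommGroup V] [Module K V]
    [AddCommGroup V'] [Module K V'] (G : Grading K V) (G' : Grading K V') (f : V →ₗ[K] V')
    (hf : ∀ n, ∀ x ∈ G.deg n, f x ∈ G'.deg n) (n : ℕ) (x : V) :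
    f (G.proj n x) = G'.proj n (f x) := by
  induction x using G.homogeneous_induction with
  | add x y h h' => simp only [map_add, h, h']
  | mem m x hx =>
  by_cases h : m = n
  · subst h
    rw [G.proj_of_mem hx, G'.proj_of_mem (hf _ _ hx)]
  · rw [G.proj_of_mem_ne hx h, G'.proj_of_mem_ne (hf _ _ hx) h, map_zero]

namespace GraftingBialgebra

variable {K A A' : Type*} [Field K] [AddCommGroup A] [Module K A] [AddCommGroup A'] [Module K A']
  (H : GraftingBialgebra K A)

/-! ### The primitive filtration -/

theorem filtration_succ_succ (p : ℕ) {x : A} : x ∈ H.filtration (p + 2) ↔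
    H.comul x ∈ LinearMap.range (TensorProduct.map (H.filtration (p + 1)).subtype
      (H.filtration (p + 1)).subtype) := Iff.rfl

theorem range_map_subtype_mono {S S' T T' : Submodule K A} (h : S ≤ S') (h' : T ≤ T') :
    LinearMap.range (TensorProduct.map S.subtype T.subtype) ≤
      LinearMap.range (TensorProduct.map S'.subtype T'.subtype) :=
  TensorProduct.range_map_mono (by simpa) (by simpa)

theorem filtration_le_succ (p : ℕ) : H.filtration p ≤ H.filtration (p + 1) := by
  induction p with
  | zero => exact bot_le
  | succ p ih =>
    intro x hx
    rw [filtration_succ_succ]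
    cases p with
    | zero =>
      rw [show H.comul x = 0 from hx]
      exact Submodule.zero_mem _
    | succ p => exact range_map_subtype_mono ih ih ((H.filtration_succ_succ p).1 hx)

theorem filtration_mono : Monotone H.filtration := monotone_nat_of_le_succ H.filtration_le_succ

/-- In Δ(w •₀ y) = w ⊗ y + ∑ (w •₀ y₁) ⊗ y₂ the factors y₁ and y₂ lie one level below `y`, so by
induction w •₀ y₁ is at most at the level of `y`. This is what makes the enveloping bialgebra
connected. -/
theorem graft_zero_mem_filtration {w : A} (hw : w ∈ H.prim) (p : ℕ) :
    ∀ y ∈ H.filtration (p + 1), H.graft 0 w y ∈ H.filtration (p + 2) := by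
  have hw' : ∀ p, w ∈ H.filtration (p + 1) := fun p =>
    H.filtration_mono (show 1 ≤ p + 1 by omega) hw
  induction p with
  | zero =>
    intro y hy
    rw [filtration_succ_succ, H.comul_graft_zero, H.mem_prim.1 hw, show H.comul y = 0 from hy,
      map_zero, map_zero, zero_add, add_zero]
    exact ⟨⟨w, hw⟩ ⊗ₜ ⟨y, hy⟩, rfl⟩
  | succ p ih =>
    intro y hy
    rw [filtration_succ_succ, H.comul_graft_zero, H.mem_prim.1 hw, map_zero, zero_add]
    refine Submodule.add_mem _ ⟨⟨w, hw' _⟩ ⊗ₜ ⟨y, hy⟩, rfl⟩ ?_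
    obtain ⟨t, ht⟩ := (H.filtration_succ_succ p).1 hy
    rw [← ht]
    clear hy ht
    induction t using TensorProduct.induction_on with
    | zero => simp
    | add s s' h h' => simp only [map_add]; exact Submodule.add_mem _ h h'
    | tmul a b =>
      exact ⟨⟨_, ih a a.2⟩ ⊗ₜ ⟨b, H.filtration_le_succ _ b.2⟩, rfl⟩

/-- A morphism of coalgebras on a connected bialgebra is injective if it is injective on the
primitive elements. -/
theorem injective_of_injective_prim (hH : H.IsConnected) (H' : GraftingBialgebra K A')
    (f : A →ₗ[K] A') (hf : ∀ x, H'.comul (f x) = TensorProduct.map f f (H.comul x))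
    (hp : ∀ x ∈ H.prim, f x = 0 → x = 0) : Function.Injective f := by
  have key : ∀ p, ∀ x ∈ H.filtration (p + 1), f x = 0 → x = 0 := by
    intro p
    induction p with
    | zero => exact hp
    | succ p ih =>
      intro x hx hfx
      obtain ⟨t, ht⟩ := (H.filtration_succ_succ p).1 hx
      have hi : Function.Injective (f ∘ₗ (H.filtration (p + 1)).subtype) := by
        rw [injective_iff_map_eq_zero]
        exact fun y hy => Subtype.ext (ih y y.2 hy)
      have h := hf x
      rw [hfx, map_zero, ← ht, TensorProduct.map_map] at h
      -- Over a field the tensor square of an injective map is injective. Hence Δx = 0, and `x`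
      -- falls under the hypothesis on primitive elements.
      have ht0 : t = 0 := TensorProduct.map_injective_of_flat_flat _ _ hi hi
        (h.symm.trans (map_zero _).symm)
      rw [ht0, map_zero] at ht
      exact hp x ht.symm hfx
  rw [injective_iff_map_eq_zero]
  intro x hx
  obtain ⟨p, hp1, hxp⟩ := hH x
  obtain ⟨q, rfl⟩ : ∃ q, p = q + 1 := ⟨p - 1, by omega⟩
  exact key q x hxp hx

/-- A subspace `R` of a connected bialgebra that contains the primitive elements is everything
if it is closed under products with them and its elements are recovered from a primitive
component and their coproduct. -/
theorem eq_top_of_reconstruction (hH : H.IsConnected) (R : Submodule K A) (hR : H.prim ≤ R)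
    (hR' : ∀ w ∈ H.prim, ∀ y ∈ R, H.graft 0 w y ∈ R) (q : A →ₗ[K] A) (hq : ∀ x, q x ∈ H.prim)
    (hrec : ∀ x ∈ R, q x + TensorProduct.lift (H.graft 0 ∘ₗ q) (H.comul x) = x) : R = ⊤ := by
  set μ := TensorProduct.lift (H.graft 0 ∘ₗ q) with hμ
  -- Since q(a) is primitive, Δ(q(a) •₀ b) = q(a) ⊗ b + ∑ (q(a) •₀ b₁) ⊗ b₂.
  have hcomul : ∀ t, H.comul (μ t) = TensorProduct.map q LinearMap.id t +
      TensorProduct.map μ LinearMap.id ((TensorProduct.assoc K A A A).symm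
        (TensorProduct.map LinearMap.id H.comul t)) := by
    intro t
    induction t using TensorProduct.induction_on with
    | zero => simp
    | add s s' h h' => simp only [map_add, h, h']; abel
    | tmul a b =>
      rw [hμ, TensorProduct.lift.tmul, LinearMap.comp_apply, H.comul_graft_zero,
        H.mem_prim.1 (hq a), map_zero, zero_add, TensorProduct.map_tmul, TensorProduct.map_tmul]
      congr 1
      generalize H.comul b = t
      rw [LinearMap.id_apply]
      induction t using TensorProduct.induction_on with
      | zero => simp
      | add s s' h h' => simp only [map_add, TensorProduct.tmul_add, h, h']
      | tmul b c => simp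
  have key : ∀ p, H.filtration (p + 1) ≤ R := by
    intro p
    induction p with
    | zero => exact hR
    | succ p ih =>
      intro x hx
      obtain ⟨t, ht⟩ := (H.filtration_succ_succ p).1 hx
      -- Coassociativity turns the right side of `hcomul` at Δx into ((q + μΔ) ⊗ id)(Δx). By
      -- induction the left factors of Δx lie in `R`, where q + μΔ is the identity.
      have h1 : H.comul (μ (H.comul x)) = H.comul x := by
        rw [hcomul, ← H.coassoc, LinearEquiv.symm_apply_apply, ← ht]
        clear hx ht
        induction t using TensorProduct.induction_on with
        | zero => simp
        | add s s' h h' =>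
          conv_rhs => rw [map_add, ← h, ← h']
          simp only [map_add]
          abel
        | tmul a b =>
          simp only [TensorProduct.map_tmul, Submodule.subtype_apply, LinearMap.id_apply]
          rw [← TensorProduct.add_tmul, hrec _ (ih a.2)]
      have h2 : μ (H.comul x) ∈ R := by
        rw [← ht]
        clear hx ht h1
        induction t using TensorProduct.induction_on with
        | zero => simp
        | add s s' h h' => simp only [map_add]; exact R.add_mem h h'
        | tmul a b =>
          rw [TensorProduct.map_tmul, hμ, TensorProduct.lift.tmul]
          exact hR' _ (hq _) _ (ih b.2)
      have h3 : x - μ (H.comul x) ∈ R := hR (by rw [mem_prim, map_sub, h1, sub_self])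
      simpa using R.add_mem h3 h2
  rw [eq_top_iff]
  rintro x -
  obtain ⟨p, hp1, hxp⟩ := hH x
  obtain ⟨q, rfl⟩ : ∃ q, p = q + 1 := ⟨p - 1, by omega⟩
  exact key q hxp

end GraftingBialgebra

/-! ### Connectedness of the enveloping bialgebra -/

namespace PrimGrAlgebra

variable {K V ι : Type*} [Field K] [AddCommGroup V] [Module K V] (P : PrimGrAlgebra K V)
  (X : HomogeneousBasis P.toGrading ι)

theorem isConnected_envelop : (P.envelop X).IsConnected := by
  intro x
  induction x using P.envelop_induction X with
  | add x y h h' =>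
    obtain ⟨p, hp, hx⟩ := h
    obtain ⟨q, -, hy⟩ := h'
    exact ⟨max p q, by omega, Submodule.add_mem _
      ((P.envelop X).filtration_mono (le_max_left _ _) hx)
      ((P.envelop X).filtration_mono (le_max_right _ _) hy)⟩
  | smul a x h =>
    obtain ⟨p, hp, hx⟩ := h
    exact ⟨p, hp, Submodule.smul_mem _ _ hx⟩
  | mem v => exact ⟨1, le_rfl, P.comul_toEnvelop X v⟩
  | mul v y h =>
    obtain ⟨p, hp, hy⟩ := h
    obtain ⟨q, rfl⟩ : ∃ q, p = q + 1 := ⟨p - 1, by omega⟩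
    exact ⟨q + 2, by omega,
      (P.envelop X).graft_zero_mem_filtration (P.comul_toEnvelop X v) q y hy⟩

end PrimGrAlgebra

/-! ### The comparison of `H` with the envelope of its primitive part -/

namespace GraftingBialgebra

variable {K A ι : Type*} [Field K] [AddCommGroup A] [Module K A] (H : GraftingBialgebra K A)
  (X : HomogeneousBasis H.primAlg.toGrading ι)

/-- The canonical morphism from the enveloping bialgebra of `Prim(H)` to `H`. -/
theorem exists_envelop_prim_hom :
    ∃ ψ : (TreeSpace K X.degree ⧸ (H.primAlg.free X).idealSpan (H.primAlg.relations X)) →ₗ[K] A,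
      (∀ v, ψ (H.primAlg.toEnvelop X v) = v) ∧
      (∀ i x y, ψ ((H.primAlg.envelop X).graft i x y) = H.graft i (ψ x) (ψ y)) ∧
      (∀ n, ∀ x ∈ (H.primAlg.envelop X).deg n, ψ x ∈ H.deg n) ∧
      ∀ x, H.comul (ψ x) = TensorProduct.map ψ ψ ((H.primAlg.envelop X).comul x) := by
  obtain ⟨ψ, h1, h2, h3⟩ := H.primAlg.exists_envelop_lift X H.toGraftingAlgebra H.prim.subtype
    (fun i => X.mem i) (fun i j => rfl)
    (fun i j p hp hp' => (H.inner_of_mem _ (X.mem j) hp hp').symm)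
  replace h1 : ∀ v, ψ (H.primAlg.toEnvelop X v) = v := h1
  refine ⟨ψ, h1, h2, h3, fun x => ?_⟩
  -- Products v •₀ y with `v` primitive span the envelope together with `V`, so of the three
  -- coproduct formulas only the one for •₀ has to be compared.
  induction x using H.primAlg.envelop_induction X with
  | add x y h h' => simp only [map_add, h, h']
  | smul a x h => simp only [map_smul, h]
  | mem v => rw [h1, H.primAlg.comul_toEnvelop, map_zero]; exact v.2
  | mul v y h =>
    rw [h2, h1, H.primAlg.comul_graft_zero_toEnvelop, H.comul_graft_zero, H.mem_prim.1 v.2,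
      map_zero, zero_add, map_add, TensorProduct.map_tmul, h1, h]
    congr 1
    generalize (H.primAlg.envelop X).comul y = t
    induction t using TensorProduct.induction_on with
    | zero => simp
    | add s s' h h' => simp only [map_add, h, h']
    | tmul a b => simp [h1, h2]

/-- A connected grafting bialgebra is the enveloping bialgebra of its primitive part. -/
theorem nonempty_iso_envelop_prim (hH : H.IsConnected) :
    Nonempty (H.Iso (H.primAlg.envelop X)) := by
  obtain ⟨ψ, h1, h2, h3, h4⟩ := H.exists_envelop_prim_hom X
  have hinj : Function.Injective ψ := by
    refine (H.primAlg.envelop X).injective_of_injective_prim (H.primAlg.isConnected_envelop X) H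
      ψ h4 fun x hx h => ?_
    -- Part b) enters here: the primitive elements of the envelope come from Prim(H), where `ψ` is
    -- the inclusion.
    rw [← H.primAlg.range_toEnvelop X] at hx
    obtain ⟨v, rfl⟩ := hx
    rw [h1] at h
    rw [show v = 0 from Subtype.ext h, map_zero]
  have hsurj : LinearMap.range ψ = ⊤ := by
    obtain ⟨p, -, hp⟩ := H.primAlg.exists_envelop_reconstruction X
    -- A merely linear left inverse suffices: it extends the projection `p` from the image of `ψ` to
    -- all of `H`, and the reconstruction formula is needed only on the image.
    obtain ⟨r, hr⟩ := ψ.exists_leftInverse_of_injective (LinearMap.ker_eq_bot.2 hinj)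
    refine H.eq_top_of_reconstruction hH _ (fun x hx => ⟨_, h1 ⟨x, hx⟩⟩) ?_
      (H.prim.subtype ∘ₗ p ∘ₗ r) (fun x => (p (r x)).2) ?_
    · rintro w hw _ ⟨y, rfl⟩
      exact ⟨_, (h2 0 (H.primAlg.toEnvelop X ⟨w, hw⟩) y).trans (by rw [h1])⟩
    · rintro _ ⟨y, rfl⟩
      have hr' : ∀ y, r (ψ y) = y := LinearMap.congr_fun hr
      conv_rhs => rw [← hp y, map_add, h1]
      rw [h4]
      congr 1
      · simp [hr']
      generalize (H.primAlg.envelop X).comul y = t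
      induction t using TensorProduct.induction_on with
      | zero => simp
      | add s s' h h' => simp only [map_add, h, h']
      | tmul a b => simp [h1, h2, hr']
  let e := LinearEquiv.ofBijective ψ ⟨hinj, LinearMap.range_eq_top.1 hsurj⟩
  have he : ∀ x, ψ (e.symm x) = x := e.apply_symm_apply
  refine ⟨⟨e.symm, fun n x hx => ?_, fun i x y => ?_, fun x => ?_⟩⟩
  -- The inverse preserves degrees because `ψ` commutes with the projections and is injective.
  · have h : (H.primAlg.envelop X).proj n (e.symm x) = e.symm x := by
      apply hinj
      rw [Grading.map_proj _ H.toGrading ψ h3, he, H.proj_of_mem hx]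
    have hmem := (H.primAlg.envelop X).proj_mem n (e.symm x)
    rwa [h] at hmem
  · apply hinj
    rw [h2, he, he, he]
  · apply TensorProduct.map_injective_of_flat_flat _ _ hinj hinj
    rw [← h4, he, TensorProduct.map_map]
    have : ψ ∘ₗ e.symm.toLinearMap = LinearMap.id := LinearMap.ext he
    rw [this, TensorProduct.map_id, LinearMap.id_apply]

end GraftingBialgebra

end GraftingCMM

theorem mainTheorem5 :
    (∀ {K H ι : Type*} [Field K] [AddCommGroup H] [Module K H]
      (B : GraftingCMM.GraftingBialgebra K H), B.IsConnected →
      ∀ X : GraftingCMM.HomogeneousBasis B.primAlg.toGrading ι,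
        Nonempty (B.Iso (B.primAlg.envelop X))) ∧
    (∀ {K V ι : Type*} [Field K] [AddCommGroup V] [Module K V]
      (P : GraftingCMM.PrimGrAlgebra K V)
      (X : GraftingCMM.HomogeneousBasis P.toGrading ι),
        Nonempty (P.Iso (P.envelop X).primAlg)) :=
  ⟨fun B hB X => B.nonempty_iso_envelop_prim X hB, fun P X => ⟨P.isoPrimEnvelop X⟩⟩
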